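/- Let $v\ge 4$ be an integer, $v'=\lfloor v/2\rfloor$, $z=v(v-1)/2$, $Q=v+2z=v^2$. Let $N_v$ be the free two-step nilpotent Lie group on $v$ generators, with Lie algebra $\mathcal V\oplus\mathcal Z$, where $X_1,\dots,X_v$ is the canonical basis of $\mathcal V=\mathbb R^v$ and $X_{i,j}=[X_i,X_j]$, $i<j$, that of $\mathcal Z=\mathbb R^z$ (both taken orthonormal). Write $s.\exp(X+A)=\exp(sX+s^2A)$ for the dilations and $|\exp(X+A)|=(|X|^4+|A|^2)^{1/4}$ for the Korányi norm. Let $dn$ be the Haar measure given by Lebesgue measure in these coordinates, and $\mu$ the measure on $S_1=\{|n|=1\}$ with $\int_{N_v} f\,dn=\int_0^\infty\int_{S_1}f(r.n)\,d\mu(n)\,r^{Q-1}dr$. Put $\langle\mu_s,f\rangle=\int_{S_1}f(s.n)\,d\mu(n)$. Identify $\mathcal Z$ with the skew-symmetric $v\times v$ matrices, $X_{i,j}\leftrightarrow E_{ij}-E_{ji}$, and let $k\in O(v)$ act on $N_v$ by $k.\exp(X+A)=\exp(kX+kAk^{-1})$. Let $dk$ be the Haar probability measure of $O(v)$. Let $\mathcal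 P$ be the set of triples $(r,\Lambda,l)$ with $\Lambda=(\lambda_1,\dots,\lambda_{v'})$, $\lambda_1>\dots>\lambda_{v'}>0$, $l\in\mathbb N^{v'}$, and $r>0$ if $v$ is odd, $r=0$ if $v$ is even. For $(r,\Lambda,l)\in\mathcal P$ put $$\phi^{r,\Lambda,l}(n)=\int_{O(v)}\Theta^{r,\Lambda,l}(k.n)\,dk,\qquad \Theta^{r,\Lambda,l}(\exp(X+A))=e^{irx_v}\,e^{i\sum_{j=1}^{v'}\lambda_jA_{2j-1,2j}}\prod_{j=1}^{v'}\mathcal L_{l_j}\Big(\tfrac{\lambda_j}{2}(x_{2j-1}^2+x_{2j}^2)\Big),$$ where $X=\sum_i x_iX_i$, $A=\sum_{i<j}A_{i,j}X_{i,j}$, and $\mathcal L_n(x)=L_n^{0}(x)e^{-x/2}$ with $L_n^0$ the Laguerre polynomial of type $0$ and degree $n$. Let $h$ be an integer with $1\le h<(z-2)/2$. Then there is a constant $C>0$, depending only on $v$ and $h$, such that for every $\phi=\phi^{r,\Lambda,l}$ with $(r,\Lambda,l)\in\mathcal P$ the function $s\mapsto\langle\mu_s,\phi\rangle$ is $h$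 times continuously differentiable on $(0,\infty)$ and $$\hat S^h(\phi):=\Big(\int_0^\infty\big|\partial_s^h\langle\mu_s,\phi\rangle\big|^2s^{2h-1}\,ds\Big)^{1/2}\le C .$$ -/

import Mathlib

open MeasureTheory Set
open scoped ENNReal

noncomputable section

namespace FreeTwoStep

/-! ### The free two-step nilpotent group `N_v` -/

/-- The first layer `𝒱 = ℝ^v`, with its canonical orthonormal basis `X_1, …, X_v`
(indexed here by `0, …, v - 1`). -/
abbrev V (v : ℕ) : Type := EuclideanSpace ℝ (Fin v)

/-- The centre `𝒵`, with its canonical orthonormal basis `X_{i,j} = [X_i, X_j]`, `i < j`. -/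
abbrev Z (v : ℕ) : Type := EuclideanSpace ℝ {p : Fin v × Fin v // p.1 < p.2}

/-- `z = v (v - 1) / 2`, the dimension of the centre. -/
def zdim (v : ℕ) : ℕ := v * (v - 1) / 2

/-- `Q = v + 2 z = v ^ 2`, the homogeneous dimension. -/
def homDim (v : ℕ) : ℕ := v + 2 * zdim v

/-- The bracket `𝒱 × 𝒱 → 𝒵`, determined by `[X_i, X_j] = X_{i,j}` for `i < j`. -/
def bracket {v : ℕ} (X Y : V v) : Z v :=
  WithLp.toLp 2 fun p => X p.1.1 * Y p.1.2 - X p.1.2 * Y p.1.1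

/-- The free two-step nilpotent Lie group on `v` generators, in exponential coordinates: the pair
`(X, A)` is the element `exp (X + A)`. -/
def N (v : ℕ) : Type := V v × Z v

/-- The element `exp (X + A)`. -/
def exp {v : ℕ} (X : V v) (A : Z v) : N v := (X, A)

/-- The component `X` of `exp (X + A)`. -/
def N.fst {v : ℕ} (n : N v) : V v := Prod.fst n

/-- The component `A` of `exp (X + A)`. -/
def N.snd {v : ℕ} (n : N v) : Z v := Prod.snd n

/-- The group law (Baker-Campbell-Hausdorff):
`exp (X + A) * exp (Y + B) = exp (X + Y + A + B + [X, Y] / 2)`. -/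
instance (v : ℕ) : Group (N v) where
  mul m n := exp (m.fst + n.fst) (m.snd + n.snd + (1 / 2 : ℝ) • bracket m.fst n.fst)
  one := exp 0 0
  inv n := exp (-n.fst) (-n.snd)
  mul_assoc a b c := by
    refine Prod.ext (add_assoc a.1 b.1 c.1) ?_
    change (a.2 + b.2 + (1 / 2 : ℝ) • bracket a.1 b.1) + c.2 +
      (1 / 2 : ℝ) • bracket (a.1 + b.1) c.1 = a.2 + (b.2 + c.2 + (1 / 2 : ℝ) • bracket b.1 c.1) +
      (1 / 2 : ℝ) • bracket a.1 (b.1 + c.1)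
    ext p
    simp [bracket]
    ring
  one_mul a := by
    refine Prod.ext (zero_add a.1) ?_
    change 0 + a.2 + (1 / 2 : ℝ) • bracket 0 a.1 = a.2
    ext p
    simp [bracket]
  mul_one a := by
    refine Prod.ext (add_zero a.1) ?_
    change a.2 + 0 + (1 / 2 : ℝ) • bracket a.1 0 = a.2
    ext p
    simp [bracket]
  inv_mul_cancel a := by
    refine Prod.ext (neg_add_cancel a.1) ?_
    change -a.2 + a.2 + (1 / 2 : ℝ) • bracket (-a.1) a.1 = 0
    ext p
    simp [bracket]
    ring

instance (v : ℕ) : TopologicalSpace (N v) := inferInstanceAs (TopologicalSpace (V v × Z v))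

/-- The Haar measure `dn`: Lebesgue measure for the canonical bases of `𝒱` and `𝒵`. -/
instance (v : ℕ) : MeasureSpace (N v) := inferInstanceAs (MeasureSpace (V v × Z v))

/-- The dilation `s.exp (X + A) = exp (s X + s ^ 2 A)`. -/
def dil {v : ℕ} (s : ℝ) (n : N v) : N v := exp (s • n.fst) (s ^ 2 • n.snd)

/-- The Korányi norm `(|X| ^ 4 + |A| ^ 2) ^ (1 / 4)` of `exp (X + A)`. -/
def koranyi {v : ℕ} (n : N v) : ℝ := (‖n.fst‖ ^ 4 + ‖n.snd‖ ^ 2) ^ (1 / 4 : ℝ)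

/-- The measure `μ` on the unit Korányi sphere `S₁ = {n | |n| = 1}` given by polar coordinates,
`∫ f(n) dn = ∫_0^∞ ∫_{S₁} f(r.n) dμ(n) r ^ (Q - 1) dr`; it is regarded as a measure on `N_v`.
As for any such cone measure, `μ E` is `Q` times the Haar measure of
`{r.n | 0 < r ≤ 1, n ∈ E}` for `E ⊆ S₁`. -/
def sphereMeasure (v : ℕ) : Measure (N v) :=
  (homDim v : ℝ≥0∞) •
    ((volume : Measure (N v)).restrict {n | 0 < koranyi n ∧ koranyi n ≤ 1}).map
      (fun n => dil (koranyi n)⁻¹ n)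

/-! ### The action of the orthogonal group -/

/-- The orthogonal group `O(v)`. -/
abbrev Orth (v : ℕ) : Type := Matrix.orthogonalGroup (Fin v) ℝ

instance (v : ℕ) : MeasurableSpace (Orth v) := borel _

instance (v : ℕ) : BorelSpace (Orth v) := ⟨rfl⟩

instance (v : ℕ) : CompactSpace (Orth v) := by
  refine isCompact_iff_compactSpace.mp ?_
  have hK : IsCompact (univ.pi fun _ : Fin v => univ.pi fun _ : Fin v => Icc (-1 : ℝ) 1) :=
    isCompact_univ_pi fun _ => isCompact_univ_pi fun _ => isCompact_Icc
  have hC : IsClosed {A : Matrix (Fin v) (Fin v) ℝ | star A * A = 1 ∧ A * star A = 1} :=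
    (isClosed_eq (by fun_prop) continuous_const).inter
      (isClosed_eq (by fun_prop) continuous_const)
  refine IsCompact.of_isClosed_subset hK hC ?_
  intro A hA i _ j _
  have h := entry_norm_bound_of_unitary (𝕜 := ℝ) (U := A) hA i j
  exact abs_le.mp h

/-- The Haar probability measure `dk` of `O(v)`. -/
def haarOrth (v : ℕ) : Measure (Orth v) := Measure.haarMeasure ⊤

/-- The skew-symmetric matrix `∑_{i<j} A_{i,j} (E_{i,j} - E_{j,i})` identified with
`∑_{i<j} A_{i,j} X_{i,j} ∈ 𝒵`. -/
def toSkew {v : ℕ} (A : Z v) : Matrix (Fin v) (Fin v) ℝ :=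
  Matrix.of fun i j =>
    if hij : i < j then A ⟨(i, j), hij⟩ else if hji : j < i then -A ⟨(j, i), hji⟩ else 0

/-- The inverse identification: read off the entries above the diagonal. -/
def ofSkew {v : ℕ} (M : Matrix (Fin v) (Fin v) ℝ) : Z v :=
  WithLp.toLp 2 fun p => M p.1.1 p.1.2

/-- The action of `O(v)` on `N_v`: `k.exp (X + A) = exp (k X + k A k⁻¹)`. -/
def rot {v : ℕ} (k : Orth v) (n : N v) : N v :=
  exp (WithLp.toLp 2 ((k : Matrix (Fin v) (Fin v) ℝ).mulVec n.fst.ofLp))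
    (ofSkew ((k : Matrix (Fin v) (Fin v) ℝ) * toSkew n.snd *
      ((k⁻¹ : Orth v) : Matrix (Fin v) (Fin v) ℝ)))

/-! ### The spherical functions -/

/-- The Laguerre polynomial `L_n^0 (x) = ∑_{k ≤ n} C(n, k) (-x) ^ k / k!` of type `0`. -/
def laguerrePoly (n : ℕ) (x : ℝ) : ℝ :=
  ∑ k ∈ Finset.range (n + 1), (n.choose k : ℝ) * (-x) ^ k / (k.factorial : ℝ)

/-- The Laguerre function `L_n^0 (x) e ^ (-x / 2)`. -/
def laguerreFun (n : ℕ) (x : ℝ) : ℝ := laguerrePoly n x * Real.exp (-x / 2)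

/-- `D₂(Λ)`: the skew-symmetric matrix with diagonal blocks `λ_j J`, `J = [0, 1; -1, 0]`, followed
by one zero row and column if `v` is odd. -/
def D2 {v : ℕ} (Λ : Fin (v / 2) → ℝ) : Matrix (Fin v) (Fin v) ℝ :=
  Matrix.of fun i j =>
    if h : (i : ℕ) % 2 = 0 ∧ (j : ℕ) = i + 1 then Λ ⟨i / 2, by omega⟩
    else if h : (j : ℕ) % 2 = 0 ∧ (i : ℕ) = j + 1 then -Λ ⟨j / 2, by omega⟩
    else 0

/-- The duality `⟨D, A⟩` between a skew-symmetric matrix `D`, standing for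
`∑_{i<j} D_{i,j} X_{i,j}^* ∈ 𝒵^*`, and `A ∈ 𝒵`. -/
def pairing {v : ℕ} (D : Matrix (Fin v) (Fin v) ℝ) (A : Z v) : ℝ :=
  ∑ p : {p : Fin v × Fin v // p.1 < p.2}, D p.1.1 p.1.2 * A p

/-- The orthogonal projection of `𝒱` onto the plane spanned by `X_{2j-1}, X_{2j}`
(whose basis vectors have indices `2 j, 2 j + 1` when counting starts from `0`). -/
def pr {v : ℕ} (j : Fin (v / 2)) (X : V v) : V v :=
  WithLp.toLp 2 fun i => if (i : ℕ) / 2 = j then X i else 0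

/-- The last coordinate `⟨X_v^*, X⟩`. -/
def lastCoord {v : ℕ} (X : V v) : ℝ := if h : 0 < v then X ⟨v - 1, by omega⟩ else 0

/-- The parameter set `𝒫` of triples `(r, Λ, l)` with `λ_1 > ⋯ > λ_{v'} > 0`, `l ∈ ℕ^{v'}`, and
`r > 0` if `v = 2 v' + 1`, `r = 0` if `v = 2 v'`. -/
def P (v : ℕ) : Set (ℝ × (Fin (v / 2) → ℝ) × (Fin (v / 2) → ℕ)) :=
  {p | (∀ i j, i < j → p.2.1 j < p.2.1 i) ∧ (∀ j, 0 < p.2.1 j) ∧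
    (Odd v → 0 < p.1) ∧ (Even v → p.1 = 0)}

/-- `Θ^{r,Λ,l} (exp (X + A)) =
e^{i ⟨r X_v^*, X⟩} e^{i ⟨D₂(Λ), A⟩} ∏_j ℓ_{l_j} (λ_j / 2 * |pr_j X| ^ 2)`. -/
def Theta {v : ℕ} (r : ℝ) (Λ : Fin (v / 2) → ℝ) (l : Fin (v / 2) → ℕ) (n : N v) : ℂ :=
  Complex.exp (Complex.I * ((r * lastCoord n.fst : ℝ) : ℂ)) *
    Complex.exp (Complex.I * ((pairing (D2 Λ) n.snd : ℝ) : ℂ)) *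
    ∏ j, ((laguerreFun (l j) (Λ j / 2 * ‖pr j n.fst‖ ^ 2) : ℝ) : ℂ)

/-- The spherical function `φ^{r,Λ,l} (n) = ∫_{O(v)} Θ^{r,Λ,l} (k.n) dk`. -/
def phi {v : ℕ} (r : ℝ) (Λ : Fin (v / 2) → ℝ) (l : Fin (v / 2) → ℕ) (n : N v) : ℂ :=
  ∫ k, Theta r Λ l (rot k n) ∂haarOrth v

/-! ### The square function on the spectral side -/

/-- `⟨μ_s, f⟩ = ∫ f (s.n) dμ(n)`, where `μ_s` is the `s`-dilate of `μ`. -/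
def sphereMean {v : ℕ} (f : N v → ℂ) (s : ℝ) : ℂ := ∫ n, f (dil s n) ∂sphereMeasure v

/-- `Ŝ^h (f) = (∫_0^∞ |∂_s^h ⟨μ_s, f⟩| ^ 2 s ^ (2 h - 1) ds) ^ (1 / 2)`, with values in
`[0, ∞]`. -/
def Shat {v : ℕ} (h : ℕ) (f : N v → ℂ) : ℝ≥0∞ :=
  (∫⁻ s in Ioi (0 : ℝ), ‖iteratedDeriv h (sphereMean f) s‖ₑ ^ 2 *
    ENNReal.ofReal (s ^ (2 * h - 1))) ^ (1 / 2 : ℝ)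

/-! ### Checks of the definitions -/

instance (v : ℕ) : IsProbabilityMeasure (haarOrth v) :=
  ⟨Measure.haarMeasure_self (K₀ := (⊤ : TopologicalSpace.PositiveCompacts (Orth v)))⟩

/-- `zdim v` is the dimension of the centre. -/
theorem finrank_Z (v : ℕ) : Module.finrank ℝ (Z v) = zdim v := by
  rw [finrank_euclideanSpace, zdim, Fintype.card_subtype]
  have h : ∀ v : ℕ, (Finset.univ.filter fun p : Fin v × Fin v => p.1 < p.2).card = ∑ i ∈ Finset.range v, i := by
    intro v
    rw [← Finset.univ_product_univ, Finset.card_filter, Finset.sum_product_right, Finset.sum_range]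
    refine Finset.sum_congr rfl fun i _ => ?_
    rw [← Finset.card_filter]
    have : (Finset.univ.filter fun x : Fin v => x < i) = Finset.Iio i := by ext; simp
    rw [this, Fin.card_Iio]
  rw [h, Finset.sum_range_id]

/-- The Korányi norm is homogeneous. -/
theorem koranyi_dil {v : ℕ} {s : ℝ} (hs : 0 ≤ s) (n : N v) : koranyi (dil s n) = s * koranyi n := by
  have : ‖(dil s n).fst‖ ^ 4 + ‖(dil s n).snd‖ ^ 2 = s ^ 4 * (‖n.fst‖ ^ 4 + ‖n.snd‖ ^ 2) := by
    change ‖s • n.fst‖ ^ 4 + ‖s ^ 2 • n.snd‖ ^ 2 = _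
    rw [norm_smul, norm_smul]; simp [abs_of_nonneg hs]; ring
  unfold koranyi
  rw [this, Real.mul_rpow (by positivity) (by positivity)]
  congr 1
  rw [← Real.rpow_natCast, ← Real.rpow_mul hs]; norm_num

theorem measurable_koranyi (v : ℕ) : Measurable (koranyi (v := v)) := by
  have h : Measurable fun n : V v × Z v => (‖n.1‖ ^ 4 + ‖n.2‖ ^ 2) ^ (1 / 4 : ℝ) := by fun_prop
  exact h

theorem measurable_dil (v : ℕ) : Measurable fun p : ℝ × N v => dil p.1 p.2 := by
  have h : Measurable fun p : ℝ × (V v × Z v) => (p.1 • p.2.1, p.1 ^ 2 • p.2.2) := by fun_prop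
  exact h

theorem lintegral_smul_change (E : Type) [NormedAddCommGroup E] [InnerProductSpace ℝ E]
    [FiniteDimensional ℝ E] [MeasurableSpace E] [BorelSpace E] (c : ℝ) (hc : 0 < c) (g : E → ℝ≥0∞)
    (hg : Measurable g) :
    ∫⁻ x, g x = ENNReal.ofReal (c ^ Module.finrank ℝ E) * ∫⁻ x, g (c • x) := by
  have h1 := Measure.map_addHaar_smul (volume : Measure E) hc.ne'
  have h2 : ∫⁻ x, g (c • x) = ∫⁻ x, g x ∂(Measure.map (c • ·) (volume : Measure E)) := by
    rw [lintegral_map hg (by fun_prop)]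
  rw [h2, h1, lintegral_smul_measure, abs_of_pos (by positivity), smul_eq_mul, ← mul_assoc,
    ← ENNReal.ofReal_mul (by positivity), mul_inv_cancel₀ (by positivity)]
  simp

theorem lintegral_dil {v : ℕ} {s : ℝ} (hs : 0 < s) (f : N v → ℝ≥0∞) (hf : Measurable f) :
    ∫⁻ n, f n = ENNReal.ofReal (s ^ homDim v) * ∫⁻ n, f (dil s n) := by
  have hf' : Measurable (fun p : V v × Z v => f p) := hf
  change ∫⁻ n : V v × Z v, f n ∂(volume.prod volume) = _ * ∫⁻ n : V v × Z v, f (s • n.1, s ^ 2 • n.2) ∂(volume.prod volume)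
  rw [lintegral_prod _ hf'.aemeasurable, lintegral_prod _ (by fun_prop)]
  dsimp only
  rw [lintegral_smul_change (V v) s hs _ (by exact hf'.lintegral_prod_right')]
  simp_rw [fun x : V v => lintegral_smul_change (Z v) (s ^ 2) (by positivity) (fun y => f (s • x, y)) (by fun_prop)]
  rw [lintegral_const_mul _ (by
    have : Measurable fun p : V v × Z v => f (s • p.1, s^2 • p.2) := by fun_prop
    exact this.lintegral_prod_right'), ← mul_assoc, ← ENNReal.ofReal_mul (by positivity)]
  rw [finrank_Z, finrank_euclideanSpace, Fintype.card_fin, homDim, ← pow_mul, pow_add]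

/-- The formula of integration in polar coordinates that characterizes `μ`. -/
theorem lintegral_polar {v : ℕ} (hv : 0 < v) (f : N v → ℝ≥0∞) (hf : Measurable f) :
    ∫⁻ n, f n = ∫⁻ r in Ioi (0 : ℝ),
      (∫⁻ n, f (dil r n) ∂sphereMeasure v) * ENNReal.ofReal (r ^ (homDim v - 1)) := by
  set Q := homDim v with hQ
  have hQ0 : 0 < Q := by rw [hQ, homDim]; omega
  have hk : Measurable (koranyi (v := v)) := measurable_koranyi v
  have hd := measurable_dil v
  have hB : MeasurableSet {n : N v | 0 < koranyi n ∧ koranyi n ≤ 1} :=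
    (measurableSet_lt measurable_const hk).inter (measurableSet_le hk measurable_const)
  have hT : Measurable fun n : N v => dil (koranyi n)⁻¹ n := hd.comp (hk.inv.prodMk measurable_id)
  have hfd : Measurable fun p : ℝ × N v => f (dil p.1 p.2) := hf.comp hd
  have hdd : ∀ (a b : ℝ) (n : N v), dil a (dil b n) = dil (a * b) n := by
    intro a b n
    exact Prod.ext (smul_smul a b n.1) ((smul_smul (a ^ 2) (b ^ 2) n.2).trans
      (by rw [← mul_pow]; rfl))
  have hIoi : ∀ g : ℝ → ℝ≥0∞, ∫⁻ r in Ioi (0:ℝ), g r = ∫⁻ r, (Ioi (0:ℝ)).indicator g r :=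
    fun g => (lintegral_indicator measurableSet_Ioi g).symm
  -- the mean over the sphere
  have h1 : ∀ r, ∫⁻ n, f (dil r n) ∂sphereMeasure v = (Q : ℝ≥0∞) *
      ∫⁻ n in {n : N v | 0 < koranyi n ∧ koranyi n ≤ 1}, f (dil (r * (koranyi n)⁻¹) n) := by
    intro r
    rw [sphereMeasure, lintegral_smul_measure, lintegral_map (by
      exact hfd.comp (measurable_const.prodMk measurable_id)) hT]
    simp [hdd, hQ]
  -- the substitution `r = |n| ρ`
  have h2 : ∀ n : N v, 0 < koranyi n →
      ∫⁻ r in Ioi (0:ℝ), f (dil (r * (koranyi n)⁻¹) n) * ENNReal.ofReal (r ^ (Q - 1)) =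
      ∫⁻ ρ in Ioi (0:ℝ), f (dil ρ n) * ENNReal.ofReal (ρ ^ (Q - 1) * koranyi n ^ Q) := by
    intro n hn
    have hm : Measurable fun r : ℝ =>
        f (dil (r * (koranyi n)⁻¹) n) * ENNReal.ofReal (r ^ (Q - 1)) :=
      (hfd.comp ((measurable_id.mul_const _).prodMk measurable_const)).mul (by fun_prop)
    rw [hIoi, lintegral_smul_change ℝ (koranyi n) hn _ (hm.indicator measurableSet_Ioi),
      ← lintegral_const_mul' _ _ ENNReal.ofReal_ne_top, hIoi]
    refine lintegral_congr fun ρ => ?_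
    by_cases hρ : 0 < ρ
    · rw [indicator_of_mem (by exact mul_pos hn hρ), indicator_of_mem (by exact hρ), mul_left_comm,
        ← ENNReal.ofReal_mul (by positivity)]
      have e1 : koranyi n • ρ * (koranyi n)⁻¹ = ρ := by rw [smul_eq_mul]; field_simp
      rw [e1]
      congr 2
      rw [Module.finrank_self, smul_eq_mul, pow_one, mul_pow]
      obtain ⟨q, hq⟩ : ∃ q, Q = q + 1 := ⟨Q - 1, by omega⟩
      rw [hq]; simp; ring
    · rw [indicator_of_notMem, indicator_of_notMem, mul_zero]
      · exact hρ
      · intro h; exact hρ (pos_of_mul_pos_right (a := koranyi n) h hn.le)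
  -- the dilation of the Haar measure
  have h3 : ∀ ρ : ℝ, 0 < ρ →
      ∫⁻ n in {n : N v | 0 < koranyi n ∧ koranyi n ≤ 1},
        f (dil ρ n) * ENNReal.ofReal (ρ ^ (Q - 1) * koranyi n ^ Q) =
      ∫⁻ n in {n : N v | 0 < koranyi n},
        (Ici (koranyi n)).indicator (fun ρ : ℝ => f n * ENNReal.ofReal (koranyi n ^ Q *
          ρ ^ (-(Q:ℝ) - 1))) ρ := by
    intro ρ hρ
    have hm : Measurable fun n : N v => {n : N v | 0 < koranyi n ∧ koranyi n ≤ ρ}.indicator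
        (fun n => f n * ENNReal.ofReal (koranyi n ^ Q * ρ ^ (-(Q:ℝ) - 1))) n := by
      refine Measurable.indicator (by fun_prop)
        ((measurableSet_lt measurable_const hk).inter (measurableSet_le hk measurable_const))
    rw [← lintegral_indicator hB, ← lintegral_indicator (measurableSet_lt measurable_const hk)]
    have := lintegral_dil hρ _ hm
    have e : ∀ n : N v, {n : N v | 0 < koranyi n}.indicator (fun n => (Ici (koranyi n)).indicator
        (fun ρ : ℝ => f n * ENNReal.ofReal (koranyi n ^ Q *
          ρ ^ (-(Q:ℝ) - 1))) ρ) n = {n : N v | 0 < koranyi n ∧ koranyi n ≤ ρ}.indicator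
        (fun n => f n * ENNReal.ofReal (koranyi n ^ Q * ρ ^ (-(Q:ℝ) - 1))) n := by
      intro n
      simp only [indicator_apply, mem_ofPred_eq, mem_Ici]
      split_ifs <;> tauto
    simp_rw [e]
    rw [this, ← lintegral_const_mul' _ _ ENNReal.ofReal_ne_top]
    refine lintegral_congr fun n => ?_
    have hkd := koranyi_dil hρ.le n
    by_cases hn : 0 < koranyi n ∧ koranyi n ≤ 1
    · have hn' : dil ρ n ∈ {n : N v | 0 < koranyi n ∧ koranyi n ≤ ρ} := by
        simp only [mem_ofPred_eq, hkd]
        exact ⟨mul_pos hρ hn.1, by nlinarith⟩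
      rw [indicator_of_mem (by exact hn), indicator_of_mem hn', mul_left_comm,
        ← ENNReal.ofReal_mul (by positivity), hkd]
      congr 2
      rw [← hQ, mul_pow, Real.rpow_sub hρ, Real.rpow_neg hρ.le, Real.rpow_natCast, Real.rpow_one]
      obtain ⟨q, hq⟩ : ∃ q, Q = q + 1 := ⟨Q - 1, by omega⟩
      rw [hq]; simp; field_simp; ring
    · have hn' : dil ρ n ∉ {n : N v | 0 < koranyi n ∧ koranyi n ≤ ρ} := by
        simp only [mem_ofPred_eq, hkd]
        rintro ⟨h, h'⟩
        exact hn ⟨pos_of_mul_pos_right h hρ.le, by nlinarith⟩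
      rw [indicator_of_notMem (by exact hn), indicator_of_notMem hn', mul_zero]
  -- the radial integral
  have h4 : ∀ k : ℝ, 0 < k → ∫⁻ ρ in Ioi (0:ℝ), (Ici k).indicator
      (fun ρ => ENNReal.ofReal (k ^ Q * ρ ^ (-(Q:ℝ) - 1))) ρ = (Q : ℝ≥0∞)⁻¹ := by
    intro k hk0
    rw [lintegral_indicator measurableSet_Ici, Measure.restrict_restrict measurableSet_Ici,
      inter_eq_left.mpr (show Ici k ⊆ Ioi 0 from fun x hx => lt_of_lt_of_le hk0 hx), setLIntegral_congr Ioi_ae_eq_Ici.symm]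
    have hQr : (0:ℝ) < Q := by exact_mod_cast hQ0
    rw [← ofReal_integral_eq_lintegral_ofReal, integral_const_mul, integral_Ioi_rpow_of_lt (by linarith) hk0]
    · have e : k ^ Q * (-k ^ (-(Q:ℝ) - 1 + 1) / (-(Q:ℝ) - 1 + 1)) = (Q:ℝ)⁻¹ := by
        rw [sub_add_cancel, Real.rpow_neg hk0.le, Real.rpow_natCast]; field_simp
      rw [e, ENNReal.ofReal_inv_of_pos hQr, ENNReal.ofReal_natCast]
    · exact (integrableOn_Ioi_rpow_of_lt (by linarith) hk0).const_mul _
    · exact (ae_restrict_mem measurableSet_Ioi).mono fun x hx => by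
        have : 0 < x := hk0.trans hx
        positivity
  have h5 : ∀ᵐ n : N v, n ∈ {n : N v | 0 < koranyi n} := by
    have : Nonempty (Fin v) := ⟨⟨0, hv⟩⟩
    have h0 : ∀ᵐ n : V v × Z v ∂(volume.prod volume), n.1 ≠ 0 :=
      Measure.quasiMeasurePreserving_fst.ae (p := fun x : V v => x ≠ 0)
        (by simp [ae_iff])
    refine h0.mono fun n hn => ?_
    have : 0 < ‖n.1‖ := norm_pos_iff.mpr hn
    change 0 < (‖n.1‖ ^ 4 + ‖n.2‖ ^ 2) ^ (1 / 4 : ℝ)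
    positivity
  have : SFinite (volume : Measure (N v)) := inferInstanceAs (SFinite (volume : Measure (V v × Z v)))
  symm
  calc ∫⁻ r in Ioi (0 : ℝ),
      (∫⁻ n, f (dil r n) ∂sphereMeasure v) * ENNReal.ofReal (r ^ (Q - 1))
      = (Q:ℝ≥0∞) * ∫⁻ r in Ioi (0 : ℝ), ∫⁻ n in {n : N v | 0 < koranyi n ∧ koranyi n ≤ 1},
          f (dil (r * (koranyi n)⁻¹) n) * ENNReal.ofReal (r ^ (Q - 1)) := by
        rw [← lintegral_const_mul' _ _ (by simp)]
        refine lintegral_congr fun r => ?_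
        rw [h1, mul_assoc, lintegral_mul_const' _ _ (by simp)]
    _ = (Q:ℝ≥0∞) * ∫⁻ n in {n : N v | 0 < koranyi n ∧ koranyi n ≤ 1}, ∫⁻ r in Ioi (0 : ℝ),
          f (dil (r * (koranyi n)⁻¹) n) * ENNReal.ofReal (r ^ (Q - 1)) := by
        rw [lintegral_lintegral_swap]
        refine Measurable.aemeasurable (Measurable.mul (hfd.comp (Measurable.prodMk ?_ measurable_snd)) (by fun_prop))
        exact measurable_fst.mul (hk.comp measurable_snd).inv
    _ = (Q:ℝ≥0∞) * ∫⁻ n in {n : N v | 0 < koranyi n ∧ koranyi n ≤ 1}, ∫⁻ ρ in Ioi (0 : ℝ),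
          f (dil ρ n) * ENNReal.ofReal (ρ ^ (Q - 1) * koranyi n ^ Q) := by
        congr 1
        exact setLIntegral_congr_fun hB fun n hn => h2 n hn.1
    _ = (Q:ℝ≥0∞) * ∫⁻ ρ in Ioi (0 : ℝ), ∫⁻ n in {n : N v | 0 < koranyi n ∧ koranyi n ≤ 1},
          f (dil ρ n) * ENNReal.ofReal (ρ ^ (Q - 1) * koranyi n ^ Q) := by
        rw [lintegral_lintegral_swap]
        exact Measurable.aemeasurable (Measurable.mul (hfd.comp measurable_swap) (by fun_prop))
    _ = (Q:ℝ≥0∞) * ∫⁻ ρ in Ioi (0 : ℝ), ∫⁻ n in {n : N v | 0 < koranyi n},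
        (Ici (koranyi n)).indicator (fun ρ : ℝ => f n * ENNReal.ofReal (koranyi n ^ Q *
          ρ ^ (-(Q:ℝ) - 1))) ρ := by
        congr 1
        exact setLIntegral_congr_fun measurableSet_Ioi fun ρ hρ => h3 ρ hρ
    _ = (Q:ℝ≥0∞) * ∫⁻ n in {n : N v | 0 < koranyi n}, ∫⁻ ρ in Ioi (0 : ℝ),
        (Ici (koranyi n)).indicator (fun ρ : ℝ => f n * ENNReal.ofReal (koranyi n ^ Q *
          ρ ^ (-(Q:ℝ) - 1))) ρ := by
        rw [lintegral_lintegral_swap]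
        have hS : MeasurableSet {p : ℝ × N v | koranyi p.2 ≤ p.1} :=
          measurableSet_le (hk.comp measurable_snd) measurable_fst
        have hm : Measurable ({p : ℝ × N v | koranyi p.2 ≤ p.1}.indicator fun p => f p.2 *
          ENNReal.ofReal (koranyi p.2 ^ Q * p.1 ^ (-(Q:ℝ) - 1))) :=
          Measurable.indicator (by fun_prop) hS
        exact hm.aemeasurable
    _ = (Q:ℝ≥0∞) * ∫⁻ n in {n : N v | 0 < koranyi n}, f n * (Q:ℝ≥0∞)⁻¹ := by
        congr 1
        refine setLIntegral_congr_fun (measurableSet_lt measurable_const hk) fun n hn => ?_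
        rw [← h4 (koranyi n) hn, ← lintegral_const_mul _ (by
          exact Measurable.indicator (by fun_prop) measurableSet_Ici)]
        refine lintegral_congr fun ρ => ?_
        simp only [indicator_apply]
        split_ifs <;> simp
    _ = ∫⁻ n, f n := by
        rw [Measure.restrict_eq_self_of_ae_mem h5, lintegral_mul_const _ hf, mul_left_comm,
          ENNReal.mul_inv_cancel (by simp [hQ0.ne']) (by simp), mul_one]
/-- `μ` is carried by the unit Korányi sphere. -/
theorem sphereMeasure_compl (v : ℕ) : sphereMeasure v {n | koranyi n ≠ 1} = 0 := by
  have hk := measurable_koranyi v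
  have hT : Measurable fun n : N v => dil (koranyi n)⁻¹ n :=
    (measurable_dil v).comp (hk.inv.prodMk measurable_id)
  have hS : MeasurableSet {n : N v | koranyi n ≠ 1} := (hk (measurableSet_singleton 1)).compl
  have hB : MeasurableSet {n : N v | 0 < koranyi n ∧ koranyi n ≤ 1} :=
    (measurableSet_lt measurable_const hk).inter (measurableSet_le hk measurable_const)
  rw [sphereMeasure, Measure.smul_apply, Measure.map_apply hT hS,
    Measure.restrict_apply (hT hS)]
  have : ((fun n : N v => dil (koranyi n)⁻¹ n) ⁻¹' {n | koranyi n ≠ 1}) ∩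
      {n | 0 < koranyi n ∧ koranyi n ≤ 1} = ∅ := by
    ext n
    simp only [mem_inter_iff, mem_preimage, mem_ofPred_eq, mem_empty_iff_false, iff_false]
    rintro ⟨h, h0, -⟩
    rw [koranyi_dil (by positivity), inv_mul_cancel₀ h0.ne'] at h
    exact h rfl
  rw [this]; simp

/-- Left translations preserve `dn`. -/
theorem volume_mul_left {v : ℕ} (m : N v) :
    MeasurePreserving (fun n : N v => m * n) volume volume := by
  have h1 : MeasurePreserving (fun X : V v => m.fst + X) volume volume :=
    measurePreserving_add_left volume m.fst
  have h : MeasurePreserving (fun p : V v × Z v =>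
      (m.fst + p.1, m.snd + p.2 + (1 / 2 : ℝ) • bracket m.fst p.1))
      (volume.prod volume) (volume.prod volume) := by
    refine h1.skew_product (g := fun X A => m.snd + A + (1 / 2 : ℝ) • bracket m.fst X) ?_ ?_
    · have : Continuous fun p : V v × Z v => m.snd + p.2 + (1 / 2 : ℝ) • bracket m.fst p.1 := by
        unfold bracket; fun_prop
      exact this.measurable
    · refine Filter.Eventually.of_forall fun X => ?_
      have : (fun A : Z v => m.snd + A + (1 / 2 : ℝ) • bracket m.fst X) =
          fun A => (m.snd + (1 / 2 : ℝ) • bracket m.fst X) + A := by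
        ext1 A; exact add_right_comm _ _ _
      rw [this]
      exact (measurePreserving_add_left volume _).map_eq
  exact h

/-- `O(v)` acts by automorphisms of the group `N_v`. -/
theorem rot_mul {v : ℕ} (k : Orth v) (m n : N v) : rot k (m * n) = rot k m * rot k n := by
  have hb : ∀ X Y : V v, toSkew (bracket X Y) =
      Matrix.vecMulVec X.ofLp Y.ofLp - Matrix.vecMulVec Y.ofLp X.ofLp := by
    intro X Y
    ext i j
    simp only [toSkew, bracket, Matrix.of_apply, Matrix.sub_apply, Matrix.vecMulVec_apply]
    split_ifs with h h'
    · ring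
    · ring
    · obtain rfl : i = j := by omega
      ring
  have hadd : ∀ A B : Z v, toSkew (A + B) = toSkew A + toSkew B := by
    intro A B
    ext i j
    simp only [toSkew, Matrix.of_apply, Matrix.add_apply]
    split_ifs <;> simp; ring
  have hsmul : ∀ (c : ℝ) (A : Z v), toSkew (c • A) = c • toSkew A := by
    intro c A
    ext i j
    simp only [toSkew, Matrix.of_apply, Matrix.smul_apply]
    split_ifs <;> simp
  have hk : ((k⁻¹ : Orth v) : Matrix (Fin v) (Fin v) ℝ) =
      (k : Matrix (Fin v) (Fin v) ℝ).transpose := rfl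
  refine Prod.ext ?_ ?_
  · change WithLp.toLp 2 (Matrix.mulVec _ (m.fst + n.fst).ofLp) = _ + _
    rw [WithLp.ofLp_add, Matrix.mulVec_add]
    rfl
  · change ofSkew (_ * toSkew (m.snd + n.snd + (1 / 2 : ℝ) • bracket m.fst n.fst) * _) =
      ofSkew _ + ofSkew _ + (1 / 2 : ℝ) • bracket (WithLp.toLp 2 _) (WithLp.toLp 2 _)
    rw [hadd, hadd, hsmul, hb, hk]
    ext p
    simp only [Matrix.mul_add, Matrix.add_mul, Matrix.mul_sub, Matrix.sub_mul, Matrix.mul_smul,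
      Matrix.smul_mul, Matrix.mul_vecMulVec, Matrix.vecMulVec_mul, Matrix.vecMul_transpose]
    simp [ofSkew, bracket, Matrix.vecMulVec_apply]
    ring

end FreeTwoStep

end

/-! The measure `μ` is invariant under `O(v)`, so averaging over the group does not change spherical
means: `⟨μ_s, φ⟩ = ⟨μ_s, Θ⟩`. Moreover `Θ` depends only on `X` and on one central coordinate `⟨u,
A⟩` (`sphereMean_phi`). Integrating out the other `z - 1` central coordinates over a Korányi ball
and differentiating in the radius gives `⟨μ_s, Θ⟩ = c s^(4-Q) ∫ G(w) (s⁴ - |w|⁴)₊^q dw` on `ℝ^v ×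
ℝ`, with `q = (z - 3) / 2` (`sphereMean_eq_rieszInt`). Each differentiation in `s` lowers the
exponent by at most one, so `h` derivatives are available when `h ≤ q`; for integers this is the
same as `h < (z - 2) / 2`. By homogeneity, `s^h ∂_s^h ⟨μ_s, φ⟩` is a fixed linear combination of the
integrals `∫ G(s.w) (1 - |w|⁴)₊^(q-i) dw`, `0 ≤ i ≤ h` (`iteratedDeriv_rieszInt_mul_pow`). It
remains to bound this combination in `L²(ds/s)`, uniformly in the parameters.

Let `σ = max(r, max_j (λ_j (2 l_j + 1))^(1/2))` be the frequency of `Θ`. If `s ≤ 1/σ`, then `Θ(s.w)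
- 1 = O(σ s)` on the unit ball (`norm_thetaSlice_sub_one_le`), and the combination vanishes on the
constant 1 because `h ≥ 1` (`sum_derivCoeff_mul_rieszInt_one`); so it is `O(σ s)`. If `s > 1/σ` and
`σ = r`, translating the last coordinate by `π / (r s)` changes the sign of `Θ(s.w)`, and the
combination is `O(1 / (r s))` (`norm_rieszInt_le_of_antiperiodic`). If `s > 1/σ` and `σ` comes from
some `λ_j (2 l_j + 1)`, Cauchy-Schwarz and Fubini reduce the estimate to the single Laguerre factor
`j` (`lintegral_sq_thetaSlice_le`).

The last case needs `∫ ℓ_n(t)² dt/t` over `t > 1 / (4a)`, `a = n + 1/2`, to be bounded uniformly in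
`n` (`lintegral_sq_laguerreFun_div_le`). This combines the bound `|ℓ_n| ≤ 1`, obtained from a norm
in Fock space; the decay `ℓ_n² = O((a t)^(-1/2))` for `t ≤ 2a`, obtained from a decreasing energy;
and `∫ ℓ_n² ≤ 5a`, obtained from an exact primitive. -/

noncomputable section

namespace FreeTwoStep

/-! ### Laguerre functions -/

/-- The `m`-th Taylor coefficient of `(z - w) ^ n * exp (w z)`. -/
def shiftedExpCoeff (w : ℝ) : ℕ → ℕ → ℝ
  | 0, m => w ^ m / (m.factorial : ℝ)
  | n + 1, 0 => -w * shiftedExpCoeff w n 0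
  | n + 1, m + 1 => shiftedExpCoeff w n m - w * shiftedExpCoeff w n (m + 1)

theorem shiftedExpCoeff_deriv_zero (w : ℝ) (m : ℕ) :
    (m + 1) * shiftedExpCoeff w 0 (m + 1) - w * shiftedExpCoeff w 0 m = 0 := by
  simp only [shiftedExpCoeff, Nat.factorial_succ]
  have : (m.factorial : ℝ) ≠ 0 := by positivity
  push_cast
  field_simp
  ring

/-- With `f_n = (z - w)^n e^(wz)`, this is the coefficient form of `(d/dz - w) f_(n+1) = (n + 1)
f_n`. -/
theorem shiftedExpCoeff_deriv_succ (w : ℝ) (n m : ℕ) :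
    (m + 1) * shiftedExpCoeff w (n + 1) (m + 1) - w * shiftedExpCoeff w (n + 1) m =
      (n + 1) * shiftedExpCoeff w n m := by
  induction n generalizing m with
  | zero =>
    have h := shiftedExpCoeff_deriv_zero w
    cases m with
    | zero =>
      have h0 := h 0
      simp only [shiftedExpCoeff] at h0 ⊢
      push_cast at h0 ⊢
      linear_combination (-w) * h0
    | succ m =>
      have h0 := h m
      have h1 := h (m + 1)
      rw [shiftedExpCoeff.eq_3, shiftedExpCoeff.eq_3]
      push_cast at h0 h1 ⊢
      linear_combination h0 - w * h1
  | succ n ih =>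
    cases m with
    | zero =>
      have h0 := ih 0
      rw [shiftedExpCoeff.eq_3, shiftedExpCoeff.eq_2 w (n + 1)]
      rw [shiftedExpCoeff.eq_2 w n] at h0 ⊢
      push_cast at h0 ⊢
      linear_combination (-w) * h0
    | succ m =>
      have h0 := ih m
      have h1 := ih (m + 1)
      rw [shiftedExpCoeff.eq_3 w (n + 1) (m + 1), shiftedExpCoeff.eq_3 w (n + 1) m]
      have e := shiftedExpCoeff.eq_3 w n m
      push_cast at h0 h1 e ⊢
      linear_combination h0 - w * h1 - (n + 1) * e

/-- Multiplication by `z` is the shift operator `T` on coefficient sequences, and `T` commutes with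
scalars, so the binomial theorem expands `(T - w)^n`. -/
theorem shiftedExpCoeff_eq_sum (w : ℝ) (n m : ℕ) :
    shiftedExpCoeff w n m = ∑ k ∈ Finset.range (n + 1), (n.choose k : ℝ) * (-w) ^ (n - k) *
      (if k ≤ m then w ^ (m - k) / ((m - k).factorial : ℝ) else 0) := by
  let T : Module.End ℝ (ℕ → ℝ) :=
    { toFun := fun f m => if m = 0 then 0 else f (m - 1)
      map_add' := fun f g => by ext m; simp only [Pi.add_apply]; split_ifs <;> simp
      map_smul' := fun c f => by
        ext m; simp only [Pi.smul_apply, RingHom.id_apply]; split_ifs <;> simp }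
  have hT : ∀ k f m, (T ^ k) f m = if k ≤ m then f (m - k) else 0 := by
    intro k
    induction k with
    | zero => simp
    | succ k ih =>
      intro f m
      rw [pow_succ', Module.End.mul_apply]
      change (if m = 0 then 0 else (T ^ k) f (m - 1)) = _
      rw [ih]
      by_cases hm : m = 0
      · simp [hm]
      · by_cases hk : k + 1 ≤ m
        · have : k ≤ m - 1 := by omega
          simp [hm, hk, this, Nat.sub_sub, add_comm]
        · have : ¬ k ≤ m - 1 := by omega
          simp [hm, hk, this]
  have ha : ∀ n, shiftedExpCoeff w n =
      ((T + (-w) • (1 : Module.End ℝ (ℕ → ℝ))) ^ n) (shiftedExpCoeff w 0) := by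
    intro n
    induction n with
    | zero => simp
    | succ n ih =>
      rw [pow_succ', Module.End.mul_apply, ← ih]
      ext m
      cases m with
      | zero => simp [shiftedExpCoeff, T]
      | succ m => simp [shiftedExpCoeff, T]; ring
  have hc : Commute T ((-w) • (1 : Module.End ℝ (ℕ → ℝ))) :=
    (Commute.one_right T).smul_right _
  rw [ha, hc.add_pow, LinearMap.sum_apply, Finset.sum_apply]
  refine Finset.sum_congr rfl fun k _ => ?_
  rw [smul_pow, one_pow, mul_assoc, Module.End.mul_apply, Module.End.mul_apply]
  rw [hT]
  simp only [Module.End.natCast_apply, LinearMap.smul_apply, Module.End.one_apply, Pi.smul_apply,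
    smul_eq_mul, nsmul_eq_mul, Pi.mul_apply, shiftedExpCoeff]
  split_ifs
  · simp; ring
  · simp

theorem shiftedExpCoeff_self (w : ℝ) (n : ℕ) :
    shiftedExpCoeff w n n = laguerrePoly n (w ^ 2) := by
  rw [shiftedExpCoeff_eq_sum, laguerrePoly, ← Finset.sum_range_reflect]
  refine Finset.sum_congr rfl fun k hk => ?_
  have hk' : k ≤ n := by simpa [Nat.lt_succ_iff] using hk
  have e1 : n + 1 - 1 - k = n - k := by omega
  have e2 : n - (n - k) = k := by omega
  rw [e1, e2, Nat.choose_symm hk', if_pos (Nat.sub_le n k)]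
  rw [show -w ^ 2 = (-w) * w by ring, mul_pow]
  ring

/-- For the Fock norm `‖f‖² = ∑ m! |f_m|²`, multiplication by `z - w` is adjoint to `d/dz - w`, and
their commutator is 1. Hence `‖(z - w) f‖² = ‖f‖² + ‖(d/dz - w) f‖²`. Truncating the sums at `K`
leaves the boundary term. -/
theorem sum_sq_shiftedExpCoeff_succ (w : ℝ) (n K : ℕ) :
    ∑ m ∈ Finset.range (K + 1), (m.factorial : ℝ) * shiftedExpCoeff w (n + 1) m ^ 2 =
      ∑ m ∈ Finset.range (K + 1), (m.factorial : ℝ) * (shiftedExpCoeff w n m ^ 2 +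
        ((m + 1) * shiftedExpCoeff w n (m + 1) - w * shiftedExpCoeff w n m) ^ 2) -
      ((K + 1).factorial : ℝ) * (shiftedExpCoeff w n K ^ 2 +
        (K + 1) * shiftedExpCoeff w n (K + 1) ^ 2 -
        2 * w * shiftedExpCoeff w n K * shiftedExpCoeff w n (K + 1)) := by
  induction K with
  | zero => simp [shiftedExpCoeff]; ring
  | succ K ih =>
    rw [Finset.sum_range_succ, ih, Finset.sum_range_succ _ (K + 1), shiftedExpCoeff.eq_3]
    rw [Nat.factorial_succ (K + 1)]
    push_cast
    ring

/-- Up to a boundary term of favourable sign, `‖f_(n+2)‖² = ‖f_(n+1)‖² + (n + 1)² ‖f_n‖²`, and `(n +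
1)! + (n + 1)² n! = (n + 2)!`. Truncation avoids any question of convergence. -/
theorem sum_sq_shiftedExpCoeff_le (w : ℝ) (n K : ℕ) (hK : w ^ 2 ≤ K) :
    ∑ m ∈ Finset.range (K + 1), (m.factorial : ℝ) * shiftedExpCoeff w n m ^ 2 ≤
      n.factorial * Real.exp (w ^ 2) := by
  have step : ∀ n, ∑ m ∈ Finset.range (K + 1), (m.factorial : ℝ) * shiftedExpCoeff w (n + 1) m ^ 2 ≤
      ∑ m ∈ Finset.range (K + 1), (m.factorial : ℝ) * (shiftedExpCoeff w n m ^ 2 +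
        ((m + 1) * shiftedExpCoeff w n (m + 1) - w * shiftedExpCoeff w n m) ^ 2) := by
    intro n
    rw [sum_sq_shiftedExpCoeff_succ, sub_le_self_iff]
    -- The boundary term is a quadratic form, nonnegative because `w² ≤ K + 1`.
    refine mul_nonneg (by positivity) ?_
    nlinarith [sq_nonneg (shiftedExpCoeff w n K - w * shiftedExpCoeff w n (K + 1)),
      sq_nonneg (shiftedExpCoeff w n (K + 1))]
  have h0 : ∑ m ∈ Finset.range (K + 1), (m.factorial : ℝ) * shiftedExpCoeff w 0 m ^ 2 ≤
      Real.exp (w ^ 2) := by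
    refine le_trans (le_of_eq (Finset.sum_congr rfl fun m _ => ?_))
      (Real.sum_le_exp_of_nonneg (sq_nonneg w) (K + 1))
    have : (m.factorial : ℝ) ≠ 0 := by positivity
    simp only [shiftedExpCoeff]
    field_simp
    ring
  induction n using Nat.strong_induction_on with
  | _ n ih =>
    match n with
    | 0 => simpa using h0
    | 1 =>
      refine (step 0).trans ?_
      simp only [shiftedExpCoeff_deriv_zero]
      simpa using h0
    | n + 2 =>
      refine (step (n + 1)).trans ?_
      simp only [shiftedExpCoeff_deriv_succ]
      have i1 := ih (n + 1) (by omega)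
      have i0 := ih n (by omega)
      have : ∑ m ∈ Finset.range (K + 1), (m.factorial : ℝ) * (shiftedExpCoeff w (n + 1) m ^ 2 +
          ((n + 1) * shiftedExpCoeff w n m) ^ 2) =
          ∑ m ∈ Finset.range (K + 1), (m.factorial : ℝ) * shiftedExpCoeff w (n + 1) m ^ 2 +
          (n + 1) ^ 2 * ∑ m ∈ Finset.range (K + 1), (m.factorial : ℝ) *
            shiftedExpCoeff w n m ^ 2 := by
        rw [Finset.mul_sum, ← Finset.sum_add_distrib]
        exact Finset.sum_congr rfl fun m _ => by ring
      rw [this]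
      have i2 := mul_le_mul_of_nonneg_left i0 (by positivity : (0:ℝ) ≤ (n + 1) ^ 2)
      refine (add_le_add i1 i2).trans (le_of_eq ?_)
      rw [Nat.factorial_succ (n + 1), Nat.factorial_succ n]
      push_cast
      ring

/-- One term of the Fock norm is at most the whole: `n! L_n(w²)² ≤ ‖(z - w)^n e^(wz)‖² ≤ n! e^(w²)`,
with `w² = x`. -/
theorem abs_laguerreFun_le_one (n : ℕ) {x : ℝ} (hx : 0 ≤ x) : |laguerreFun n x| ≤ 1 := by
  -- `K ≥ x` is needed for the norm bound, and `K ≥ n` so that the truncated sum contains the term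
  -- `m = n`.
  obtain ⟨K, hK⟩ := exists_nat_ge (max x n)
  have hKx : x ≤ K := (le_max_left _ _).trans hK
  have hKn : n ≤ K := by exact_mod_cast (le_max_right _ _).trans hK
  have hw : Real.sqrt x ^ 2 = x := Real.sq_sqrt hx
  have h := sum_sq_shiftedExpCoeff_le (Real.sqrt x) n K (by rwa [hw])
  have h1 : (n.factorial : ℝ) * shiftedExpCoeff (Real.sqrt x) n n ^ 2 ≤
      n.factorial * Real.exp x := by
    rw [hw] at h
    exact (Finset.single_le_sum (f := fun m => (m.factorial : ℝ) *
      shiftedExpCoeff (Real.sqrt x) n m ^ 2) (fun m _ => by positivity)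
      (Finset.mem_range.mpr (by omega))).trans h
  rw [shiftedExpCoeff_self, hw] at h1
  have h2 : laguerrePoly n x ^ 2 ≤ Real.exp x := le_of_mul_le_mul_left h1 (by positivity)
  have h3 : laguerreFun n x ^ 2 ≤ 1 := by
    rw [laguerreFun, mul_pow, ← Real.exp_nat_mul]
    calc laguerrePoly n x ^ 2 * Real.exp ((2 : ℕ) * (-x / 2)) ≤
        Real.exp x * Real.exp ((2 : ℕ) * (-x / 2)) := by gcongr
      _ = 1 := by rw [← Real.exp_add]; norm_num; ring
  exact (sq_le_one_iff_abs_le_one _).mp h3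

/-! ### The Laguerre differential equation. -/

open Polynomial in
/-- The Laguerre polynomial as a formal polynomial. -/
def laguerreX (n : ℕ) : ℝ[X] :=
  ∑ k ∈ Finset.range (n + 1), C ((n.choose k : ℝ) * (-1) ^ k / (k.factorial : ℝ)) * X ^ k

theorem eval_laguerreX (n : ℕ) (x : ℝ) : (laguerreX n).eval x = laguerrePoly n x := by
  rw [laguerreX, laguerrePoly, Polynomial.eval_finsetSum]
  refine Finset.sum_congr rfl fun k _ => ?_
  rw [Polynomial.eval_mul, Polynomial.eval_C, Polynomial.eval_pow, Polynomial.eval_X, neg_pow x k]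
  ring

theorem coeff_laguerreX (n k : ℕ) :
    (laguerreX n).coeff k = (n.choose k : ℝ) * (-1) ^ k / (k.factorial : ℝ) := by
  rw [laguerreX, Polynomial.finsetSum_coeff]
  simp only [Polynomial.coeff_C_mul, Polynomial.coeff_X_pow, mul_ite, mul_one, mul_zero]
  rw [Finset.sum_ite_eq]
  split_ifs with h
  · rfl
  · rw [Nat.choose_eq_zero_of_lt (by simpa using h)]; simp

open Polynomial in
theorem laguerreX_ode (n : ℕ) :
    X * derivative (derivative (laguerreX n)) + derivative (laguerreX n) =
      X * derivative (laguerreX n) - C (n : ℝ) * laguerreX n := by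
  have key : ∀ k : ℕ, ((k : ℝ) + 1) ^ 2 * (laguerreX n).coeff (k + 1) =
      ((k : ℝ) - n) * (laguerreX n).coeff k := by
    intro k
    rw [coeff_laguerreX, coeff_laguerreX, Nat.factorial_succ, pow_succ]
    have hc : ((n.choose (k + 1) : ℕ) : ℝ) * (k + 1) = n.choose k * (n - k) := by
      by_cases hkn : k ≤ n
      · have := Nat.choose_succ_right_eq n k
        have h' : ((n.choose (k + 1) * (k + 1) : ℕ) : ℝ) = (n.choose k * (n - k) : ℕ) := by
          rw [this]
        push_cast [Nat.cast_sub hkn] at h'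
        exact h'
      · rw [Nat.choose_eq_zero_of_lt (by omega : n < k + 1),
          Nat.choose_eq_zero_of_lt (by omega : n < k)]
        simp
    have : (k.factorial : ℝ) ≠ 0 := by positivity
    push_cast
    field_simp
    linear_combination (-(-1 : ℝ) ^ k) * hc
  ext k
  cases k with
  | zero =>
    have := key 0
    simp only [coeff_add, coeff_sub, coeff_derivative, mul_coeff_zero, coeff_X_zero, coeff_C_zero]
    push_cast at this ⊢
    linear_combination this
  | succ k =>
    have := key (k + 1)
    simp only [coeff_add, coeff_sub, coeff_C_mul, coeff_derivative, coeff_X_mul]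
    push_cast at this ⊢
    linear_combination this

/-- The derivative of the Laguerre function. -/
def laguerreFunDeriv (n : ℕ) (x : ℝ) : ℝ :=
  ((Polynomial.derivative (laguerreX n)).eval x - laguerrePoly n x / 2) * Real.exp (-x / 2)

theorem hasDerivAt_exp_neg_half (x : ℝ) :
    HasDerivAt (fun t : ℝ => Real.exp (-t / 2)) (Real.exp (-x / 2) * (-1 / 2)) x :=
  ((hasDerivAt_id x).neg.div_const 2).exp

theorem hasDerivAt_laguerreFun (n : ℕ) (x : ℝ) :
    HasDerivAt (laguerreFun n) (laguerreFunDeriv n x) x := by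
  have h := ((laguerreX n).hasDerivAt x).mul (hasDerivAt_exp_neg_half x)
  have e : laguerreFun n = (fun t => (laguerreX n).eval t) * fun t : ℝ => Real.exp (-t / 2) := by
    ext t; simp [laguerreFun, eval_laguerreX]
  rw [e]
  refine h.congr_deriv ?_
  rw [laguerreFunDeriv, eval_laguerreX]
  ring

/-- Self-adjoint form of the equation, `(t y')' = -(a - t/4) y` with `a = n + 1/2`. All decay
estimates are drawn from it. -/
theorem hasDerivAt_mul_laguerreFunDeriv (n : ℕ) (x : ℝ) :
    HasDerivAt (fun t => t * laguerreFunDeriv n t)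
      (-((n + 1 / 2 : ℝ) - x / 4) * laguerreFun n x) x := by
  have h := (hasDerivAt_id x).mul ((((Polynomial.derivative (laguerreX n)).hasDerivAt x).sub
    (((laguerreX n).hasDerivAt x).div_const 2)).mul (hasDerivAt_exp_neg_half x))
  have e : (fun t => t * laguerreFunDeriv n t) = id * (((fun t =>
      (Polynomial.derivative (laguerreX n)).eval t) - fun t => (laguerreX n).eval t / 2) *
      fun t : ℝ => Real.exp (-t / 2)) := by
    ext t; simp [laguerreFunDeriv, eval_laguerreX]
  rw [e]
  refine h.congr_deriv ?_
  have ode := congrArg (Polynomial.eval x) (laguerreX_ode n)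
  simp only [Polynomial.eval_add, Polynomial.eval_mul, Polynomial.eval_sub, Polynomial.eval_X,
    Polynomial.eval_C, eval_laguerreX] at ode
  simp only [laguerreFun, Pi.mul_apply, Pi.sub_apply, id, eval_laguerreX]
  linear_combination Real.exp (-x / 2) * ode

theorem laguerreFun_zero (n : ℕ) : laguerreFun n 0 = 1 := by
  rw [laguerreFun, ← eval_laguerreX, ← Polynomial.coeff_zero_eq_eval_zero, coeff_laguerreX]
  simp

theorem continuous_laguerreFun (n : ℕ) : Continuous (laguerreFun n) :=
  continuous_iff_continuousAt.mpr fun x => (hasDerivAt_laguerreFun n x).continuousAt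

/-! ### Decay of Laguerre functions -/

/-- On `[0, 4a]` the coefficient `a - t/4` lies in `[0, a]` and `|y| ≤ 1`, so `t y'` vanishes at 0
and has slope at most `a`. -/
theorem abs_mul_laguerreFunDeriv_le (n : ℕ) {t : ℝ} (h0 : 0 ≤ t) (h1 : t ≤ 4 * (n + 1 / 2 : ℝ)) :
    |t * laguerreFunDeriv n t| ≤ (n + 1 / 2 : ℝ) * t := by
  have h := (convex_Icc (0 : ℝ) t).norm_image_sub_le_of_norm_hasDerivWithin_le
    (f := fun t => t * laguerreFunDeriv n t)
    (f' := fun x => -((n + 1 / 2 : ℝ) - x / 4) * laguerreFun n x) (C := (n + 1 / 2 : ℝ))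
    (fun x _ => (hasDerivAt_mul_laguerreFunDeriv n x).hasDerivWithinAt)
    (fun x hx => by
      rw [norm_mul, Real.norm_eq_abs, Real.norm_eq_abs, abs_neg]
      have a1 := abs_laguerreFun_le_one n hx.1
      have a2 : |(n + 1 / 2 : ℝ) - x / 4| ≤ n + 1 / 2 := by
        rw [abs_of_nonneg (by linarith [hx.2])]; linarith [hx.1]
      calc _ ≤ (n + 1 / 2 : ℝ) * 1 := by gcongr
        _ = _ := mul_one _)
    (left_mem_Icc.mpr h0) (right_mem_Icc.mpr h0)
  simpa [abs_of_nonneg h0] using h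

theorem abs_laguerreFun_sub_one_le (n : ℕ) {t : ℝ} (h0 : 0 ≤ t) (h1 : t ≤ 4 * (n + 1 / 2 : ℝ)) :
    |laguerreFun n t - 1| ≤ (n + 1 / 2 : ℝ) * t := by
  rcases h0.eq_or_lt with rfl | h0
  · simp [laguerreFun_zero]
  obtain ⟨c, hc, he⟩ := exists_hasDerivAt_eq_slope (laguerreFun n) (laguerreFunDeriv n) h0
    (continuous_laguerreFun n).continuousOn fun x _ => hasDerivAt_laguerreFun n x
  rw [laguerreFun_zero, sub_zero, eq_div_iff h0.ne'] at he
  rw [← he, abs_mul, abs_of_pos h0]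
  have h2 := abs_mul_laguerreFunDeriv_le n hc.1.le (hc.2.le.trans h1)
  rw [abs_mul, abs_of_pos hc.1, mul_comm] at h2
  gcongr
  exact le_of_mul_le_mul_right h2 hc.1

/-- A decreasing energy of the Laguerre equation. -/
def laguerreEnergy (n : ℕ) (t : ℝ) : ℝ :=
  ((laguerreFun n t + 4 * (t * laguerreFunDeriv n t)) ^ 2 +
    (16 * (n + 1 / 2 : ℝ) * t - 4 * t ^ 2 + 1) * laguerreFun n t ^ 2) / Real.sqrt t

/-- With `τ = √t` and `u = τ^(1/2) y`, the equation takes the Liouville form `u'' + (4a - τ² +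
1/(4τ²)) u = 0`, and `laguerreEnergy` is `4 (u'² + (4a - τ² + 1/(4τ²)) u²)`. Only the derivative of
the potential survives, and the potential decreases. -/
theorem hasDerivAt_laguerreEnergy (n : ℕ) {t : ℝ} (ht : 0 < t) :
    HasDerivAt (laguerreEnergy n)
      (-((4 * t + 1 / t) * laguerreFun n t ^ 2) / Real.sqrt t) t := by
  have hy := hasDerivAt_laguerreFun n t
  have hp := hasDerivAt_mul_laguerreFunDeriv n t
  have hx := hasDerivAt_id t
  have hs := Real.hasDerivAt_sqrt ht.ne'
  have h := ((((hy.add (hp.const_mul 4)).pow 2).add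
    ((((hx.const_mul (16 * (n + 1 / 2 : ℝ))).sub ((hx.pow 2).const_mul 4)).add_const 1).mul
      (hy.pow 2))).div hs (Real.sqrt_pos.mpr ht).ne')
  refine h.congr_deriv ?_
  have hq : Real.sqrt t ≠ 0 := (Real.sqrt_pos.mpr ht).ne'
  have hq2 : Real.sqrt t ^ 2 = t := Real.sq_sqrt ht.le
  simp only [Pi.add_apply, Pi.mul_apply, Pi.pow_apply, Pi.sub_apply, id]
  set q := Real.sqrt t
  rw [← hq2]
  field_simp
  push_cast
  ring

theorem laguerreEnergy_anti (n : ℕ) : AntitoneOn (laguerreEnergy n) (Ioi 0) := by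
  refine antitoneOn_of_hasDerivWithinAt_nonpos (convex_Ioi 0)
    (fun t ht => (hasDerivAt_laguerreEnergy n ht).continuousAt.continuousWithinAt)
    (fun t ht => (hasDerivAt_laguerreEnergy n (interior_subset ht)).hasDerivWithinAt)
    fun t ht => ?_
  have ht' : (0 : ℝ) < t := interior_subset ht
  rw [neg_div, neg_nonpos]
  positivity

theorem sq_laguerreFun_le (n : ℕ) {t : ℝ} (h0 : 1 / (4 * (n + 1 / 2 : ℝ)) ≤ t)
    (h1 : t ≤ 2 * (n + 1 / 2 : ℝ)) :
    laguerreFun n t ^ 2 ≤ 9 / 4 / (Real.sqrt (n + 1 / 2 : ℝ) * Real.sqrt t) := by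
  set a : ℝ := n + 1 / 2 with ha
  have ha2 : 1 / 2 ≤ a := by rw [ha]; linarith [(Nat.cast_nonneg n : (0 : ℝ) ≤ n)]
  have ha0 : 0 < a := by linarith
  set t0 : ℝ := 1 / (4 * a) with ht0
  have ht0p : 0 < t0 := by positivity
  have htp : 0 < t := ht0p.trans_le h0
  have hm := laguerreEnergy_anti n ht0p htp h0
  have hat : a * t0 = 1 / 4 := by rw [ht0]; field_simp
  have ht04 : t0 ≤ 4 * a := by
    rw [ht0, div_le_iff₀ (by positivity)]; nlinarith
  have hy := abs_le.mp (abs_laguerreFun_le_one n ht0p.le)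
  have hp := abs_le.mp (abs_mul_laguerreFunDeriv_le n ht0p.le ht04)
  rw [← ha, hat] at hp
  -- Since `a t0 = 1/4`, the first square is at most `(1 + 4 · 1/4)² = 4` and the coefficient of
  -- `y²` is at most `4 + 1`, giving 9.
  have hup : laguerreEnergy n t0 ≤ 9 / Real.sqrt t0 := by
    unfold laguerreEnergy
    gcongr
    rw [← ha]
    have hy2 : laguerreFun n t0 ^ 2 ≤ 1 := by nlinarith
    have hx2 : (laguerreFun n t0 + 4 * (t0 * laguerreFunDeriv n t0)) ^ 2 ≤ 4 := by nlinarith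
    have : 0 ≤ 16 * a * t0 - 4 * t0 ^ 2 + 1 := by nlinarith
    nlinarith [mul_le_mul_of_nonneg_left hy2 this]
  -- The restriction `t ≤ 2a` enters here: it keeps half of the potential, `16 a t - 4 t² ≥ 8 a t`.
  have hlow : 8 * a * t * laguerreFun n t ^ 2 / Real.sqrt t ≤ laguerreEnergy n t := by
    unfold laguerreEnergy
    gcongr
    rw [← ha]
    have : 8 * a * t ≤ 16 * a * t - 4 * t ^ 2 + 1 := by nlinarith
    nlinarith [mul_le_mul_of_nonneg_right this (sq_nonneg (laguerreFun n t)),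
      sq_nonneg (laguerreFun n t + 4 * (t * laguerreFunDeriv n t))]
  have h := (hlow.trans hm).trans hup
  have hs0 : Real.sqrt t0 = 1 / (2 * Real.sqrt a) := by
    rw [ht0, Real.sqrt_div zero_le_one, Real.sqrt_one, Real.sqrt_mul (by norm_num),
      show (4 : ℝ) = 2 ^ 2 by norm_num, Real.sqrt_sq (by norm_num)]
  rw [hs0] at h
  have hsa : 0 < Real.sqrt a := Real.sqrt_pos.mpr ha0
  have hst : 0 < Real.sqrt t := Real.sqrt_pos.mpr htp
  have ea : Real.sqrt a ^ 2 = a := Real.sq_sqrt ha0.le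
  have et : Real.sqrt t ^ 2 = t := Real.sq_sqrt htp.le
  rw [le_div_iff₀ (by positivity)]
  set α := Real.sqrt a
  set β := Real.sqrt t
  rw [← ea, ← et] at h
  have h' : 8 * α ^ 2 * β * laguerreFun n (β ^ 2) ^ 2 ≤ 18 * α := by
    have e1 : 8 * α ^ 2 * β ^ 2 * laguerreFun n (β ^ 2) ^ 2 / β =
      8 * α ^ 2 * β * laguerreFun n (β ^ 2) ^ 2 := by field_simp
    have e2 : 9 / (1 / (2 * α)) = 18 * α := by field_simp; norm_num
    rw [← e1, ← e2]; exact h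
  rw [et] at h'
  have : α * (8 * α * β * laguerreFun n t ^ 2) ≤ α * 18 := by linarith
  have := le_of_mul_le_mul_left this hsa
  linarith

open Polynomial in
theorem lintegral_sq_laguerreFun_le (n : ℕ) :
    ∫⁻ t in Ioi (1 / (4 * (n + 1 / 2 : ℝ))), ENNReal.ofReal (laguerreFun n t ^ 2) ≤
      ENNReal.ofReal (5 * (n + 1 / 2)) := by
  set a : ℝ := n + 1 / 2 with ha
  have ha2 : 1 / 2 ≤ a := by rw [ha]; linarith [(Nat.cast_nonneg n : (0 : ℝ) ≤ n)]
  have ha0 : 0 < a := by linarith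
  set t0 : ℝ := 1 / (4 * a) with ht0
  have ht0p : 0 < t0 := by positivity
  have hat : a * t0 = 1 / 4 := by rw [ht0]; field_simp
  have ht04 : t0 ≤ 4 * a := by
    rw [ht0, div_le_iff₀ (by positivity)]; nlinarith
  -- With `p = t y'`, the equation cancels the cross terms in the derivative of `p²/t + (a - t/4)
  -- y²`, leaving `-(p²/t² + y²/4)`. Thus `H` is a primitive of a function dominating `y²`.
  let H : ℝ → ℝ := fun t => -4 * ((t * laguerreFunDeriv n t) ^ 2 / t +
    (a - t / 4) * laguerreFun n t ^ 2)
  let H' : ℝ → ℝ := fun t => 4 * (t * laguerreFunDeriv n t) ^ 2 / t ^ 2 + laguerreFun n t ^ 2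
  have hH : ∀ t ∈ Ici t0, HasDerivAt H (H' t) t := by
    intro t ht
    have htp : 0 < t := ht0p.trans_le ht
    have hy := hasDerivAt_laguerreFun n t
    have hp := hasDerivAt_mul_laguerreFunDeriv n t
    have hx := hasDerivAt_id t
    have h := ((((hp.pow 2).div hx htp.ne').add
      (((hx.div_const 4).const_sub a).mul (hy.pow 2))).const_mul (-4))
    refine h.congr_deriv ?_
    simp only [Pi.pow_apply, id, H', ← ha]
    field_simp
    push_cast
    ring
  -- For `t > 0`, `H` is a polynomial times `e^(-t)`.
  have hlim : Filter.Tendsto H Filter.atTop (nhds 0) := by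
    let q : ℝ[X] := C (-4) * (X * (derivative (laguerreX n) - C (1 / 2) * laguerreX n) ^ 2 +
      (C a - C (1 / 4) * X) * laguerreX n ^ 2)
    refine (Polynomial.tendsto_div_exp_atTop q).congr' ?_
    filter_upwards [Filter.eventually_gt_atTop 0] with t ht
    simp only [q, H, eval_mul, eval_C, eval_add, eval_pow, eval_X, eval_sub, eval_laguerreX,
      laguerreFun, laguerreFunDeriv]
    have e : Real.exp (-t / 2) ^ 2 = (Real.exp t)⁻¹ := by
      rw [← Real.exp_nat_mul, ← Real.exp_neg]; congr 1; push_cast; ring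
    simp only [mul_pow, e]
    have := Real.exp_ne_zero t
    field_simp
  have hpos : ∀ t ∈ Ioi t0, 0 ≤ H' t := fun t _ => by simp only [H']; positivity
  have hint := integrableOn_Ioi_deriv_of_nonneg' hH hpos hlim
  have hval := integral_Ioi_of_hasDerivAt_of_nonneg' hH hpos hlim
  calc _ ≤ ∫⁻ t in Ioi t0, ENNReal.ofReal (H' t) := by
        refine lintegral_mono fun t => ENNReal.ofReal_le_ofReal ?_
        simp only [H']
        have : 0 ≤ 4 * (t * laguerreFunDeriv n t) ^ 2 / t ^ 2 := by positivity
        linarith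
    _ = ENNReal.ofReal (0 - H t0) := by
        rw [← hval, ofReal_integral_eq_lintegral_ofReal hint
          ((ae_restrict_mem measurableSet_Ioi).mono hpos)]
    _ ≤ _ := by
        refine ENNReal.ofReal_le_ofReal ?_
        have hy := abs_le.mp (abs_laguerreFun_le_one n ht0p.le)
        have hp := abs_le.mp (abs_mul_laguerreFunDeriv_le n ht0p.le ht04)
        rw [← ha, hat] at hp
        have hy2 : laguerreFun n t0 ^ 2 ≤ 1 := by nlinarith
        have hp2 : (t0 * laguerreFunDeriv n t0) ^ 2 ≤ 1 / 16 := by nlinarith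
        have h1 : (t0 * laguerreFunDeriv n t0) ^ 2 / t0 ≤ a / 4 := by
          rw [div_le_iff₀ ht0p]; linarith
        have h2 : (a - t0 / 4) * laguerreFun n t0 ^ 2 ≤ a := by
          nlinarith [mul_le_mul_of_nonneg_left hy2 (by linarith : 0 ≤ a - t0 / 4)]
        simp only [H]
        linarith

theorem lintegral_sq_laguerreFun_div_le (n : ℕ) :
    ∫⁻ t in Ioi (1 / (4 * (n + 1 / 2 : ℝ))), ENNReal.ofReal (laguerreFun n t ^ 2 / t) ≤ 12 := by
  set a : ℝ := n + 1 / 2 with ha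
  have ha2 : 1 / 2 ≤ a := by rw [ha]; linarith [(Nat.cast_nonneg n : (0 : ℝ) ≤ n)]
  have ha0 : 0 < a := by linarith
  set t0 : ℝ := 1 / (4 * a) with ht0
  have ht0p : 0 < t0 := by positivity
  have ht02 : t0 ≤ 2 * a := by
    rw [ht0, div_le_iff₀ (by positivity)]; nlinarith
  have hsa : 0 < Real.sqrt a := Real.sqrt_pos.mpr ha0
  rw [← Ioc_union_Ioi_eq_Ioi ht02]
  refine (lintegral_union_le _ _ _).trans ?_
  -- Below `2a` the pointwise decay is used; the factor `√a` from `∫ t^(-3/2)` at the lower endpoint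
  -- cancels the `1/√a`.
  have h1 : ∫⁻ t in Ioc t0 (2 * a), ENNReal.ofReal (laguerreFun n t ^ 2 / t) ≤ 9 := by
    have hint : IntegrableOn (fun t : ℝ => 9 / 4 / Real.sqrt a * t ^ (-3 / 2 : ℝ)) (Ioi t0) :=
      (integrableOn_Ioi_rpow_of_lt (by norm_num) ht0p).const_mul _
    calc _ ≤ ∫⁻ t in Ioc t0 (2 * a), ENNReal.ofReal (9 / 4 / Real.sqrt a * t ^ (-3 / 2 : ℝ)) := by
          refine setLIntegral_mono (by fun_prop) fun t ht => ENNReal.ofReal_le_ofReal ?_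
          have htp : 0 < t := ht0p.trans ht.1
          have hs := sq_laguerreFun_le n ht.1.le ht.2
          rw [← ha] at hs
          have e : t ^ (-3 / 2 : ℝ) = 1 / (Real.sqrt t * t) := by
            rw [Real.sqrt_eq_rpow, show (-3 / 2 : ℝ) = -(1 / 2 + 1) by norm_num,
              Real.rpow_neg htp.le, Real.rpow_add htp, Real.rpow_one, inv_eq_one_div]
          rw [e]
          calc _ ≤ 9 / 4 / (Real.sqrt a * Real.sqrt t) / t := by gcongr
            _ = _ := by field_simp
      _ ≤ ∫⁻ t in Ioi t0, ENNReal.ofReal (9 / 4 / Real.sqrt a * t ^ (-3 / 2 : ℝ)) :=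
          lintegral_mono_set Ioc_subset_Ioi_self
      _ = ENNReal.ofReal 9 := by
          rw [← ofReal_integral_eq_lintegral_ofReal hint
            ((ae_restrict_mem measurableSet_Ioi).mono fun t ht => by
              have : 0 < t := ht0p.trans ht
              positivity), integral_const_mul, integral_Ioi_rpow_of_lt (by norm_num) ht0p]
          congr 1
          have e : t0 ^ (-3 / 2 + 1 : ℝ) = 2 * Real.sqrt a := by
            rw [show (-3 / 2 + 1 : ℝ) = -(1 / 2) by norm_num, Real.rpow_neg ht0p.le,
              ← Real.sqrt_eq_rpow, ht0, Real.sqrt_div zero_le_one, Real.sqrt_one,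
              Real.sqrt_mul (by norm_num), show (4 : ℝ) = 2 ^ 2 by norm_num,
              Real.sqrt_sq (by norm_num)]
            field_simp
          rw [e]
          field_simp
          norm_num
      _ = 9 := by norm_num
  -- Above `2a` the weight `1/t` is at most `1/(2a)`, and the mean-square bound `5a` suffices.
  have h2 : ∫⁻ t in Ioi (2 * a), ENNReal.ofReal (laguerreFun n t ^ 2 / t) ≤ 3 := by
    calc _ ≤ ∫⁻ t in Ioi (2 * a), ENNReal.ofReal (1 / (2 * a)) *
          ENNReal.ofReal (laguerreFun n t ^ 2) := by
          have := continuous_laguerreFun n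
          refine setLIntegral_mono (by fun_prop) fun t ht => ?_
          rw [← ENNReal.ofReal_mul (by positivity), one_div_mul_eq_div]
          have : 2 * a < t := ht
          gcongr
      _ = ENNReal.ofReal (1 / (2 * a)) * ∫⁻ t in Ioi (2 * a),
          ENNReal.ofReal (laguerreFun n t ^ 2) := by
          rw [lintegral_const_mul' _ _ ENNReal.ofReal_ne_top]
      _ ≤ ENNReal.ofReal (1 / (2 * a)) * ENNReal.ofReal (5 * a) := by
          gcongr
          exact (lintegral_mono_set (Ioi_subset_Ioi ht02)).trans (lintegral_sq_laguerreFun_le n)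
      _ = ENNReal.ofReal (5 / 2) := by
          rw [← ENNReal.ofReal_mul (by positivity)]; congr 1; field_simp
      _ ≤ ENNReal.ofReal 3 := ENNReal.ofReal_le_ofReal (by norm_num)
      _ = 3 := by norm_num
  calc _ ≤ (9 : ℝ≥0∞) + 3 := add_le_add h1 h2
    _ = 12 := by norm_num

/-- Lowering the endpoint by `q²` costs at most `∫ dt/t = 2 log(1/q)`, as `|ℓ_n| ≤ 1`. The logarithm
is replaced by `q^(-1/2)`, which is still integrable when `q` is later bounded below by the modulus
of one coordinate. -/
theorem lintegral_sq_laguerreFun_div_le_log (n : ℕ) {q : ℝ} (hq : 0 < q) (hq1 : q ≤ 1) :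
    ∫⁻ t in Ioi (q ^ 2 / (4 * (n + 1 / 2 : ℝ))), ENNReal.ofReal (laguerreFun n t ^ 2 / t) ≤
      ENNReal.ofReal (12 + 4 * q ^ (-1 / 2 : ℝ)) := by
  set a : ℝ := n + 1 / 2 with ha
  have ha0 : 0 < a := by positivity
  have hτ : q ^ 2 / (4 * a) ≤ 1 / (4 * a) := by
    gcongr
    exact pow_le_one₀ hq.le hq1
  have hτp : 0 < q ^ 2 / (4 * a) := by positivity
  rw [← Ioc_union_Ioi_eq_Ioi hτ]
  refine (lintegral_union_le _ _ _).trans ?_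
  rw [add_comm, ENNReal.ofReal_add (by norm_num) (by positivity)]
  refine add_le_add ((lintegral_sq_laguerreFun_div_le n).trans (by norm_num)) ?_
  have hint : IntegrableOn (fun t : ℝ => t⁻¹) (Ioc (q ^ 2 / (4 * a)) (1 / (4 * a))) := by
    rw [← intervalIntegrable_iff_integrableOn_Ioc_of_le hτ]
    refine intervalIntegral.intervalIntegrable_inv (fun x hx => ?_) continuousOn_id
    rw [uIcc_of_le hτ] at hx
    exact (hτp.trans_le hx.1).ne'
  calc _ ≤ ∫⁻ t in Ioc (q ^ 2 / (4 * a)) (1 / (4 * a)), ENNReal.ofReal (t⁻¹) := by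
        refine setLIntegral_mono (by fun_prop) fun t ht => ENNReal.ofReal_le_ofReal ?_
        have htp : 0 < t := hτp.trans ht.1
        rw [div_eq_mul_inv]
        have : laguerreFun n t ^ 2 ≤ 1 :=
          (sq_le_one_iff_abs_le_one _).mpr (abs_laguerreFun_le_one n htp.le)
        calc _ ≤ 1 * t⁻¹ := by gcongr
          _ = _ := one_mul _
    _ = ENNReal.ofReal (Real.log (1 / (4 * a) / (q ^ 2 / (4 * a)))) := by
        rw [← ofReal_integral_eq_lintegral_ofReal hint
          ((ae_restrict_mem measurableSet_Ioc).mono fun t ht => by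
            have : 0 < t := hτp.trans ht.1
            positivity), ← intervalIntegral.integral_of_le hτ, integral_inv_of_pos hτp (by positivity)]
    _ ≤ _ := by
        refine ENNReal.ofReal_le_ofReal ?_
        have e : 1 / (4 * a) / (q ^ 2 / (4 * a)) = (q ^ (-1 / 2 : ℝ)) ^ 4 := by
          rw [← Real.rpow_natCast (q ^ (-1 / 2 : ℝ)), ← Real.rpow_mul hq.le,
            show (-1 / 2 : ℝ) * (4 : ℕ) = -(2 : ℕ) by norm_num, Real.rpow_neg hq.le,
            Real.rpow_natCast]
          field_simp
        rw [e, Real.log_pow]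
        have := Real.log_le_sub_one_of_pos (show 0 < q ^ (-1 / 2 : ℝ) by positivity)
        push_cast
        linarith

/-- Substitution `t = (lam/2) q² s²`, for which `ds/s = dt/(2t)`. -/
theorem lintegral_dilated_sq_laguerreFun_le (n : ℕ) {lam s₀ q : ℝ} (hlam : 0 < lam) (hs : 0 < s₀)
    (hs' : 1 ≤ lam * (2 * n + 1) * s₀ ^ 2) (hq : 0 < q) (hq1 : q ≤ 1) :
    ∫⁻ s in Ioi s₀, ENNReal.ofReal (laguerreFun n (lam / 2 * (s * q) ^ 2) ^ 2 * s⁻¹) ≤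
      ENNReal.ofReal (6 + 2 * q ^ (-1 / 2 : ℝ)) := by
  have hn : (0 : ℝ) < n + 1 / 2 := by positivity
  set c := lam / 2 * q ^ 2 with hc
  have hc0 : 0 < c := by positivity
  have hd : ∀ s ∈ Ioi s₀, HasDerivWithinAt (fun s : ℝ => c * s ^ 2) (2 * c * s) (Ioi s₀) s := by
    intro s _
    refine (((hasDerivAt_pow 2 s).const_mul c).congr_deriv ?_).hasDerivWithinAt
    push_cast; ring
  have hinj : InjOn (fun s : ℝ => c * s ^ 2) (Ioi s₀) := by
    intro x hx y hy h
    have hx' : 0 < x := hs.trans hx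
    have hy' : 0 < y := hs.trans hy
    have h2 : x ^ 2 = y ^ 2 := mul_left_cancel₀ hc0.ne' h
    exact (pow_left_inj₀ hx'.le hy'.le two_ne_zero).mp h2
  have h := lintegral_image_eq_lintegral_abs_deriv_mul measurableSet_Ioi hd hinj
    (fun t => ENNReal.ofReal (1 / 2 * (laguerreFun n t ^ 2 / t)))
  have e : ∫⁻ s in Ioi s₀, ENNReal.ofReal (laguerreFun n (lam / 2 * (s * q) ^ 2) ^ 2 * s⁻¹) =
      ∫⁻ s in Ioi s₀, ENNReal.ofReal |2 * c * s| *
        ENNReal.ofReal (1 / 2 * (laguerreFun n (c * s ^ 2) ^ 2 / (c * s ^ 2))) := by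
    refine setLIntegral_congr_fun measurableSet_Ioi fun s hs1 => ?_
    have hs2 : 0 < s := hs.trans hs1
    rw [← ENNReal.ofReal_mul (abs_nonneg _), abs_of_pos (by positivity)]
    congr 1
    rw [show lam / 2 * (s * q) ^ 2 = c * s ^ 2 by rw [hc]; ring]
    field_simp
  rw [e, ← h]
  -- The threshold `lam (2n + 1) s₀² ≥ 1` becomes exactly `t > q² / (4 (n + 1/2))`.
  have hsub : (fun s : ℝ => c * s ^ 2) '' Ioi s₀ ⊆ Ioi (q ^ 2 / (4 * (n + 1 / 2 : ℝ))) := by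
    rintro _ ⟨s, hs1, rfl⟩
    have hs2 : s₀ < s := hs1
    have h3 : s₀ ^ 2 < s ^ 2 := by gcongr
    change _ < c * s ^ 2
    rw [div_lt_iff₀ (by positivity), hc]
    have : 1 < lam * (2 * n + 1) * s ^ 2 := hs'.trans_lt (by gcongr)
    nlinarith [mul_lt_mul_of_pos_left this (by positivity : 0 < q ^ 2)]
  refine (lintegral_mono_set hsub).trans ?_
  simp_rw [ENNReal.ofReal_mul (show (0 : ℝ) ≤ 1 / 2 by norm_num)]
  rw [lintegral_const_mul' _ _ ENNReal.ofReal_ne_top]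
  refine (mul_le_mul_right (lintegral_sq_laguerreFun_div_le_log n hq hq1) _).trans ?_
  rw [← ENNReal.ofReal_mul (by norm_num)]
  exact ENNReal.ofReal_le_ofReal (by ring_nf; rfl)

/-! ### Integrals of Bochner-Riesz type for the Korányi gauge on `E × ℝ` -/

/-- The truncated power `x₊ ^ p`. -/
def truncPow (p x : ℝ) : ℝ := if 0 < x then x ^ p else 0

theorem truncPow_nonneg (p x : ℝ) : 0 ≤ truncPow p x := by
  unfold truncPow; split_ifs <;> positivity

theorem truncPow_of_nonpos (p : ℝ) {x : ℝ} (hx : x ≤ 0) : truncPow p x = 0 := if_neg hx.not_gt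

theorem truncPow_of_pos (p : ℝ) {x : ℝ} (hx : 0 < x) : truncPow p x = x ^ p := if_pos hx

theorem truncPow_le {p x R : ℝ} (hp : 0 ≤ p) (hx : x ≤ R) (hR : 0 ≤ R) : truncPow p x ≤ R ^ p := by
  unfold truncPow; split_ifs
  · gcongr
  · positivity

theorem measurable_truncPow (p : ℝ) : Measurable (truncPow p) :=
  Measurable.ite (measurableSet_lt measurable_const measurable_id) (by fun_prop) measurable_const

theorem truncPow_mul (p x : ℝ) {c : ℝ} (hc : 0 < c) : truncPow p (c * x) = c ^ p * truncPow p x := by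
  by_cases hx : 0 < x
  · rw [truncPow_of_pos p hx, truncPow_of_pos p (by positivity), Real.mul_rpow hc.le hx.le]
  · rw [truncPow_of_nonpos p (not_lt.mp hx), truncPow_of_nonpos p (by nlinarith), mul_zero]

theorem truncPow_eq_max {p : ℝ} (hp : 1 ≤ p) (x : ℝ) : truncPow p x = max x 0 ^ p := by
  by_cases hx : 0 < x
  · rw [truncPow_of_pos p hx, max_eq_left hx.le]
  · rw [truncPow_of_nonpos p (not_lt.mp hx), max_eq_right (not_lt.mp hx),
      Real.zero_rpow (by linarith)]

theorem hasDerivAt_truncPow (p : ℝ) {x : ℝ} (hx : x ≠ 0) :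
    HasDerivAt (truncPow p) (p * truncPow (p - 1) x) x := by
  rcases lt_or_gt_of_ne hx with h | h
  · rw [truncPow_of_nonpos _ h.le, mul_zero]
    refine (hasDerivAt_const x (0 : ℝ)).congr_of_eventuallyEq ?_
    filter_upwards [Iio_mem_nhds h] with y hy
    exact truncPow_of_nonpos p (le_of_lt hy)
  · rw [truncPow_of_pos _ h]
    refine (Real.hasDerivAt_rpow_const (Or.inl hx)).congr_of_eventuallyEq ?_
    filter_upwards [Ioi_mem_nhds h] with y hy
    exact truncPow_of_pos p hy

theorem abs_truncPow_sub_le {p x y R : ℝ} (hp : 1 ≤ p) (hR : 0 ≤ R) (hx : x ≤ R) (hy : y ≤ R) :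
    |truncPow p x - truncPow p y| ≤ p * R ^ (p - 1) * |x - y| := by
  rw [truncPow_eq_max hp, truncPow_eq_max hp]
  have h := (convex_Icc (0 : ℝ) R).norm_image_sub_le_of_norm_hasDerivWithin_le
    (f := fun t : ℝ => t ^ p) (f' := fun t => p * t ^ (p - 1)) (C := p * R ^ (p - 1))
    (fun t _ => (Real.hasDerivAt_rpow_const (Or.inr hp)).hasDerivWithinAt)
    (fun t ht => by
      have := ht.1
      rw [Real.norm_eq_abs, abs_of_nonneg (by positivity)]
      have h0 : 0 ≤ p - 1 := by linarith
      gcongr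
      exact ht.2)
    (x := max y 0) (y := max x 0) ⟨le_max_right _ _, max_le hy hR⟩ ⟨le_max_right _ _, max_le hx hR⟩
  refine h.trans ?_
  gcongr
  rw [Real.norm_eq_abs]
  exact abs_max_sub_max_le_abs _ _ _

/-! ### The Korányi gauge on `E × ℝ`. -/

section Gauge

variable {E : Type} [NormedAddCommGroup E]

/-- The fourth power of the Korányi gauge on `E × ℝ`. -/
def gauge4 (w : E × ℝ) : ℝ := ‖w.1‖ ^ 4 + w.2 ^ 2

theorem continuous_gauge4 : Continuous (gauge4 (E := E)) := by
  unfold gauge4; fun_prop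

theorem bounds_of_gauge4_lt {w : E × ℝ} {y : ℝ} (h : gauge4 w < y) :
    ‖w.1‖ ≤ 1 + y ∧ |w.2| ≤ 1 + y := by
  unfold gauge4 at h
  have h1 := norm_nonneg w.1
  have h2 := abs_nonneg w.2
  rw [← sq_abs w.2] at h
  constructor
  · by_contra! hc
    nlinarith [sq_nonneg (‖w.1‖ ^ 2 - 1), sq_nonneg (‖w.1‖ - 1), sq_nonneg |w.2|]
  · nlinarith [sq_nonneg (|w.2| - 1), pow_nonneg h1 4]

theorem gauge4_nonneg (w : E × ℝ) : 0 ≤ gauge4 w := by unfold gauge4; positivity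

theorem gauge4_dil [NormedSpace ℝ E] (s : ℝ) (w : E × ℝ) :
    gauge4 (s • w.1, s ^ 2 * w.2) = s ^ 4 * gauge4 w := by
  simp only [gauge4, norm_smul, Real.norm_eq_abs, mul_pow]
  rw [show |s| ^ 4 = s ^ 4 from Even.pow_abs (by decide) s]
  ring

theorem measurableSet_gauge4_lt [MeasurableSpace E] [BorelSpace E] (y : ℝ) :
    MeasurableSet {w : E × ℝ | gauge4 w < y} :=
  measurableSet_lt continuous_gauge4.measurable measurable_const

theorem measurable_truncPow_gauge4 [MeasurableSpace E] [BorelSpace E] (p y : ℝ) :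
    Measurable fun w : E × ℝ => (truncPow p (y - gauge4 w) : ℂ) := by
  have := (measurable_truncPow p).comp (measurable_const.sub (continuous_gauge4 (E := E)).measurable
    : Measurable fun w : E × ℝ => y - gauge4 w)
  exact Complex.measurable_ofReal.comp this

theorem truncPow_gauge4_le {p y R : ℝ} (hp : 0 ≤ p) (hy : y ≤ R) (hR : 0 ≤ R) (w : E × ℝ) :
    truncPow p (y - gauge4 w) ≤ {w : E × ℝ | gauge4 w < R}.indicator (fun _ => R ^ p) w := by
  by_cases h : gauge4 w < R
  · rw [indicator_of_mem (by exact h)]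
    exact truncPow_le hp (by linarith [gauge4_nonneg w]) hR
  · rw [indicator_of_notMem (by exact h), truncPow_of_nonpos]
    linarith

end Gauge

/-! ### Continuity, differentiation and scaling of Bochner-Riesz integrals. -/

section BochnerRiesz

variable {E : Type} [NormedAddCommGroup E] [InnerProductSpace ℝ E] [FiniteDimensional ℝ E]
  [MeasurableSpace E] [BorelSpace E]

theorem volume_gauge4_lt (y : ℝ) : volume {w : E × ℝ | gauge4 w < y} < ⊤ := by
  refine Bornology.IsBounded.measure_lt_top ?_
  refine ((Metric.isBounded_closedBall (x := (0 : E)) (r := 1 + y)).prod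
    (Metric.isBounded_closedBall (x := (0 : ℝ)) (r := 1 + y))).subset fun w hw => ?_
  have := bounds_of_gauge4_lt hw
  simpa using this

/-- Each line parallel to the central axis meets a level set in at most two points. Hence the jump
of the kernel of exponent 0 on a level set is harmless. -/
theorem ae_gauge4_ne (y : ℝ) : ∀ᵐ w : E × ℝ, gauge4 w ≠ y := by
  have hm : MeasurableSet {w : E × ℝ | gauge4 w = y} :=
    continuous_gauge4.measurable (measurableSet_singleton y)
  have h : (volume : Measure E).prod (volume : Measure ℝ) {w : E × ℝ | gauge4 w = y} = 0 := by
    rw [Measure.measure_prod_null hm]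
    refine Filter.Eventually.of_forall fun x => ?_
    refine Set.Finite.measure_zero ?_ _
    refine (Set.toFinite {Real.sqrt (y - ‖x‖ ^ 4), -Real.sqrt (y - ‖x‖ ^ 4)}).subset fun t ht => ?_
    have ht' : ‖x‖ ^ 4 + t ^ 2 = y := ht
    have : y - ‖x‖ ^ 4 = t ^ 2 := by linarith
    rw [this, Real.sqrt_sq_eq_abs]
    rcases abs_choice t with h | h <;> simp [h]
  exact measure_eq_zero_iff_ae_notMem.mp h

/-- The Bochner-Riesz type integral `∫ G(w) (y - |w|⁴)₊ ^ p dw`. -/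
def rieszInt (G : E × ℝ → ℂ) (p y : ℝ) : ℂ := ∫ w, G w * (truncPow p (y - gauge4 w) : ℂ)

theorem integrable_indicator_gauge4 (R c : ℝ) :
    Integrable ({w : E × ℝ | gauge4 w < R}.indicator fun _ => c) :=
  (integrableOn_const (volume_gauge4_lt R).ne).integrable_indicator (measurableSet_gauge4_lt R)

theorem norm_rieszInt_integrand_le {G : E × ℝ → ℂ} (hG1 : ∀ w, ‖G w‖ ≤ 1) {p y R : ℝ} (hp : 0 ≤ p)
    (hy : y ≤ R) (hR : 0 ≤ R) (w : E × ℝ) :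
    ‖G w * (truncPow p (y - gauge4 w) : ℂ)‖ ≤
      {w : E × ℝ | gauge4 w < R}.indicator (fun _ => R ^ p) w := by
  rw [norm_mul, Complex.norm_real, Real.norm_eq_abs, abs_of_nonneg (truncPow_nonneg _ _)]
  calc _ ≤ 1 * truncPow p (y - gauge4 w) := by
        gcongr
        · exact truncPow_nonneg _ _
        · exact hG1 w
    _ ≤ _ := by rw [one_mul]; exact truncPow_gauge4_le hp hy hR w

theorem integrable_rieszInt {G : E × ℝ → ℂ} (hG : Measurable G) (hG1 : ∀ w, ‖G w‖ ≤ 1) {p : ℝ}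
    (hp : 0 ≤ p) (y : ℝ) : Integrable fun w => G w * (truncPow p (y - gauge4 w) : ℂ) :=
  (integrable_indicator_gauge4 |y| (|y| ^ p)).mono'
    (hG.mul (measurable_truncPow_gauge4 p y)).aestronglyMeasurable
    (Filter.Eventually.of_forall (norm_rieszInt_integrand_le hG1 hp (le_abs_self y) (abs_nonneg y)))

theorem continuous_rieszInt {G : E × ℝ → ℂ} (hG : Measurable G) (hG1 : ∀ w, ‖G w‖ ≤ 1) {p : ℝ}
    (hp : 0 ≤ p) : Continuous (rieszInt G p) := by
  refine continuous_iff_continuousAt.mpr fun y => ?_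
  refine continuousAt_of_dominated (bound := {w : E × ℝ | gauge4 w < |y| + 1}.indicator
    fun _ => (|y| + 1) ^ p) ?_ ?_ (integrable_indicator_gauge4 _ _) ?_
  · exact Filter.Eventually.of_forall fun z =>
      (hG.mul (measurable_truncPow_gauge4 p z)).aestronglyMeasurable
  · filter_upwards [Iio_mem_nhds (show y < |y| + 1 by linarith [le_abs_self y])] with z hz
    exact Filter.Eventually.of_forall
      (norm_rieszInt_integrand_le hG1 hp (le_of_lt hz) (by positivity))
  · filter_upwards [ae_gauge4_ne (E := E) y] with w hw
    have h := (hasDerivAt_truncPow p (sub_ne_zero.mpr hw.symm)).continuousAt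
    have h2 : ContinuousAt (fun z => truncPow p (z - gauge4 w)) y :=
      ContinuousAt.comp (f := fun z => z - gauge4 w) h (by fun_prop)
    exact continuousAt_const.mul (Complex.continuous_ofReal.continuousAt.comp h2)

/-- Domination uses a Lipschitz bound for the kernel and differentiability only at the base point.
This reaches `p = 1`, where the kernel has a corner on the level set, a null set. -/
theorem hasDerivAt_rieszInt {G : E × ℝ → ℂ} (hG : Measurable G) (hG1 : ∀ w, ‖G w‖ ≤ 1) {p : ℝ}
    (hp : 1 ≤ p) (y : ℝ) : HasDerivAt (rieszInt G p) (p * rieszInt G (p - 1) y) y := by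
  set R := |y| + 1 with hR
  have hR0 : 0 ≤ R := by positivity
  have h := hasDerivAt_integral_of_dominated_loc_of_lip (μ := (volume : Measure (E × ℝ)))
    (F := fun z w => G w * (truncPow p (z - gauge4 w) : ℂ))
    (F' := fun w => G w * ((p * truncPow (p - 1) (y - gauge4 w) : ℝ) : ℂ)) (x₀ := y)
    (bound := {w : E × ℝ | gauge4 w < R}.indicator fun _ => p * R ^ (p - 1)) (s := Iio R)
    (Iio_mem_nhds (by rw [hR]; linarith [le_abs_self y]))
    (Filter.Eventually.of_forall fun z =>
      (hG.mul (measurable_truncPow_gauge4 p z)).aestronglyMeasurable)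
    (integrable_rieszInt hG hG1 (by linarith) y)
    (by
      have := measurable_truncPow_gauge4 (E := E) (p - 1) y
      push_cast
      exact (hG.mul (this.const_mul _)).aestronglyMeasurable)
    (Filter.Eventually.of_forall fun w => by
      refine LipschitzOnWith.of_dist_le_mul fun z hz z' hz' => ?_
      rw [dist_eq_norm, ← mul_sub, ← Complex.ofReal_sub, norm_mul, Complex.norm_real,
        Real.norm_eq_abs, Real.coe_nnabs]
      have hpR : 0 ≤ p * R ^ (p - 1) := by positivity
      by_cases hw : gauge4 w < R
      · rw [indicator_of_mem (by exact hw), abs_of_nonneg hpR, Real.dist_eq]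
        have h1 := abs_truncPow_sub_le hp hR0
          (by linarith [gauge4_nonneg w, (show z < R from hz)] : z - gauge4 w ≤ R)
          (by linarith [gauge4_nonneg w, (show z' < R from hz')] : z' - gauge4 w ≤ R)
        rw [sub_sub_sub_cancel_right] at h1
        calc _ ≤ 1 * |truncPow p (z - gauge4 w) - truncPow p (z' - gauge4 w)| := by
              exact mul_le_mul_of_nonneg_right (hG1 w) (abs_nonneg _)
          _ ≤ _ := by rw [one_mul]; exact h1
      · have e1 : truncPow p (z - gauge4 w) = 0 := truncPow_of_nonpos _ (by
          linarith [(show z < R from hz)])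
        have e2 : truncPow p (z' - gauge4 w) = 0 := truncPow_of_nonpos _ (by
          linarith [(show z' < R from hz')])
        rw [e1, e2]; simp; positivity)
    (integrable_indicator_gauge4 _ _)
    (by
      filter_upwards [ae_gauge4_ne (E := E) y] with w hw
      have h1 := (hasDerivAt_truncPow p (sub_ne_zero.mpr hw.symm)).comp_sub_const y (gauge4 w)
      exact h1.ofReal_comp.const_mul (G w))
  refine h.2.congr_deriv ?_
  rw [rieszInt, ← integral_const_mul]
  refine integral_congr_ae (Filter.Eventually.of_forall fun w => ?_)
  push_cast
  ring

theorem integral_dil_prod {s : ℝ} (hs : 0 < s) (f : E × ℝ → ℂ) :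
    ∫ w, f w = (s ^ (Module.finrank ℝ E + 2) : ℝ) • ∫ w : E × ℝ, f (s • w.1, s ^ 2 * w.2) := by
  let e : (E × ℝ) ≃ₜ (E × ℝ) := (Homeomorph.smulOfNeZero s hs.ne').prodCongr
    (Homeomorph.mulLeft₀ (s ^ 2) (by positivity))
  have h1 : Measure.map e (volume : Measure (E × ℝ)) =
      ENNReal.ofReal ((s ^ (Module.finrank ℝ E + 2))⁻¹) • volume := by
    have hE := Measure.map_addHaar_smul (volume : Measure E) hs.ne'
    have hR := Measure.map_addHaar_smul (volume : Measure ℝ) (show s ^ 2 ≠ 0 by positivity)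
    have hp := Measure.map_prod_map (volume : Measure E) (volume : Measure ℝ)
      (f := (s • ·)) (g := ((s ^ 2) • ·)) (by fun_prop) (by fun_prop)
    change Measure.map (Prod.map (s • ·) ((s ^ 2) • ·)) ((volume : Measure E).prod volume) = _
    rw [← hp, hE, hR, Measure.prod_smul_left, Measure.prod_smul_right, smul_smul,
      ← ENNReal.ofReal_mul (abs_nonneg _), abs_of_pos (by positivity), abs_of_pos (by positivity)]
    congr 2
    rw [Module.finrank_self, pow_one, pow_add, mul_inv]
  have h2 : ∫ w : E × ℝ, f (s • w.1, s ^ 2 * w.2) = ∫ w, f w ∂(Measure.map e volume) :=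
    (e.measurableEmbedding.integral_map f).symm
  rw [h2, h1, integral_smul_measure, ENNReal.toReal_ofReal (by positivity), smul_smul,
    mul_inv_cancel₀ (by positivity), one_smul]

/-- The dilation has Jacobian `s^(d+2)`, and the kernel is homogeneous of degree `4p`. -/
theorem rieszInt_pow_four (G : E × ℝ → ℂ) (p : ℝ) {s : ℝ} (hs : 0 < s) :
    rieszInt G p (s ^ 4) = ((s ^ (Module.finrank ℝ E + 2) * (s ^ 4) ^ p : ℝ) : ℂ) *
      rieszInt (fun w => G (s • w.1, s ^ 2 * w.2)) p 1 := by
  rw [rieszInt, integral_dil_prod hs, rieszInt, Complex.real_smul, ← integral_const_mul,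
    ← integral_const_mul]
  refine integral_congr_ae (Filter.Eventually.of_forall fun w => ?_)
  dsimp only
  rw [gauge4_dil, show s ^ 4 - s ^ 4 * gauge4 w = s ^ 4 * (1 - gauge4 w) by ring,
    truncPow_mul _ _ (by positivity)]
  push_cast
  ring

end BochnerRiesz

/-! ### Higher derivatives -/

theorem iteratedDeriv_eq_of_hasDerivAt {f : ℕ → ℝ → ℂ} {h : ℕ}
    (hd : ∀ k < h, ∀ s, 0 < s → HasDerivAt (f k) (f (k + 1) s) s) {k : ℕ} (hk : k ≤ h) {s : ℝ}
    (hs : 0 < s) : iteratedDeriv k (f 0) s = f k s := by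
  induction k generalizing s with
  | zero => simp
  | succ k ih =>
    rw [iteratedDeriv_succ]
    have : iteratedDeriv k (f 0) =ᶠ[nhds s] f k := by
      filter_upwards [Ioi_mem_nhds hs] with t ht
      exact ih (by omega) ht
    rw [this.deriv_eq]
    exact (hd k (by omega) s hs).deriv

theorem contDiffOn_of_hasDerivAt {f : ℕ → ℝ → ℂ} {h : ℕ}
    (hd : ∀ k < h, ∀ s, 0 < s → HasDerivAt (f k) (f (k + 1) s) s)
    (hc : ContinuousOn (f h) (Ioi 0)) : ContDiffOn ℝ h (f 0) (Ioi 0) := by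
  induction h generalizing f with
  | zero => simpa using hc
  | succ h ih =>
    have h1 := ih (f := fun k => f (k + 1)) (fun k hk s hs => hd (k + 1) (by omega) s hs) hc
    push_cast
    rw [contDiffOn_succ_iff_deriv_of_isOpen isOpen_Ioi]
    refine ⟨fun s hs => (hd 0 (by omega) s hs).differentiableAt.differentiableWithinAt, by simp,
      h1.congr fun s hs => (hd 0 (by omega) s hs).deriv⟩

/-- The coefficients of the derivatives of `s ^ m * b₀ s`, where `b_i' = 4 (q - i) s ^ 3 b_{i+1}`. -/
def derivCoeff (m : ℤ) (q : ℝ) : ℕ → ℕ → ℝ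
  | 0, 0 => 1
  | 0, _ + 1 => 0
  | k + 1, 0 => (m - k) * derivCoeff m q k 0
  | k + 1, i + 1 => (m - k + 4 * (i + 1)) * derivCoeff m q k (i + 1) +
      4 * (q - i) * derivCoeff m q k i

theorem derivCoeff_of_lt (m : ℤ) (q : ℝ) {k i : ℕ} (h : k < i) : derivCoeff m q k i = 0 := by
  induction k generalizing i with
  | zero =>
    obtain ⟨j, rfl⟩ : ∃ j, i = j + 1 := ⟨i - 1, by omega⟩
    simp [derivCoeff]
  | succ k ih =>
    obtain ⟨j, rfl⟩ : ∃ j, i = j + 1 := ⟨i - 1, by omega⟩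
    rw [derivCoeff, ih (by omega), ih (by omega)]
    simp

/-- The `k`-th derivative of `s ^ m * b₀ s`, where `b_i' = 4 (q - i) s ^ 3 b_{i+1}`. -/
def derivSum (m : ℤ) (q : ℝ) (b : ℕ → ℝ → ℂ) (k : ℕ) (s : ℝ) : ℂ :=
  ∑ i ∈ Finset.range (k + 1), ((derivCoeff m q k i * s ^ (m - k + 4 * i) : ℝ) : ℂ) * b i s

theorem hasDerivAt_derivSum {m : ℤ} {q : ℝ} {b : ℕ → ℝ → ℂ} {k : ℕ} {s : ℝ} (hs : s ≠ 0)
    (hb : ∀ i ≤ k, HasDerivAt (b i) ((4 * (q - i) * s ^ 3 : ℝ) * b (i + 1) s) s) :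
    HasDerivAt (derivSum m q b k) (derivSum m q b (k + 1) s) s := by
  have h1 : HasDerivAt (derivSum m q b k) (∑ i ∈ Finset.range (k + 1),
      (((derivCoeff m q k i * ((m - k + 4 * i : ℤ) * s ^ (m - k + 4 * i - 1)) : ℝ) : ℂ) * b i s +
      ((derivCoeff m q k i * s ^ (m - k + 4 * i) : ℝ) : ℂ) *
        ((4 * (q - i) * s ^ 3 : ℝ) * b (i + 1) s))) s := by
    unfold derivSum
    refine HasDerivAt.fun_sum fun i hi => ?_
    have hz := ((hasDerivAt_zpow (m - k + 4 * i) s (Or.inl hs)).const_mul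
      (derivCoeff m q k i)).ofReal_comp
    exact hz.mul (hb i (by simpa [Nat.lt_succ_iff] using hi))
  refine h1.congr_deriv ?_
  rw [Finset.sum_add_distrib]
  have h2 : ∑ i ∈ Finset.range (k + 1),
      ((derivCoeff m q k i * ((m - k + 4 * i : ℤ) * s ^ (m - k + 4 * i - 1)) : ℝ) : ℂ) * b i s =
      ∑ i ∈ Finset.range (k + 2),
      ((derivCoeff m q k i * ((m - k + 4 * i : ℤ) * s ^ (m - k + 4 * i - 1)) : ℝ) : ℂ) * b i s := by
    rw [Finset.sum_range_succ _ (k + 1), derivCoeff_of_lt m q (Nat.lt_succ_self k)]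
    simp
  rw [h2, Finset.sum_range_succ' _ (k + 1), derivSum, Finset.sum_range_succ' _ (k + 1), add_right_comm,
    ← Finset.sum_add_distrib]
  congr 1
  · refine Finset.sum_congr rfl fun i _ => ?_
    have e1 : s ^ (m - (k + 1 : ℕ) + 4 * (i + 1 : ℕ)) = s ^ (m - k + 4 * i) * s ^ 3 := by
      rw [← zpow_natCast s 3, ← zpow_add₀ hs]; congr 1; push_cast; ring
    have e2 : s ^ (m - k + 4 * (i + 1 : ℕ) - 1) = s ^ (m - k + 4 * i) * s ^ 3 := by
      rw [← zpow_natCast s 3, ← zpow_add₀ hs]; congr 1; push_cast; ring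
    rw [e1, e2, derivCoeff]
    push_cast
    ring
  · have e1 : s ^ (m - (k + 1 : ℕ) + 4 * (0 : ℕ)) = s ^ (m - k + 4 * (0 : ℕ) - 1) := by
      congr 1; push_cast; ring
    rw [e1, derivCoeff]
    push_cast
    ring

/-! ### Derivatives of normalized Bochner-Riesz integrals. -/

section BochnerRieszDeriv

variable {E : Type} [NormedAddCommGroup E] [InnerProductSpace ℝ E] [FiniteDimensional ℝ E]
  [MeasurableSpace E] [BorelSpace E]

theorem hasDerivAt_rieszInt_pow_four {G : E × ℝ → ℂ} (hG : Measurable G) (hG1 : ∀ w, ‖G w‖ ≤ 1)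
    {p : ℝ} (hp : 1 ≤ p) (s : ℝ) : HasDerivAt (fun s => rieszInt G p (s ^ 4))
      ((4 * p * s ^ 3 : ℝ) * rieszInt G (p - 1) (s ^ 4)) s := by
  have h := (hasDerivAt_rieszInt hG hG1 hp (s ^ 4)).scomp s (hasDerivAt_pow 4 s)
  refine h.congr_deriv ?_
  rw [Complex.real_smul]
  push_cast
  ring

theorem hasDerivAt_derivSum_rieszInt {G : E × ℝ → ℂ} (hG : Measurable G) (hG1 : ∀ w, ‖G w‖ ≤ 1)
    (m : ℤ) {q : ℝ} {h : ℕ} (hq : h ≤ q) {k : ℕ} (hk : k < h) {s : ℝ} (hs : 0 < s) :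
    HasDerivAt (derivSum m q (fun i s => rieszInt G (q - i) (s ^ 4)) k)
      (derivSum m q (fun i s => rieszInt G (q - i) (s ^ 4)) (k + 1) s) s := by
  refine hasDerivAt_derivSum hs.ne' fun i hi => ?_
  have : ((i + 1 : ℕ) : ℝ) ≤ h := by exact_mod_cast (by omega : i + 1 ≤ h)
  push_cast at this
  have h1 := hasDerivAt_rieszInt_pow_four hG hG1 (p := q - i) (by linarith) s
  refine h1.congr_deriv ?_
  push_cast
  rw [sub_sub]

/-- This value of `m` makes the power of `s` in front cancel the homogeneity of the integral, so the
scale survives only inside `G`. -/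
theorem derivSum_rieszInt_mul_pow (G : E × ℝ → ℂ) {m : ℤ} {q : ℝ}
    (hm : (m : ℝ) = -(Module.finrank ℝ E + 2 + 4 * q)) (k : ℕ) {s : ℝ} (hs : 0 < s) :
    derivSum m q (fun i s => rieszInt G (q - i) (s ^ 4)) k s * (s ^ k : ℝ) =
      ∑ i ∈ Finset.range (k + 1), (derivCoeff m q k i : ℂ) *
        rieszInt (fun w => G (s • w.1, s ^ 2 * w.2)) (q - i) 1 := by
  rw [derivSum, Finset.sum_mul]
  refine Finset.sum_congr rfl fun i _ => ?_
  rw [rieszInt_pow_four _ _ hs]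
  -- Lowering the exponent by `i` costs `s^(-4i)`, which the factor `s^(4i)` in `derivSum` restores;
  -- all terms therefore have the same degree.
  have e : s ^ (m - k + 4 * i) * (s ^ (Module.finrank ℝ E + 2) * (s ^ 4) ^ (q - i)) * s ^ k = 1 := by
    rw [← Real.rpow_natCast s 4, ← Real.rpow_mul hs.le, ← Real.rpow_natCast, ← Real.rpow_natCast,
      ← Real.rpow_intCast, ← Real.rpow_add hs, ← Real.rpow_add hs, ← Real.rpow_add hs]
    push_cast
    rw [hm]
    ring_nf
    exact Real.rpow_zero s
  have e' := congrArg (Complex.ofReal) e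
  push_cast at e' ⊢
  linear_combination (derivCoeff m q k i : ℂ) *
    rieszInt (fun w => G (s • w.1, s ^ 2 * w.2)) (q - i) 1 * e'

theorem contDiffOn_rieszInt {G : E × ℝ → ℂ} (hG : Measurable G) (hG1 : ∀ w, ‖G w‖ ≤ 1)
    (m : ℤ) {q : ℝ} {h : ℕ} (hq : h ≤ q) :
    ContDiffOn ℝ h (derivSum m q (fun i s => rieszInt G (q - i) (s ^ 4)) 0) (Ioi 0) := by
  refine contDiffOn_of_hasDerivAt
    (fun k hk s hs => hasDerivAt_derivSum_rieszInt hG hG1 m hq hk hs) ?_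
  unfold derivSum
  refine continuousOn_finsetSum _ fun i hi => ?_
  have hi' : (i : ℝ) ≤ h := by exact_mod_cast Nat.lt_succ_iff.mp (Finset.mem_range.mp hi)
  have h1 := (continuous_rieszInt hG hG1 (p := q - i) (by linarith)).comp (continuous_pow 4)
  refine ContinuousOn.mul ?_ h1.continuousOn
  refine Complex.continuous_ofReal.comp_continuousOn (continuousOn_const.mul ?_)
  exact (continuousOn_zpow₀ _).mono fun s hs => ne_of_gt hs

theorem iteratedDeriv_rieszInt_mul_pow {G : E × ℝ → ℂ} (hG : Measurable G) (hG1 : ∀ w, ‖G w‖ ≤ 1)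
    {m : ℤ} {q : ℝ} (hm : (m : ℝ) = -(Module.finrank ℝ E + 2 + 4 * q)) {h : ℕ} (hq : h ≤ q) {s : ℝ}
    (hs : 0 < s) :
    iteratedDeriv h (derivSum m q (fun i s => rieszInt G (q - i) (s ^ 4)) 0) s * (s ^ h : ℝ) =
      ∑ i ∈ Finset.range (h + 1), (derivCoeff m q h i : ℂ) *
        rieszInt (fun w => G (s • w.1, s ^ 2 * w.2)) (q - i) 1 := by
  rw [← derivSum_rieszInt_mul_pow G hm h hs]
  congr 1
  exact iteratedDeriv_eq_of_hasDerivAt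
    (f := fun k => derivSum m q (fun i s => rieszInt G (q - i) (s ^ 4)) k)
    (fun k hk s hs => hasDerivAt_derivSum_rieszInt hG hG1 m hq hk hs) le_rfl hs

/-- For `G = 1` the normalized integral does not depend on `s`, so all its derivatives of order at
least one vanish. This is the cancellation used at small scales. -/
theorem sum_derivCoeff_mul_rieszInt_one {m : ℤ} {q : ℝ}
    (hm : (m : ℝ) = -(Module.finrank ℝ E + 2 + 4 * q)) {h : ℕ} (hq : h ≤ q) (h1 : 1 ≤ h) :
    ∑ i ∈ Finset.range (h + 1), (derivCoeff m q h i : ℂ) *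
      rieszInt (fun _ : E × ℝ => 1) (q - i) 1 = 0 := by
  have hG : Measurable fun _ : E × ℝ => (1 : ℂ) := measurable_const
  have hG1 : ∀ w : E × ℝ, ‖(1 : ℂ)‖ ≤ 1 := by simp
  have hk : ∀ k, k + 1 ≤ h → ∀ s : ℝ, 0 < s →
      derivSum m q (fun i s => rieszInt (fun _ : E × ℝ => 1) (q - i) (s ^ 4)) (k + 1) s = 0 := by
    intro k
    induction k with
    | zero =>
      intro hk s hs
      have hd := hasDerivAt_derivSum_rieszInt hG hG1 m hq (k := 0) (by omega) hs
      refine hd.unique ((hasDerivAt_const s (derivSum m q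
        (fun i s => rieszInt (fun _ : E × ℝ => 1) (q - i) (s ^ 4)) 0 1)).congr_of_eventuallyEq ?_)
      filter_upwards [Ioi_mem_nhds hs] with t ht
      have e1 := derivSum_rieszInt_mul_pow (fun _ : E × ℝ => 1) hm 0 ht
      have e2 := derivSum_rieszInt_mul_pow (fun _ : E × ℝ => 1) hm 0 one_pos
      simp only [pow_zero, Complex.ofReal_one, mul_one] at e1 e2
      rw [e1, e2]
    | succ k ih =>
      intro hk s hs
      have hd := hasDerivAt_derivSum_rieszInt hG hG1 m hq (k := k + 1) (by omega) hs
      refine hd.unique ((hasDerivAt_const s (0 : ℂ)).congr_of_eventuallyEq ?_)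
      filter_upwards [Ioi_mem_nhds hs] with t ht
      exact ih (by omega) t ht
  have e := derivSum_rieszInt_mul_pow (fun _ : E × ℝ => 1) hm h one_pos
  rw [← e]
  obtain ⟨k, rfl⟩ : ∃ k, h = k + 1 := ⟨h - 1, by omega⟩
  rw [hk k le_rfl 1 one_pos, zero_mul]

end BochnerRieszDeriv

/-! ### Estimates on the unit Korányi ball of `ℝ ^ v × ℝ` -/

theorem truncPow_mono {p : ℝ} (hp : 0 ≤ p) : Monotone (truncPow p) := by
  intro x y h
  by_cases hx : 0 < x
  · rw [truncPow_of_pos p hx, truncPow_of_pos p (hx.trans_le h)]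
    gcongr
  · rw [truncPow_of_nonpos p (not_lt.mp hx)]
    exact truncPow_nonneg p y

/-- The unit ball of the Korányi gauge on `E × ℝ`. -/
def gaugeBall (E : Type) [NormedAddCommGroup E] : Set (E × ℝ) := {w | gauge4 w < 1}

theorem norm_lt_one_of_mem_gaugeBall {E : Type} [NormedAddCommGroup E] {w : E × ℝ}
    (hw : w ∈ gaugeBall E) : ‖w.1‖ < 1 ∧ |w.2| < 1 := by
  have h : ‖w.1‖ ^ 4 + w.2 ^ 2 < 1 := hw
  constructor
  · exact (pow_lt_one_iff_of_nonneg (norm_nonneg _) (by norm_num : (4 : ℕ) ≠ 0)).mp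
      (by nlinarith [sq_nonneg w.2])
  · exact (sq_lt_one_iff_abs_lt_one _).mp (by nlinarith [pow_nonneg (norm_nonneg w.1) 4])

section GaugeBall

variable {E : Type} [NormedAddCommGroup E] [InnerProductSpace ℝ E] [FiniteDimensional ℝ E]
  [MeasurableSpace E] [BorelSpace E]

theorem measurableSet_gaugeBall : MeasurableSet (gaugeBall E) :=
  measurableSet_gauge4_lt (E := E) 1

theorem volume_gaugeBall_lt_top : volume (gaugeBall E) < ⊤ := volume_gauge4_lt (E := E) 1

/-- The domination does not involve `p`, so the bounds on the unit ball are uniform in `p ≥ 0`. -/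
theorem truncPow_one_sub_le {p : ℝ} (hp : 0 ≤ p) (w : E × ℝ) :
    truncPow p (1 - gauge4 w) ≤ (gaugeBall E).indicator (fun _ => 1) w := by
  have h := truncPow_gauge4_le hp le_rfl zero_le_one w
  rw [Real.one_rpow] at h
  exact h

theorem norm_rieszInt_one_sub_le {G : E × ℝ → ℂ} (hG : Measurable G) (hG1 : ∀ w, ‖G w‖ ≤ 1) {p : ℝ}
    (hp : 0 ≤ p) {δ : ℝ} (hδ : ∀ w ∈ gaugeBall E, ‖G w - 1‖ ≤ δ) :
    ‖rieszInt G p 1 - rieszInt (fun _ : E × ℝ => 1) p 1‖ ≤ δ * (volume (gaugeBall E)).toReal := by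
  rw [rieszInt, rieszInt, ← integral_sub (integrable_rieszInt hG hG1 hp 1)
    (integrable_rieszInt measurable_const (by simp) hp 1)]
  have hi : Integrable ((gaugeBall E).indicator fun _ => δ) := integrable_indicator_gauge4 1 δ
  refine (norm_integral_le_of_norm_le hi (Filter.Eventually.of_forall fun w => ?_)).trans ?_
  · rw [← sub_mul, norm_mul, Complex.norm_real, Real.norm_eq_abs,
      abs_of_nonneg (truncPow_nonneg _ _)]
    have ht := truncPow_one_sub_le hp w
    by_cases hw : w ∈ gaugeBall E
    · rw [indicator_of_mem hw] at ht ⊢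
      calc _ ≤ δ * 1 := mul_le_mul (hδ w hw) ht (truncPow_nonneg _ _)
            ((norm_nonneg _).trans (hδ w hw))
        _ = δ := mul_one δ
    · rw [indicator_of_notMem hw] at ht ⊢
      rw [le_antisymm ht (truncPow_nonneg _ _), mul_zero]
  · rw [integral_indicator measurableSet_gaugeBall, setIntegral_const, smul_eq_mul, mul_comm]
    rfl

theorem sq_lintegral_le {α : Type*} [MeasurableSpace α] (μ : Measure α) {f : α → ℝ≥0∞}
    (hf : AEMeasurable f μ) : (∫⁻ a, f a ∂μ) ^ 2 ≤ μ univ * ∫⁻ a, f a ^ 2 ∂μ := by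
  have h := ENNReal.lintegral_mul_le_Lp_mul_Lq μ Real.HolderConjugate.two_two
    (f := fun _ => 1) (g := f) aemeasurable_const hf
  simp only [Pi.mul_apply, one_mul, ENNReal.one_rpow, lintegral_const] at h
  have h2 := pow_le_pow_left' h 2
  refine h2.trans (le_of_eq ?_)
  rw [mul_pow, ← ENNReal.rpow_natCast, ← ENNReal.rpow_natCast, ← ENNReal.rpow_mul,
    ← ENNReal.rpow_mul]
  norm_num

/-- Cauchy-Schwarz on the unit ball, where the kernel is at most 1. -/
theorem sq_enorm_rieszInt_le {G : E × ℝ → ℂ} (hG : Measurable G) {p : ℝ} (hp : 0 ≤ p) :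
    ‖rieszInt G p 1‖ₑ ^ 2 ≤ volume (gaugeBall E) * ∫⁻ w in gaugeBall E, ‖G w‖ₑ ^ 2 := by
  have h1 : ‖rieszInt G p 1‖ₑ ≤ ∫⁻ w in gaugeBall E, ‖G w‖ₑ := by
    rw [rieszInt, ← lintegral_indicator measurableSet_gaugeBall]
    refine (enorm_integral_le_lintegral_enorm _).trans (lintegral_mono fun w => ?_)
    have ht := truncPow_one_sub_le hp w
    rw [enorm_mul]
    by_cases hw : w ∈ gaugeBall E
    · rw [indicator_of_mem hw] at ht ⊢
      have : ‖(truncPow p (1 - gauge4 w) : ℂ)‖ₑ ≤ 1 := by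
        rw [← ofReal_norm, Complex.norm_real, Real.norm_eq_abs,
          abs_of_nonneg (truncPow_nonneg _ _)]
        exact ENNReal.ofReal_le_one.mpr ht
      calc _ ≤ ‖G w‖ₑ * 1 := by gcongr
        _ = _ := mul_one _
    · rw [indicator_of_notMem hw] at ht ⊢
      rw [le_antisymm ht (truncPow_nonneg _ _)]
      simp
  have h2 := sq_lintegral_le (volume.restrict (gaugeBall E)) (f := fun w => ‖G w‖ₑ)
    hG.enorm.aemeasurable
  rw [Measure.restrict_apply_univ] at h2
  exact (pow_le_pow_left' h1 2).trans h2

end GaugeBall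

/-- The ball lies in the cube `[-1, 1]^(v+1)`, and each of the `v` remaining coordinates contributes
a factor 2. -/
theorem setLIntegral_gaugeBall_coord_le {v : ℕ} (i : Fin v) {φ : ℝ → ℝ≥0∞} (hφ : Measurable φ) :
    ∫⁻ w in gaugeBall (V v), φ (w.1 i) ≤ 2 ^ v * ∫⁻ x in Icc (-1 : ℝ) 1, φ x := by
  set B : Set (Fin v → ℝ) := univ.pi fun _ => Icc (-1 : ℝ) 1 with hB
  have hBm : MeasurableSet B := MeasurableSet.univ_pi fun _ => measurableSet_Icc
  have hsub : gaugeBall (V v) ⊆ (WithLp.ofLp ⁻¹' B : Set (V v)) ×ˢ Icc (-1 : ℝ) 1 := by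
    intro w hw
    have h := norm_lt_one_of_mem_gaugeBall hw
    refine ⟨fun k _ => ?_, abs_le.mp h.2.le⟩
    have h2 := PiLp.norm_apply_le w.1 k
    rw [Real.norm_eq_abs] at h2
    exact abs_le.mp (h2.trans h.1.le)
  have hm : Measurable fun X : V v => φ (X i) := hφ.comp (by fun_prop)
  have hmp := PiLp.volume_preserving_ofLp (Fin v)
  calc _ ≤ ∫⁻ w in (WithLp.ofLp ⁻¹' B : Set (V v)) ×ˢ Icc (-1 : ℝ) 1, φ (w.1 i) :=
        lintegral_mono_set hsub
    _ = 2 * ∫⁻ X in (WithLp.ofLp ⁻¹' B : Set (V v)), φ (X i) := by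
        rw [Measure.volume_eq_prod, ← Measure.prod_restrict,
          lintegral_prod (fun w : V v × ℝ => φ (w.1 i)) (hm.comp measurable_fst).aemeasurable]
        simp only [lintegral_const, Measure.restrict_apply_univ, Real.volume_Icc]
        rw [lintegral_mul_const _ hm, mul_comm]
        norm_num
    _ = 2 * ∫⁻ x in B, φ (x i) := by
        congr 1
        exact hmp.setLIntegral_comp_preimage hBm (f := fun x => φ (x i)) (by fun_prop)
    _ = 2 ^ v * ∫⁻ x in Icc (-1 : ℝ) 1, φ x := by
        rw [hB, volume_pi, Measure.restrict_pi_pi]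
        have h := lintegral_map (μ := Measure.pi fun _ : Fin v =>
          (volume : Measure ℝ).restrict (Icc (-1 : ℝ) 1)) hφ (measurable_pi_apply i)
        have h' : ∫⁻ x, φ (x i) ∂(Measure.pi fun _ : Fin v =>
          (volume : Measure ℝ).restrict (Icc (-1 : ℝ) 1)) = _ := h.symm
        rw [h']
        have he := Measure.pi_map_eval (fun _ : Fin v =>
          (volume : Measure ℝ).restrict (Icc (-1 : ℝ) 1)) i
        change 2 * lintegral (Measure.map (Function.eval i) (Measure.pi fun _ : Fin v =>
          (volume : Measure ℝ).restrict (Icc (-1 : ℝ) 1))) (fun x : ℝ => φ x) = _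
        rw [he, lintegral_smul_measure]
        simp only [Measure.restrict_apply_univ, Real.volume_Icc, Finset.prod_const, smul_eq_mul]
        rw [Finset.card_erase_of_mem (Finset.mem_univ i), Finset.card_univ, Fintype.card_fin,
          ← mul_assoc]
        congr 1
        have hv : v = (v - 1) + 1 := by have := i.pos; omega
        conv_rhs => rw [hv, pow_succ']
        norm_num

theorem volume_slab_le {v : ℕ} (i : Fin v) {δ : ℝ} (hδ : 0 ≤ δ) :
    (volume (gaugeBall (V v) ∩ {w | |w.1 i| ≤ δ / 2})).toReal ≤ 2 ^ v * δ := by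
  have hm : MeasurableSet {x : ℝ | |x| ≤ δ / 2} := measurableSet_le (by fun_prop) measurable_const
  have hc : Measurable fun w : V v × ℝ => w.1 i := by fun_prop
  have h := setLIntegral_gaugeBall_coord_le i (φ := {x : ℝ | |x| ≤ δ / 2}.indicator 1)
    (measurable_one.indicator hm)
  have e1 : ∫⁻ w in gaugeBall (V v), {x : ℝ | |x| ≤ δ / 2}.indicator (1 : ℝ → ℝ≥0∞) (w.1 i) =
      volume (gaugeBall (V v) ∩ {w | |w.1 i| ≤ δ / 2}) := by
    have : ∀ w : V v × ℝ, {x : ℝ | |x| ≤ δ / 2}.indicator (1 : ℝ → ℝ≥0∞) (w.1 i) =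
        {w : V v × ℝ | |w.1 i| ≤ δ / 2}.indicator 1 w := fun w => rfl
    simp_rw [this]
    have hc' : MeasurableSet {w : V v × ℝ | |w.1 i| ≤ δ / 2} := hc hm
    rw [lintegral_indicator_one hc', Measure.restrict_apply hc', inter_comm]
  have e2 : ∫⁻ x in Icc (-1 : ℝ) 1, {x : ℝ | |x| ≤ δ / 2}.indicator 1 x ≤ ENNReal.ofReal δ := by
    calc _ ≤ ∫⁻ x : ℝ, {x : ℝ | |x| ≤ δ / 2}.indicator 1 x := setLIntegral_le_lintegral _ _
      _ = volume {x : ℝ | |x| ≤ δ / 2} := lintegral_indicator_one hm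
      _ = ENNReal.ofReal δ := by
        have : {x : ℝ | |x| ≤ δ / 2} = Icc (-(δ / 2)) (δ / 2) := by
          ext x; simp only [mem_ofPred_eq, mem_Icc, abs_le]
        rw [this, Real.volume_Icc]; congr 1; ring
  rw [e1] at h
  refine ENNReal.toReal_le_of_le_ofReal (by positivity) ((h.trans (mul_le_mul_right e2 _)).trans
    (le_of_eq ?_))
  rw [ENNReal.ofReal_mul (by positivity), ENNReal.ofReal_pow (by norm_num)]
  norm_num

theorem setLIntegral_gaugeBall_rpow_lt_top {v : ℕ} (i : Fin v) :
    ∫⁻ w in gaugeBall (V v), ENNReal.ofReal (6 + 2 * |w.1 i| ^ (-1 / 2 : ℝ)) < ⊤ := by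
  refine (setLIntegral_gaugeBall_coord_le i
    (φ := fun x => ENNReal.ofReal (6 + 2 * |x| ^ (-1 / 2 : ℝ))) (by fun_prop)).trans_lt ?_
  refine ENNReal.mul_lt_top (by simp) ?_
  have h0 : IntervalIntegrable (fun x : ℝ => |x| ^ (-1 / 2 : ℝ)) volume (-1) 1 := by
    have hp : IntervalIntegrable (fun x : ℝ => |x| ^ (-1 / 2 : ℝ)) volume 0 1 := by
      refine (intervalIntegral.intervalIntegrable_rpow' (r := -1 / 2) (by norm_num)).congr ?_
      intro x hx
      rw [uIoc_of_le zero_le_one] at hx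
      simp only
      rw [abs_of_pos hx.1]
    have hn : IntervalIntegrable (fun x : ℝ => |x| ^ (-1 / 2 : ℝ)) volume (-1) 0 := by
      have := hp.comp_sub_left 0
      simp only [zero_sub, abs_neg, sub_zero] at this
      exact this.symm
    exact hn.trans hp
  have h1 : IntegrableOn (fun x : ℝ => 6 + 2 * |x| ^ (-1 / 2 : ℝ)) (Icc (-1) 1) := by
    rw [integrableOn_Icc_iff_integrableOn_Ioc, ← intervalIntegrable_iff_integrableOn_Ioc_of_le
      (by norm_num)]
    exact intervalIntegrable_const.add (h0.const_mul 2)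
  exact h1.lintegral_lt_top

/-- Antiperiodicity gives `2 ∫ G e = ∫ G (e - e(· + τ))`, and the `L¹` modulus of continuity of `e`
is controlled by monotonicity in `‖X‖` alone. No smoothness of the kernel is used, so `p = 0` is
allowed. -/
theorem norm_rieszInt_le_of_antiperiodic {v : ℕ} (i : Fin v) {G : V v × ℝ → ℂ} (hG : Measurable G)
    (hG1 : ∀ w, ‖G w‖ ≤ 1) {p : ℝ} (hp : 0 ≤ p) {δ : ℝ} (hδ : 0 ≤ δ)
    (hanti : ∀ w, G (w + (EuclideanSpace.single i δ, 0)) = -G w) :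
    ‖rieszInt G p 1‖ ≤ 2 ^ v * δ := by
  have : (volume : Measure (V v × ℝ)).IsAddRightInvariant :=
    inferInstanceAs (((volume : Measure (V v)).prod (volume : Measure ℝ)).IsAddRightInvariant)
  set τ : V v × ℝ := (EuclideanSpace.single i δ, 0) with hτ
  let e : V v × ℝ → ℝ := fun w => truncPow p (1 - gauge4 w)
  have he : Integrable e := by
    have h := (integrable_rieszInt (E := V v) (G := fun _ => 1) measurable_const (by simp) hp 1).re
    simpa using h
  have heτ : Integrable fun w => e (w + τ) := he.comp_add_right τ
  have hGe : Integrable fun w => G w * (e w : ℂ) := integrable_rieszInt hG hG1 hp 1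
  have hGeτ : Integrable fun w => G w * (e (w + τ) : ℂ) := by
    refine heτ.ofReal.bdd_mul hG.aestronglyMeasurable (c := 1) (Filter.Eventually.of_forall hG1)
  have e1 : rieszInt G p 1 = -∫ w, G w * (e (w + τ) : ℂ) := by
    rw [rieszInt, ← integral_add_right_eq_self _ τ, ← integral_neg]
    refine integral_congr_ae (Filter.Eventually.of_forall fun w => ?_)
    simp only [hanti, e]
    ring
  have e2 : (2 : ℂ) * rieszInt G p 1 = ∫ w, G w * ((e w - e (w + τ) : ℝ) : ℂ) := by
    rw [two_mul]
    nth_rw 2 [e1]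
    rw [← sub_eq_add_neg, rieszInt, ← integral_sub hGe hGeτ]
    refine integral_congr_ae (Filter.Eventually.of_forall fun w => ?_)
    simp only [e]
    push_cast
    ring
  have hnorm : ∀ w : V v × ℝ, ‖(w + τ).1‖ ^ 2 = ‖w.1‖ ^ 2 + 2 * δ * w.1 i + δ ^ 2 := by
    intro w
    change ‖w.1 + EuclideanSpace.single i δ‖ ^ 2 = _
    rw [norm_add_sq_real, EuclideanSpace.inner_single_right, PiLp.norm_single]
    simp
    ring
  have hcmp : ∀ w w' : V v × ℝ, w.2 = w'.2 → ‖w.1‖ ^ 2 ≤ ‖w'.1‖ ^ 2 → e w' ≤ e w := by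
    intro w w' h2 h1
    refine truncPow_mono hp ?_
    unfold gauge4
    rw [h2]
    nlinarith [sq_nonneg ‖w.1‖, sq_nonneg ‖w'.1‖]
  -- Translation by `τ` moves a point away from the origin exactly when its `i`-th coordinate is at
  -- least `-δ/2` (for `δ > 0`). So `e - e(· + τ)` is nonnegative on `A`, nonpositive off it, and `B
  -- = A + τ`.
  let A : Set (V v × ℝ) := {w | -(δ / 2) ≤ w.1 i}
  let B : Set (V v × ℝ) := {w | δ / 2 ≤ w.1 i}
  have hAm : MeasurableSet A := measurableSet_le measurable_const (by fun_prop)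
  have hBm : MeasurableSet B := measurableSet_le measurable_const (by fun_prop)
  have hAB : ∀ w, w ∈ A ↔ w + τ ∈ B := by
    intro w
    simp only [A, B, mem_ofPred_eq, hτ, Prod.fst_add, PiLp.add_apply, PiLp.single_apply,
      if_true]
    constructor <;> intro h <;> linarith
  have habs : ∀ w, |e w - e (w + τ)| =
      2 * A.indicator (fun w => e w - e (w + τ)) w - (e w - e (w + τ)) := by
    intro w
    have h2 : w.2 = (w + τ).2 := by simp [hτ]
    by_cases hw : w ∈ A
    · rw [indicator_of_mem hw, abs_of_nonneg]
      · ring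
      · have hw' : -(δ / 2) ≤ w.1 i := hw
        refine sub_nonneg.mpr (hcmp w (w + τ) h2 ?_)
        rw [hnorm]
        nlinarith
    · rw [indicator_of_notMem hw, abs_of_nonpos]
      · ring
      · have hw' : w.1 i < -(δ / 2) := not_le.mp hw
        refine sub_nonpos.mpr (hcmp (w + τ) w h2.symm ?_)
        rw [hnorm]
        nlinarith
  have hint : ∫ w, (e w - e (w + τ)) = 0 := by
    rw [integral_sub he heτ, integral_add_right_eq_self e τ, sub_self]
  have hAint : ∫ w, A.indicator (fun w => e w - e (w + τ)) w ≤ 2 ^ v * δ := by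
    -- After translating the second term, the integral over `A` becomes that of `e` over `A` minus
    -- that over `B`. Only the slab `A \ B` of width `δ` remains, and there `e ≤ 1`.
    have hs : (A.indicator fun w => e w - e (w + τ)) =
        fun w => A.indicator e w - (B.indicator e) (w + τ) := by
      ext w
      by_cases hw : w ∈ A
      · rw [indicator_of_mem hw, indicator_of_mem hw, indicator_of_mem ((hAB w).mp hw)]
      · rw [indicator_of_notMem hw, indicator_of_notMem hw,
          indicator_of_notMem fun h => hw ((hAB w).mpr h), sub_zero]
    rw [hs, integral_sub (he.indicator hAm) ((he.indicator hBm).comp_add_right τ),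
      integral_add_right_eq_self (B.indicator e) τ, ← integral_sub (he.indicator hAm)
      (he.indicator hBm)]
    have hSm : MeasurableSet (gaugeBall (V v) ∩ {w | |w.1 i| ≤ δ / 2}) :=
      measurableSet_gaugeBall.inter (measurableSet_le (by fun_prop) measurable_const)
    have hSf : volume (gaugeBall (V v) ∩ {w | |w.1 i| ≤ δ / 2}) ≠ ⊤ :=
      ((measure_mono inter_subset_left).trans_lt volume_gaugeBall_lt_top).ne
    calc _ ≤ ∫ w, (gaugeBall (V v) ∩ {w | |w.1 i| ≤ δ / 2}).indicator (fun _ => (1 : ℝ)) w := by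
          refine integral_mono ((he.indicator hAm).sub (he.indicator hBm))
            ((integrableOn_const hSf).integrable_indicator hSm) fun w => ?_
          have ht : e w ≤ _ := truncPow_one_sub_le hp w
          have h0 : 0 ≤ (gaugeBall (V v) ∩ {w | |w.1 i| ≤ δ / 2}).indicator
            (fun _ => (1 : ℝ)) w := indicator_nonneg (fun _ _ => zero_le_one) w
          by_cases hB : w ∈ B
          · have hA : w ∈ A := by
              have hB' : δ / 2 ≤ w.1 i := hB
              change -(δ / 2) ≤ w.1 i
              linarith
            simp only [indicator_of_mem hA, indicator_of_mem hB, sub_self]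
            exact h0
          · by_cases hA : w ∈ A
            · simp only [indicator_of_mem hA, indicator_of_notMem hB, sub_zero]
              have hB' : w.1 i < δ / 2 := not_le.mp hB
              have hA' : -(δ / 2) ≤ w.1 i := hA
              by_cases hw : w ∈ gaugeBall (V v)
              · have hm : w ∈ gaugeBall (V v) ∩ {w | |w.1 i| ≤ δ / 2} :=
                  ⟨hw, abs_le.mpr ⟨hA', hB'.le⟩⟩
                rw [indicator_of_mem hm]
                rwa [indicator_of_mem hw] at ht
              · rw [indicator_of_notMem hw] at ht
                exact ht.trans h0
            · simp only [indicator_of_notMem hA, indicator_of_notMem hB, sub_zero]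
              exact h0
      _ = (volume (gaugeBall (V v) ∩ {w | |w.1 i| ≤ δ / 2})).toReal := by
          rw [integral_indicator hSm, setIntegral_const, smul_eq_mul, mul_one]
          rfl
      _ ≤ _ := volume_slab_le i hδ
  have hD : Integrable fun w => e w - e (w + τ) := he.sub heτ
  have hfin : ‖(2 : ℂ) * rieszInt G p 1‖ ≤ 2 * (2 ^ v * δ) := by
    rw [e2]
    calc _ ≤ ∫ w, |e w - e (w + τ)| := by
          refine norm_integral_le_of_norm_le hD.abs (Filter.Eventually.of_forall fun w => ?_)
          rw [norm_mul, Complex.norm_real, Real.norm_eq_abs]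
          exact mul_le_of_le_one_left (abs_nonneg _) (hG1 w)
      _ = 2 * ∫ w, A.indicator (fun w => e w - e (w + τ)) w := by
          simp_rw [habs]
          rw [integral_sub ((hD.indicator hAm).const_mul 2) hD, hint, sub_zero, integral_const_mul]
      _ ≤ _ := by gcongr
  rw [norm_mul, Complex.norm_ofNat] at hfin
  linarith

/-! ### Slicing and polar coordinates -/

/-- Orthogonal decomposition along the line spanned by `u`, with an orthonormal basis of the
complement. -/
theorem exists_measurePreserving_slice {E : Type} [NormedAddCommGroup E] [InnerProductSpace ℝ E]
    [FiniteDimensional ℝ E] [MeasurableSpace E] [BorelSpace E] {m : ℕ}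
    (hm : Module.finrank ℝ E = m + 1) {u : E} (hu : ‖u‖ = 1) :
    ∃ e : E ≃ᵐ ℝ × EuclideanSpace ℝ (Fin m), MeasurePreserving e ∧
      ∀ a, (e a).1 = inner ℝ u a ∧ ‖a‖ ^ 2 = (e a).1 ^ 2 + ‖(e a).2‖ ^ 2 := by
  have hu0 : u ≠ 0 := fun h => by simp [h] at hu
  set K : Submodule ℝ E := Submodule.span ℝ {u} with hK
  have hd : Module.finrank ℝ Kᗮ = m := by
    have h := K.finrank_add_finrank_orthogonal
    have h1 : Module.finrank ℝ K = 1 := finrank_span_singleton hu0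
    omega
  let b : OrthonormalBasis (Fin m) ℝ Kᗮ := (stdOrthonormalBasis ℝ Kᗮ).reindex (finCongr hd)
  let ψ : E ≃ₗᵢ[ℝ] WithLp 2 (ℝ × EuclideanSpace ℝ (Fin m)) :=
    K.orthogonalDecomposition.trans (LinearIsometryEquiv.withLpProdCongr 2
      (LinearIsometryEquiv.toSpanUnitSingleton u hu).symm b.repr)
  have hψu : ψ u = WithLp.toLp 2 (1, 0) := by
    have h1 : K.orthogonalProjectionOnto u = ⟨u, Submodule.mem_span_singleton_self u⟩ :=
      K.orthogonalProjectionOnto_mem_subspace_eq_self ⟨u, Submodule.mem_span_singleton_self u⟩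
    have h2 : Kᗮ.orthogonalProjectionOnto u = 0 :=
      Submodule.orthogonalProjectionOnto_orthogonal_apply_eq_zero
        (Submodule.mem_span_singleton_self u)
    have h3 : (LinearIsometryEquiv.toSpanUnitSingleton (𝕜 := ℝ) u hu).symm
        ⟨u, Submodule.mem_span_singleton_self u⟩ = 1 := by
      rw [LinearIsometryEquiv.symm_apply_eq]
      ext
      simp
    simp only [ψ, LinearIsometryEquiv.trans_apply, Submodule.orthogonalDecomposition_apply, h1, h2]
    simp [LinearIsometryEquiv.withLpProdCongr, h3]
  refine ⟨ψ.toMeasurableEquiv.trans (MeasurableEquiv.toLp 2 _).symm,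
    ψ.measurePreserving.trans (WithLp.volume_preserving_ofLp _ _), fun a => ⟨?_, ?_⟩⟩
  · change (ψ a).fst = _
    rw [← ψ.inner_map_map, hψu, WithLp.prod_inner_apply]
    simp
  · change _ = (ψ a).fst ^ 2 + ‖(ψ a).snd‖ ^ 2
    rw [← ψ.norm_map a, WithLp.prod_norm_sq_eq_of_L2]
    simp

/-- At a fixed `w = (X, ⟨u, A⟩)`, the remaining central variables fill a ball of radius `(y -
|w|⁴)₊^(1/2)` in dimension `m`, whose volume produces the exponent `m/2`. -/
theorem integral_slice {E F : Type} [NormedAddCommGroup E] [InnerProductSpace ℝ E]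
    [FiniteDimensional ℝ E] [MeasurableSpace E] [BorelSpace E]
    [NormedAddCommGroup F] [InnerProductSpace ℝ F]
    [FiniteDimensional ℝ F] [MeasurableSpace F] [BorelSpace F] {m : ℕ}
    (hm : Module.finrank ℝ F = m + 1) {u : F} (hu : ‖u‖ = 1) {G : E × ℝ → ℂ} (hG : Measurable G)
    (hG1 : ∀ w, ‖G w‖ ≤ 1) (y : ℝ) :
    ∫ n : E × F, {n : E × F | ‖n.1‖ ^ 4 + ‖n.2‖ ^ 2 < y}.indicator
      (fun n => G (n.1, inner ℝ u n.2)) n =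
      ((volume (Metric.ball (0 : EuclideanSpace ℝ (Fin m)) 1)).toReal : ℂ) *
        rieszInt G (m / 2) y := by
  obtain ⟨e, he, hea⟩ := exists_measurePreserving_slice hm hu
  let S : Set ((E × ℝ) × EuclideanSpace ℝ (Fin m)) := {x | gauge4 x.1 + ‖x.2‖ ^ 2 < y}
  have hSm : MeasurableSet S := measurableSet_lt
    ((continuous_gauge4.comp continuous_fst).add (by fun_prop)).measurable measurable_const
  let e' : E × F ≃ᵐ (E × ℝ) × EuclideanSpace ℝ (Fin m) :=
    (MeasurableEquiv.prodCongr (MeasurableEquiv.refl E) e).trans MeasurableEquiv.prodAssoc.symm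
  have he' : MeasurePreserving e' :=
    ((MeasurePreserving.id (volume : Measure E)).prod he).trans
      (volume_preserving_prodAssoc (α₁ := E) (β₁ := ℝ)
        (γ₁ := EuclideanSpace ℝ (Fin m))).symm
  have h1 : ∀ n : E × F, {n : E × F | ‖n.1‖ ^ 4 + ‖n.2‖ ^ 2 < y}.indicator
      (fun n => G (n.1, inner ℝ u n.2)) n = S.indicator (fun x => G x.1) (e' n) := by
    intro n
    have hn : n ∈ {n : E × F | ‖n.1‖ ^ 4 + ‖n.2‖ ^ 2 < y} ↔ e' n ∈ S := by
      change ‖n.1‖ ^ 4 + ‖n.2‖ ^ 2 < y ↔ ‖n.1‖ ^ 4 + (e n.2).1 ^ 2 + ‖(e n.2).2‖ ^ 2 < y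
      rw [(hea n.2).2, add_assoc]
    by_cases h : e' n ∈ S
    · rw [indicator_of_mem (hn.mpr h), indicator_of_mem h]
      change _ = G (n.1, (e n.2).1)
      rw [(hea n.2).1]
    · rw [indicator_of_notMem (fun h' => h (hn.mp h')), indicator_of_notMem h]
  simp_rw [h1]
  rw [he'.integral_comp e'.measurableEmbedding]
  have hSf : volume S < ⊤ := by
    refine Bornology.IsBounded.measure_lt_top ?_
    refine (((Metric.isBounded_closedBall (x := (0 : E)) (r := 1 + y)).prod
      (Metric.isBounded_closedBall (x := (0 : ℝ)) (r := 1 + y))).prod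
      (Metric.isBounded_closedBall (x := (0 : EuclideanSpace ℝ (Fin m)))
        (r := 1 + y))).subset fun x hx => ?_
    have hx' : gauge4 x.1 + ‖x.2‖ ^ 2 < y := hx
    have b1 := bounds_of_gauge4_lt (w := x.1) (y := y) (by nlinarith [sq_nonneg ‖x.2‖])
    have b2 : ‖x.2‖ ≤ 1 + y := by nlinarith [gauge4_nonneg x.1, sq_nonneg (‖x.2‖ - 1)]
    simp only [mem_prod, Metric.mem_closedBall, dist_zero_right, Real.norm_eq_abs]
    exact ⟨b1, b2⟩
  have hint : Integrable (S.indicator fun x => G x.1) (volume.prod volume) := by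
    refine ((integrableOn_const (C := (1 : ℝ)) hSf.ne).integrable_indicator hSm).mono'
      ((hG.comp measurable_fst).indicator hSm).aestronglyMeasurable
      (Filter.Eventually.of_forall fun x => ?_)
    by_cases h : x ∈ S
    · rw [indicator_of_mem h, indicator_of_mem h]; exact hG1 _
    · rw [indicator_of_notMem h, indicator_of_notMem h]; simp
  rw [Measure.volume_eq_prod, integral_prod _ hint, rieszInt, ← integral_const_mul]
  refine integral_congr_ae (Filter.Eventually.of_forall fun w => ?_)
  dsimp only
  have h2 : (fun c => S.indicator (fun x => G x.1) (w, c)) =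
      (Metric.ball (0 : EuclideanSpace ℝ (Fin m)) (Real.sqrt (y - gauge4 w))).indicator
        fun _ => G w := by
    ext c
    have hc : (w, c) ∈ S ↔ c ∈ Metric.ball (0 : EuclideanSpace ℝ (Fin m))
        (Real.sqrt (y - gauge4 w)) := by
      change gauge4 w + ‖c‖ ^ 2 < y ↔ _
      rw [mem_ball_zero_iff, Real.lt_sqrt (norm_nonneg c), lt_sub_iff_add_lt, add_comm]
    by_cases h : (w, c) ∈ S
    · rw [indicator_of_mem h, indicator_of_mem (hc.mp h)]
    · rw [indicator_of_notMem h, indicator_of_notMem fun h' => h (hc.mpr h')]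
  rw [h2, integral_indicator measurableSet_ball, setIntegral_const, Complex.real_smul]
  by_cases hw : 0 < y - gauge4 w
  · rw [truncPow_of_pos _ hw, measureReal_def,
      Measure.addHaar_ball_of_pos _ _ (Real.sqrt_pos.mpr hw), ENNReal.toReal_mul,
      ENNReal.toReal_ofReal (by positivity), finrank_euclideanSpace, Fintype.card_fin]
    rw [Real.sqrt_eq_rpow, ← Real.rpow_mul_natCast hw.le, one_div_mul_eq_div]
    push_cast
    ring
  · rw [truncPow_of_nonpos _ (not_lt.mp hw), Real.sqrt_eq_zero_of_nonpos (not_lt.mp hw),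
      Metric.ball_zero]
    simp

/-! ### Polar coordinates and spherical means of complex functions. -/

instance (v : ℕ) : BorelSpace (N v) := inferInstanceAs (BorelSpace (V v × Z v))

instance (v : ℕ) : SecondCountableTopology (N v) :=
  inferInstanceAs (SecondCountableTopology (V v × Z v))

theorem volume_koranyi_le_one_lt_top (v : ℕ) :
    volume {n : N v | 0 < koranyi n ∧ koranyi n ≤ 1} < ⊤ := by
  have hb : Bornology.IsBounded {n : V v × Z v | ‖n.1‖ ≤ 1 ∧ ‖n.2‖ ≤ 1} := by
    refine ((Metric.isBounded_closedBall (x := (0 : V v)) (r := 1)).prod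
      (Metric.isBounded_closedBall (x := (0 : Z v)) (r := 1))).subset fun n hn => ?_
    simpa using hn
  have hb' : (volume : Measure (V v × Z v)) {n : V v × Z v | ‖n.1‖ ≤ 1 ∧ ‖n.2‖ ≤ 1} < ⊤ :=
    hb.measure_lt_top
  refine lt_of_le_of_lt (measure_mono (μ := (volume : Measure (N v))) fun n hn => ?_) hb'
  have h : ((‖n.fst‖ ^ 4 + ‖n.snd‖ ^ 2) ^ (1 / 4 : ℝ)) ≤ 1 := hn.2
  have h2 : ‖n.fst‖ ^ 4 + ‖n.snd‖ ^ 2 ≤ 1 := by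
    rw [Real.rpow_le_one_iff_of_pos (by
      by_contra hc
      have h0 : ‖n.fst‖ ^ 4 + ‖n.snd‖ ^ 2 = 0 := le_antisymm (not_lt.mp hc) (by positivity)
      have h1 : 0 < (‖n.fst‖ ^ 4 + ‖n.snd‖ ^ 2) ^ (1 / 4 : ℝ) := hn.1
      rw [h0, Real.zero_rpow (by norm_num)] at h1
      exact lt_irrefl _ h1)] at h
    rcases h with h | h
    · norm_num at h
    · exact h.1
  constructor
  · change ‖n.fst‖ ≤ 1
    by_contra! hc
    nlinarith [one_lt_pow₀ hc (by norm_num : (4 : ℕ) ≠ 0), sq_nonneg ‖n.snd‖]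
  · change ‖n.snd‖ ≤ 1
    by_contra! hc
    nlinarith [pow_nonneg (norm_nonneg n.fst) 4]

instance (v : ℕ) : IsFiniteMeasure (sphereMeasure v) := by
  have h : IsFiniteMeasure ((volume : Measure (N v)).restrict
      {n | 0 < koranyi n ∧ koranyi n ≤ 1}) :=
    ⟨by rw [Measure.restrict_apply_univ]; exact volume_koranyi_le_one_lt_top v⟩
  have h2 : IsFiniteMeasure ((homDim v : NNReal) • ((volume : Measure (N v)).restrict
      {n | 0 < koranyi n ∧ koranyi n ≤ 1}).map (fun n => dil (koranyi n)⁻¹ n)) := inferInstance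
  convert h2
  rw [sphereMeasure]
  ext s hs
  simp [Measure.smul_apply, ENNReal.smul_def]

theorem continuous_dil (v : ℕ) : Continuous fun p : ℝ × N v => dil p.1 p.2 := by
  have h : Continuous fun p : ℝ × (V v × Z v) => (p.1 • p.2.1, p.1 ^ 2 • p.2.2) := by fun_prop
  exact h

theorem continuous_sphereMean {v : ℕ} {f : N v → ℂ} (hf : Continuous f) (hf1 : ∀ n, ‖f n‖ ≤ 1) :
    Continuous (sphereMean f) := by
  refine continuous_of_dominated (bound := fun _ => 1) (fun s => ?_)
    (fun s => Filter.Eventually.of_forall fun n => hf1 _) (integrable_const _)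
    (Filter.Eventually.of_forall fun n => ?_)
  · exact (hf.comp ((continuous_dil v).comp
      (continuous_const.prodMk continuous_id))).aestronglyMeasurable
  · exact hf.comp ((continuous_dil v).comp (continuous_id.prodMk continuous_const))

/-- Polar integration as an identity of measures, which transfers the formula from nonnegative
functions to Bochner integrals. -/
theorem map_dil_withDensity {v : ℕ} (hv : 0 < v) :
    ((((volume : Measure ℝ).restrict (Ioi 0)).prod (sphereMeasure v)).withDensity
      fun p => ENNReal.ofReal (p.1 ^ (homDim v - 1))).map (fun p => dil p.1 p.2) = volume := by
  have hd := measurable_dil v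
  refine Measure.ext_of_lintegral _ fun f hf => ?_
  have hfd : Measurable fun p : ℝ × N v => f (dil p.1 p.2) := hf.comp hd
  have hw : Measurable fun p : ℝ × N v => ENNReal.ofReal (p.1 ^ (homDim v - 1)) := by fun_prop
  rw [lintegral_polar hv f hf, lintegral_map hf hd,
    lintegral_withDensity_eq_lintegral_mul _ hw hfd,
    lintegral_prod _ (hw.mul hfd).aemeasurable]
  refine lintegral_congr fun r => ?_
  simp only [Pi.mul_apply]
  rw [lintegral_const_mul' _ _ ENNReal.ofReal_ne_top, mul_comm]

theorem integral_polar {v : ℕ} (hv : 0 < v) {f : N v → ℂ} (hf : Integrable f) :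
    ∫ n, f n = ∫ r in Ioi (0 : ℝ), ((r ^ (homDim v - 1) : ℝ) : ℂ) * sphereMean f r := by
  have hd := measurable_dil v
  have hw : Measurable fun p : ℝ × N v => ENNReal.ofReal (p.1 ^ (homDim v - 1)) := by fun_prop
  have hmap := map_dil_withDensity hv
  rw [← hmap] at hf ⊢
  have hf' := hf.comp_measurable hd
  rw [integral_map hd.aemeasurable hf.aestronglyMeasurable]
  rw [integrable_withDensity_iff_integrable_smul' hw (by simp)] at hf'
  simp only [Function.comp_def] at hf'
  rw [integral_withDensity_eq_integral_toReal_smul hw (by simp), integral_prod _ hf']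
  refine setIntegral_congr_fun measurableSet_Ioi fun r hr => ?_
  have hr' : (0 : ℝ) < r := hr
  simp only [sphereMean]
  rw [← integral_const_mul]
  refine integral_congr_ae (Filter.Eventually.of_forall fun n => ?_)
  simp only [Complex.real_smul]
  rw [ENNReal.toReal_ofReal (by positivity)]

theorem integral_koranyi_lt {v : ℕ} (hv : 0 < v) {f : N v → ℂ} (hf : Continuous f)
    (hf1 : ∀ n, ‖f n‖ ≤ 1) {s : ℝ} (hs : 0 < s) :
    ∫ n, {n : N v | koranyi n < s}.indicator f n =
      ∫ r in (0 : ℝ)..s, ((r ^ (homDim v - 1) : ℝ) : ℂ) * sphereMean f r := by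
  have hm : MeasurableSet {n : N v | koranyi n < s} :=
    measurableSet_lt (measurable_koranyi v) measurable_const
  have hfin : volume {n : N v | koranyi n < s} < ⊤ := by
    have hb : Bornology.IsBounded {n : V v × Z v | ‖n.1‖ ≤ s ∧ ‖n.2‖ ≤ s ^ 2} := by
      refine ((Metric.isBounded_closedBall (x := (0 : V v)) (r := s)).prod
        (Metric.isBounded_closedBall (x := (0 : Z v)) (r := s ^ 2))).subset fun n hn => ?_
      simpa using hn
    have hb' : (volume : Measure (V v × Z v))
        {n : V v × Z v | ‖n.1‖ ≤ s ∧ ‖n.2‖ ≤ s ^ 2} < ⊤ := hb.measure_lt_top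
    refine lt_of_le_of_lt (measure_mono (μ := (volume : Measure (N v))) fun n hn => ?_) hb'
    have h : ((‖n.fst‖ ^ 4 + ‖n.snd‖ ^ 2) ^ (1 / 4 : ℝ)) < s := hn
    have h2 : ‖n.fst‖ ^ 4 + ‖n.snd‖ ^ 2 < s ^ 4 := by
      have := pow_lt_pow_left₀ h (by positivity) (by norm_num : (4 : ℕ) ≠ 0)
      rwa [← Real.rpow_mul_natCast (by positivity), show (1 / 4 : ℝ) * (4 : ℕ) = 1 by norm_num,
        Real.rpow_one] at this
    constructor
    · change ‖n.fst‖ ≤ s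
      exact le_of_lt (lt_of_pow_lt_pow_left₀ 4 hs.le (by nlinarith [sq_nonneg ‖n.snd‖]))
    · change ‖n.snd‖ ≤ s ^ 2
      exact le_of_lt (lt_of_pow_lt_pow_left₀ 2 (by positivity)
        (by nlinarith [pow_nonneg (norm_nonneg n.fst) 4]))
  have hint : Integrable ({n : N v | koranyi n < s}.indicator f) := by
    refine ((integrableOn_const (C := (1 : ℝ)) hfin.ne).integrable_indicator hm).mono'
      (hf.measurable.indicator hm).aestronglyMeasurable (Filter.Eventually.of_forall fun x => ?_)
    by_cases h : x ∈ {n : N v | koranyi n < s}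
    · rw [indicator_of_mem h, indicator_of_mem h]; exact hf1 _
    · rw [indicator_of_notMem h, indicator_of_notMem h]; simp
  rw [integral_polar hv hint, intervalIntegral.integral_of_le hs.le, integral_Ioc_eq_integral_Ioo,
    ← integral_indicator measurableSet_Ioi, ← integral_indicator measurableSet_Ioo]
  refine integral_congr_ae (Filter.Eventually.of_forall fun r => ?_)
  have hae : ∀ᵐ n ∂sphereMeasure v, koranyi n = 1 := by
    rw [ae_iff]; exact sphereMeasure_compl v
  by_cases hr : 0 < r
  · rw [indicator_of_mem (by exact hr)]
    by_cases hrs : r < s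
    · rw [indicator_of_mem (by exact ⟨hr, hrs⟩)]
      congr 1
      refine integral_congr_ae (hae.mono fun n hn => ?_)
      refine indicator_of_mem ?_ _
      change koranyi (dil r n) < s
      rwa [koranyi_dil hr.le, hn, mul_one]
    · rw [indicator_of_notMem (fun h => hrs h.2)]
      have : sphereMean ({n : N v | koranyi n < s}.indicator f) r = 0 := by
        rw [sphereMean, ← integral_zero (N v) ℂ (μ := sphereMeasure v)]
        refine integral_congr_ae (hae.mono fun n hn => ?_)
        refine indicator_of_notMem ?_ _
        change ¬ koranyi (dil r n) < s
        rwa [koranyi_dil hr.le, hn, mul_one]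
      rw [this, mul_zero]
  · rw [indicator_of_notMem (by exact hr), indicator_of_notMem (fun h => hr h.1)]

theorem koranyi_lt_iff {v : ℕ} (n : N v) {s : ℝ} (hs : 0 < s) :
    koranyi n < s ↔ ‖n.fst‖ ^ 4 + ‖n.snd‖ ^ 2 < s ^ 4 := by
  have e : koranyi n ^ 4 = ‖n.fst‖ ^ 4 + ‖n.snd‖ ^ 2 := by
    rw [koranyi, ← Real.rpow_mul_natCast (by positivity),
      show (1 / 4 : ℝ) * (4 : ℕ) = 1 by norm_num, Real.rpow_one]
  rw [← e]
  exact (pow_lt_pow_iff_left₀ (by unfold koranyi; positivity) hs.le (by norm_num)).symm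

/-- The spherical mean of a function of `(X, ⟨u, A⟩)`. -/
theorem sphereMean_eq_rieszInt {v : ℕ} (hv : 4 ≤ v) {u : Z v} (hu : ‖u‖ = 1) {G : V v × ℝ → ℂ}
    (hG : Continuous G) (hG1 : ∀ w, ‖G w‖ ≤ 1) {s : ℝ} (hs : 0 < s) :
    sphereMean (v := v) (fun n => G (n.fst, inner ℝ u n.snd)) s =
      ((volume (Metric.ball (0 : EuclideanSpace ℝ (Fin (zdim v - 1))) 1)).toReal *
        (2 * (zdim v - 1)) : ℝ) * (((s ^ (4 - homDim v : ℤ) : ℝ) : ℂ) *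
        rieszInt G ((zdim v - 3) / 2) (s ^ 4)) := by
  set f : N v → ℂ := fun n => G (n.fst, inner ℝ u n.snd) with hf
  set c := (volume (Metric.ball (0 : EuclideanSpace ℝ (Fin (zdim v - 1))) 1)).toReal with hc
  have hz : 6 ≤ zdim v := by
    have h1 : 4 * 3 ≤ v * (v - 1) := Nat.mul_le_mul hv (by omega)
    unfold zdim
    omega
  have hfc : Continuous f := by
    have : Continuous fun n : V v × Z v => G (n.1, inner ℝ u n.2) := by fun_prop
    exact this
  have hf1 : ∀ n, ‖f n‖ ≤ 1 := fun n => hG1 _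
  have hF := continuous_sphereMean hfc hf1
  have hB : ∀ s : ℝ, 0 < s → ∫ n, {n : N v | koranyi n < s}.indicator f n =
      (c : ℂ) * rieszInt G ((zdim v - 1) / 2) (s ^ 4) := by
    intro s hs
    have h := integral_slice (m := zdim v - 1) (E := V v)
      (by rw [finrank_Z]; omega) hu hG.measurable hG1 (s ^ 4)
    have e1 : (((zdim v - 1 : ℕ) : ℝ) / 2) = (zdim v - 1) / 2 := by
      rw [Nat.cast_sub (by omega)]; simp
    rw [e1] at h
    rw [← h]
    have e2 : {n : N v | koranyi n < s} = {n : V v × Z v | ‖n.1‖ ^ 4 + ‖n.2‖ ^ 2 < s ^ 4} := by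
      ext n
      exact koranyi_lt_iff n hs
    rw [e2]
    rfl
  have hz6 : (6 : ℝ) ≤ zdim v := by exact_mod_cast hz
  -- The integral over the ball of radius `s` has derivative `s^(Q-1)` times the spherical mean.
  -- Slicing gives a second expression for the same integral, and comparing the two derivatives
  -- gives the formula.
  have hd1 : HasDerivAt (fun s : ℝ => ∫ r in (0 : ℝ)..s,
      ((r ^ (homDim v - 1) : ℝ) : ℂ) * sphereMean f r)
      (((s ^ (homDim v - 1) : ℝ) : ℂ) * sphereMean f s) s := by
    have hc : Continuous fun r : ℝ => ((r ^ (homDim v - 1) : ℝ) : ℂ) * sphereMean f r := by fun_prop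
    exact intervalIntegral.integral_hasDerivAt_right (hc.intervalIntegrable _ _)
      hc.aestronglyMeasurable.stronglyMeasurableAtFilter hc.continuousAt
  have hd2 := (hasDerivAt_rieszInt_pow_four hG.measurable hG1
    (p := (zdim v - 1) / 2) (by linarith) s).const_mul (c : ℂ)
  have heq := hd1.unique (hd2.congr_of_eventuallyEq (by
    filter_upwards [Ioi_mem_nhds hs] with t ht
    rw [← hB t ht, integral_koranyi_lt (by omega) hfc hf1 ht]))
  have hs0 : s ≠ 0 := hs.ne'
  -- The slices have dimension `z - 1`; one differentiation lowers the exponent from `(z - 1)/2` to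
  -- `(z - 3)/2`.
  have e3 : ((zdim v - 1) / 2 - 1 : ℝ) = (zdim v - 3) / 2 := by ring
  rw [e3] at heq
  have hQ : 1 ≤ homDim v := by unfold homDim; omega
  have e4 : s ^ (4 - homDim v : ℤ) * s ^ (homDim v - 1) = s ^ 3 := by
    rw [← zpow_natCast, ← zpow_natCast, ← zpow_add₀ hs0, Nat.cast_sub hQ]
    congr 1
    push_cast
    ring
  have e5 : ((s ^ (homDim v - 1) : ℝ) : ℂ) ≠ 0 := by
    exact_mod_cast pow_ne_zero _ hs0
  refine mul_left_cancel₀ e5 (heq.trans ?_)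
  have e6 := congrArg (fun x : ℝ => (x : ℂ)) e4
  push_cast at e6 ⊢
  linear_combination (-(c : ℂ) * (2 * (zdim v - 1)) * rieszInt G ((zdim v - 3) / 2) (s ^ 4)) * e6

/-! ### Invariance under the orthogonal group -/

theorem sum_pairs_lt {v : ℕ} (f : Fin v → Fin v → ℝ) :
    ∑ p : {p : Fin v × Fin v // p.1 < p.2}, f p.1.1 p.1.2 =
      ∑ i, ∑ j, if i < j then f i j else 0 := by
  rw [← Fintype.sum_prod_type' fun i j => if i < j then f i j else 0, ← Finset.sum_filter]
  exact (Finset.sum_subtype (Finset.univ.filter fun p : Fin v × Fin v => p.1 < p.2) (by simp)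
    fun p => f p.1 p.2).symm

theorem toSkew_transpose {v : ℕ} (A : Z v) : (toSkew A).transpose = -toSkew A := by
  ext i j
  simp only [Matrix.transpose_apply, toSkew, Matrix.of_apply, Matrix.neg_apply]
  split_ifs <;> first | omega | simp

theorem toSkew_ofSkew {v : ℕ} {M : Matrix (Fin v) (Fin v) ℝ} (hM : M.transpose = -M) :
    toSkew (ofSkew M) = M := by
  have h : ∀ i j, M j i = -M i j := fun i j => congrFun (congrFun hM i) j
  ext i j
  simp only [toSkew, ofSkew, Matrix.of_apply]
  split_ifs with h1 h2
  · rfl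
  · rw [h i j, neg_neg]
  · obtain rfl : i = j := by omega
    linarith [h i i]

/-- Writes the central norm as a Hilbert-Schmidt norm, so that conjugation by an orthogonal matrix
is seen to be an isometry. -/
theorem two_mul_norm_sq_eq_trace {v : ℕ} (A : Z v) :
    2 * ‖A‖ ^ 2 = (toSkew A * (toSkew A).transpose).trace := by
  have h1 : ‖A‖ ^ 2 = ∑ i, ∑ j, if i < j then toSkew A i j ^ 2 else 0 := by
    rw [EuclideanSpace.norm_sq_eq, ← sum_pairs_lt fun i j => toSkew A i j ^ 2]
    refine Finset.sum_congr rfl fun p _ => ?_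
    simp [toSkew, p.2]
  have h2 : ‖A‖ ^ 2 = ∑ i, ∑ j, if j < i then toSkew A i j ^ 2 else 0 := by
    rw [h1, Finset.sum_comm]
    refine Finset.sum_congr rfl fun i _ => Finset.sum_congr rfl fun j _ => ?_
    have : toSkew A j i = -toSkew A i j := congrFun (congrFun (toSkew_transpose A) i) j
    rw [this, neg_sq]
  rw [two_mul]
  nth_rw 1 [h1]
  rw [h2, ← Finset.sum_add_distrib, Matrix.trace]
  refine Finset.sum_congr rfl fun i _ => ?_
  rw [← Finset.sum_add_distrib, Matrix.diag_apply, Matrix.mul_apply]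
  refine Finset.sum_congr rfl fun j _ => ?_
  rw [Matrix.transpose_apply, ← pow_two]
  have hii : toSkew A i i = 0 := by simp [toSkew]
  rcases lt_trichotomy i j with h | h | h
  · simp [h, h.not_gt]
  · subst h; simp [hii]
  · simp [h, h.not_gt]

theorem coe_inv_orth {v : ℕ} (k : Orth v) : ((k⁻¹ : Orth v) : Matrix (Fin v) (Fin v) ℝ) =
    (k : Matrix (Fin v) (Fin v) ℝ).transpose := rfl

theorem orth_transpose_mul {v : ℕ} (k : Orth v) : (k : Matrix (Fin v) (Fin v) ℝ).transpose *
    (k : Matrix (Fin v) (Fin v) ℝ) = 1 := (Matrix.mem_orthogonalGroup_iff' (Fin v) ℝ).mp k.2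

/-- The action of `O(v)` on the first layer, as a linear isometry. -/
def rotV {v : ℕ} (k : Orth v) : V v →ₗᵢ[ℝ] V v where
  toFun X := WithLp.toLp 2 ((k : Matrix (Fin v) (Fin v) ℝ).mulVec X.ofLp)
  map_add' X Y := by rw [WithLp.ofLp_add, Matrix.mulVec_add]; rfl
  map_smul' c X := by rw [WithLp.ofLp_smul, Matrix.mulVec_smul]; rfl
  norm_map' X := by
    rw [← sq_eq_sq₀ (norm_nonneg _) (norm_nonneg _), EuclideanSpace.real_norm_sq_eq,
      EuclideanSpace.real_norm_sq_eq]
    have h : ∀ x : Fin v → ℝ, ∑ i, x i ^ 2 = dotProduct x x := fun x =>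
      Finset.sum_congr rfl fun i _ => pow_two _
    change ∑ i, ((k : Matrix (Fin v) (Fin v) ℝ).mulVec X.ofLp) i ^ 2 = ∑ i, X.ofLp i ^ 2
    rw [h, h, Matrix.dotProduct_mulVec, ← Matrix.mulVec_transpose, Matrix.mulVec_mulVec,
      orth_transpose_mul, Matrix.one_mulVec]

theorem toSkew_add {v : ℕ} (A B : Z v) : toSkew (A + B) = toSkew A + toSkew B := by
  ext i j
  simp only [toSkew, Matrix.of_apply, Matrix.add_apply]
  split_ifs <;> simp; ring

theorem toSkew_smul {v : ℕ} (c : ℝ) (A : Z v) : toSkew (c • A) = c • toSkew A := by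
  ext i j
  simp only [toSkew, Matrix.of_apply, Matrix.smul_apply]
  split_ifs <;> simp

/-- The action of `O(v)` on the centre, as a linear isometry. -/
def rotZ {v : ℕ} (k : Orth v) : Z v →ₗᵢ[ℝ] Z v where
  toFun A := ofSkew ((k : Matrix (Fin v) (Fin v) ℝ) * toSkew A *
      ((k⁻¹ : Orth v) : Matrix (Fin v) (Fin v) ℝ))
  map_add' A B := by rw [toSkew_add, Matrix.mul_add, Matrix.add_mul]; rfl
  map_smul' c A := by rw [toSkew_smul, Matrix.mul_smul, Matrix.smul_mul]; rfl
  norm_map' A := by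
    change ‖ofSkew ((k : Matrix (Fin v) (Fin v) ℝ) * toSkew A *
      ((k⁻¹ : Orth v) : Matrix (Fin v) (Fin v) ℝ))‖ = ‖A‖
    rw [coe_inv_orth]
    set K := (k : Matrix (Fin v) (Fin v) ℝ) with hK
    have hKK : K.transpose * K = 1 := orth_transpose_mul k
    rw [← sq_eq_sq₀ (norm_nonneg _) (norm_nonneg _)]
    have h1 : (K * toSkew A * K.transpose).transpose = -(K * toSkew A * K.transpose) := by
      rw [Matrix.transpose_mul, Matrix.transpose_mul, Matrix.transpose_transpose, toSkew_transpose]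
      simp [Matrix.mul_assoc]
    have h2 := two_mul_norm_sq_eq_trace (ofSkew (K * toSkew A * K.transpose))
    rw [toSkew_ofSkew h1, Matrix.transpose_mul, Matrix.transpose_mul, Matrix.transpose_transpose]
      at h2
    have h3 : K * toSkew A * K.transpose * (K * ((toSkew A).transpose * K.transpose)) =
        K * ((toSkew A * (toSkew A).transpose) * K.transpose) := by
      calc _ = K * toSkew A * (K.transpose * K) * ((toSkew A).transpose * K.transpose) := by
            simp only [Matrix.mul_assoc]
        _ = _ := by rw [hKK, Matrix.mul_one]; simp only [Matrix.mul_assoc]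
    rw [h3, Matrix.trace_mul_comm, Matrix.mul_assoc _ K.transpose K, hKK, Matrix.mul_one,
      ← two_mul_norm_sq_eq_trace] at h2
    linarith


theorem koranyi_rot {v : ℕ} (k : Orth v) (n : N v) : koranyi (rot k n) = koranyi n := by
  change (‖rotV k n.fst‖ ^ 4 + ‖rotZ k n.snd‖ ^ 2) ^ (1 / 4 : ℝ) = _
  rw [LinearIsometry.norm_map, LinearIsometry.norm_map]
  rfl

theorem rot_dil {v : ℕ} (k : Orth v) (s : ℝ) (n : N v) : rot k (dil s n) = dil s (rot k n) :=
  Prod.ext ((rotV k).map_smul s n.fst) ((rotZ k).map_smul (s ^ 2) n.snd)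

theorem measurePreserving_linearIsometry {E : Type} [NormedAddCommGroup E] [InnerProductSpace ℝ E]
    [FiniteDimensional ℝ E] [MeasurableSpace E] [BorelSpace E] (f : E →ₗᵢ[ℝ] E) :
    MeasurePreserving f volume volume :=
  (f.toLinearIsometryEquiv rfl).measurePreserving

theorem measurePreserving_rot {v : ℕ} (k : Orth v) :
    MeasurePreserving (rot k : N v → N v) volume volume :=
  (measurePreserving_linearIsometry (rotV k)).prod (measurePreserving_linearIsometry (rotZ k))

/-- Rotations preserve volume and the Korányi norm and commute with dilations, and `sphereMeasure`
is built from these alone. -/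
theorem measurePreserving_rot_sphereMeasure {v : ℕ} (k : Orth v) :
    MeasurePreserving (rot k) (sphereMeasure v) (sphereMeasure v) := by
  have hk := measurable_koranyi v
  have hr := measurePreserving_rot k
  have hT : Measurable fun n : N v => dil (koranyi n)⁻¹ n :=
    (measurable_dil v).comp (hk.inv.prodMk measurable_id)
  have hB : MeasurableSet {n : N v | 0 < koranyi n ∧ koranyi n ≤ 1} :=
    (measurableSet_lt measurable_const hk).inter (measurableSet_le hk measurable_const)
  refine ⟨hr.measurable, ?_⟩
  have h1 := (hr.restrict_preimage hB).map_eq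
  have h2 : rot k ⁻¹' {n : N v | 0 < koranyi n ∧ koranyi n ≤ 1} =
      {n : N v | 0 < koranyi n ∧ koranyi n ≤ 1} := by
    ext n
    simp only [mem_preimage, mem_ofPred_eq, koranyi_rot]
  rw [h2] at h1
  rw [sphereMeasure, Measure.map_smul, Measure.map_map hr.measurable hT]
  congr 1
  conv_rhs => rw [← h1, Measure.map_map hT hr.measurable]
  congr 1
  ext1 n
  simp only [Function.comp_def, koranyi_rot, rot_dil]

theorem continuous_rot (v : ℕ) : Continuous fun p : Orth v × N v => rot p.1 p.2 := by
  have hs : Continuous fun A : Z v => toSkew A := by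
    refine continuous_matrix fun i j => ?_
    simp only [toSkew, Matrix.of_apply]
    split_ifs <;> fun_prop
  have hk : Continuous fun p : Orth v × (V v × Z v) => (p.1 : Matrix (Fin v) (Fin v) ℝ) :=
    continuous_subtype_val.comp continuous_fst
  have h1 : Continuous fun p : Orth v × (V v × Z v) =>
      (WithLp.toLp 2 ((p.1 : Matrix (Fin v) (Fin v) ℝ).mulVec p.2.1.ofLp) : V v) :=
    (PiLp.continuous_toLp 2 _).comp (hk.matrix_mulVec (by fun_prop))
  have h2 : Continuous fun p : Orth v × (V v × Z v) =>
      (p.1 : Matrix (Fin v) (Fin v) ℝ) * toSkew p.2.2 *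
        (p.1 : Matrix (Fin v) (Fin v) ℝ).transpose :=
    (hk.matrix_mul (hs.comp (by fun_prop))).matrix_mul hk.matrix_transpose
  have h3 : Continuous fun p : Orth v × (V v × Z v) =>
      (ofSkew ((p.1 : Matrix (Fin v) (Fin v) ℝ) * toSkew p.2.2 *
        (p.1 : Matrix (Fin v) (Fin v) ℝ).transpose) : Z v) :=
    (PiLp.continuous_toLp 2 _).comp (continuous_pi fun q => h2.matrix_elem _ _)
  exact h1.prodMk h3

instance (v : ℕ) : SecondCountableTopology (Orth v) :=
  have : SecondCountableTopology (Matrix (Fin v) (Fin v) ℝ) :=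
    inferInstanceAs (SecondCountableTopology (Fin v → Fin v → ℝ))
  (Topology.IsInducing.subtypeVal : Topology.IsInducing
    ((↑) : Orth v → Matrix (Fin v) (Fin v) ℝ)).secondCountableTopology

/-- Fubini, then invariance of the sphere measure under each rotation, since the Haar measure has
mass one. -/
theorem sphereMean_average {v : ℕ} {f : N v → ℂ} (hf : Continuous f) (hf1 : ∀ n, ‖f n‖ ≤ 1)
    (s : ℝ) : sphereMean (fun n => ∫ k, f (rot k n) ∂haarOrth v) s = sphereMean f s := by
  have hc : Continuous fun p : N v × Orth v => f (rot p.2 (dil s p.1)) :=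
    hf.comp ((continuous_rot v).comp (continuous_snd.prodMk
      ((continuous_dil v).comp (continuous_const.prodMk continuous_fst))))
  have hi : Integrable (Function.uncurry fun (n : N v) (k : Orth v) => f (rot k (dil s n)))
      ((sphereMeasure v).prod (haarOrth v)) :=
    (integrable_const (1 : ℝ)).mono' hc.aestronglyMeasurable
      (Filter.Eventually.of_forall fun p => hf1 _)
  simp only [sphereMean]
  rw [integral_integral_swap hi]
  have h : ∀ k : Orth v, ∫ n, f (rot k (dil s n)) ∂sphereMeasure v =
      ∫ n, f (dil s n) ∂sphereMeasure v := by
    intro k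
    have hmp := measurePreserving_rot_sphereMeasure k
    have hcs : Continuous fun n : N v => f (dil s n) :=
      hf.comp ((continuous_dil v).comp (continuous_const.prodMk continuous_id))
    conv_rhs => rw [← hmp.map_eq]
    rw [integral_map hmp.measurable.aemeasurable hcs.aestronglyMeasurable]
    simp only [rot_dil]
  simp [h]

/-! ### The functions `Θ` -/

/-- `Θ` as a function of the first layer and of one central coordinate. -/
def thetaSlice {v : ℕ} (r : ℝ) (Λ : Fin (v / 2) → ℝ) (l : Fin (v / 2) → ℕ) (κ : ℝ)
    (w : V v × ℝ) : ℂ :=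
  Complex.exp (Complex.I * ((r * lastCoord w.1 : ℝ) : ℂ)) *
    Complex.exp (Complex.I * ((κ * w.2 : ℝ) : ℂ)) *
    ∏ j, ((laguerreFun (l j) (Λ j / 2 * ‖pr j w.1‖ ^ 2) : ℝ) : ℂ)

theorem continuous_lastCoord (v : ℕ) : Continuous (lastCoord (v := v)) := by
  unfold lastCoord
  split_ifs <;> fun_prop

theorem continuous_pr {v : ℕ} (j : Fin (v / 2)) : Continuous (pr (v := v) j) := by
  refine (PiLp.continuous_toLp 2 _).comp (continuous_pi fun i => ?_)
  split_ifs <;> fun_prop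

theorem continuous_thetaSlice {v : ℕ} (r : ℝ) (Λ : Fin (v / 2) → ℝ) (l : Fin (v / 2) → ℕ) (κ : ℝ) :
    Continuous (thetaSlice (v := v) r Λ l κ) := by
  have h1 := continuous_lastCoord v
  have h2 := fun j => continuous_pr (v := v) j
  have h3 := fun n => continuous_laguerreFun n
  unfold thetaSlice
  refine Continuous.mul (by fun_prop) (continuous_finsetProd _ fun j _ => ?_)
  exact Complex.continuous_ofReal.comp ((h3 (l j)).comp (by fun_prop))

theorem norm_thetaSlice {v : ℕ} (r : ℝ) (Λ : Fin (v / 2) → ℝ) (l : Fin (v / 2) → ℕ) (κ : ℝ)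
    (w : V v × ℝ) : ‖thetaSlice r Λ l κ w‖ = ∏ j, |laguerreFun (l j) (Λ j / 2 * ‖pr j w.1‖ ^ 2)| := by
  rw [thetaSlice, norm_mul, norm_mul, Complex.norm_exp_I_mul_ofReal,
    Complex.norm_exp_I_mul_ofReal, norm_prod]
  simp only [Complex.norm_real, Real.norm_eq_abs, one_mul]

/-- The exponentials have modulus 1 and the other Laguerre factors are at most 1, so any single
factor may be kept. -/
theorem norm_thetaSlice_le {v : ℕ} {r : ℝ} {Λ : Fin (v / 2) → ℝ} {l : Fin (v / 2) → ℕ}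
    (hΛ : ∀ j, 0 < Λ j) (κ : ℝ) (w : V v × ℝ) (j : Fin (v / 2)) :
    ‖thetaSlice r Λ l κ w‖ ≤ |laguerreFun (l j) (Λ j / 2 * ‖pr j w.1‖ ^ 2)| := by
  rw [norm_thetaSlice, ← Finset.mul_prod_erase _ _ (Finset.mem_univ j)]
  refine mul_le_of_le_one_right (abs_nonneg _) (Finset.prod_le_one (fun _ _ => abs_nonneg _) ?_)
  intro i _
  have := hΛ i
  exact abs_laguerreFun_le_one _ (by positivity)

theorem norm_thetaSlice_le_one {v : ℕ} {r : ℝ} {Λ : Fin (v / 2) → ℝ} {l : Fin (v / 2) → ℕ}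
    (hΛ : ∀ j, 0 < Λ j) (κ : ℝ) (w : V v × ℝ) : ‖thetaSlice r Λ l κ w‖ ≤ 1 := by
  rw [norm_thetaSlice]
  refine Finset.prod_le_one (fun _ _ => abs_nonneg _) fun i _ => ?_
  have := hΛ i
  exact abs_laguerreFun_le_one _ (by positivity)

theorem pairing_eq_inner {v : ℕ} (D : Matrix (Fin v) (Fin v) ℝ) (A : Z v) :
    pairing D A = inner ℝ (ofSkew D) A := by
  rw [pairing, PiLp.inner_apply]
  refine Finset.sum_congr rfl fun p _ => ?_
  simp [ofSkew, mul_comm]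

theorem Theta_eq_thetaSlice {v : ℕ} (r : ℝ) (Λ : Fin (v / 2) → ℝ) (l : Fin (v / 2) → ℕ) {κ : ℝ}
    {u : Z v} (hu : ofSkew (D2 Λ) = κ • u) (n : N v) :
    Theta r Λ l n = thetaSlice r Λ l κ (n.fst, inner ℝ u n.snd) := by
  rw [Theta, thetaSlice, pairing_eq_inner, hu, real_inner_smul_left]

theorem sphereMean_phi {v : ℕ} {r : ℝ} {Λ : Fin (v / 2) → ℝ} {l : Fin (v / 2) → ℕ}
    (hΛ : ∀ j, 0 < Λ j) {κ : ℝ} {u : Z v} (hu : ofSkew (D2 Λ) = κ • u) (s : ℝ) :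
    sphereMean (phi r Λ l) s =
      sphereMean (v := v) (fun n => thetaSlice r Λ l κ (n.fst, inner ℝ u n.snd)) s := by
  have hT : Theta r Λ l = fun n : N v => thetaSlice r Λ l κ (n.fst, inner ℝ u n.snd) :=
    funext fun n => Theta_eq_thetaSlice r Λ l hu n
  rw [← hT]
  refine sphereMean_average ?_ (fun n => ?_) s
  · rw [hT]
    have h : Continuous fun n : V v × Z v => thetaSlice r Λ l κ (n.1, inner ℝ u n.2) :=
      (continuous_thetaSlice r Λ l κ).comp (by fun_prop)
    exact h
  · rw [hT]
    exact norm_thetaSlice_le_one hΛ κ _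

/-! ### The square function -/

theorem norm_mul_sub_one_le {a b : ℂ} (ha : ‖a‖ ≤ 1) : ‖a * b - 1‖ ≤ ‖a - 1‖ + ‖b - 1‖ := by
  have e : a * b - 1 = (a - 1) + a * (b - 1) := by ring
  rw [e]
  refine (norm_add_le _ _).trans (add_le_add_right ?_ _)
  rw [norm_mul]
  exact mul_le_of_le_one_left (norm_nonneg _) ha

theorem norm_prod_sub_one_le {ι : Type*} (t : Finset ι) {f : ι → ℂ} (hf : ∀ i, ‖f i‖ ≤ 1) :
    ‖∏ i ∈ t, f i - 1‖ ≤ ∑ i ∈ t, ‖f i - 1‖ := by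
  classical
  induction t using Finset.induction_on with
  | empty => simp
  | insert i t hi ih =>
    rw [Finset.prod_insert hi, Finset.sum_insert hi]
    exact (norm_mul_sub_one_le (hf i)).trans (by gcongr)

theorem abs_lastCoord_le {v : ℕ} (X : V v) : |lastCoord X| ≤ ‖X‖ := by
  unfold lastCoord
  split_ifs
  · exact PiLp.norm_apply_le X _
  · simp

theorem lastCoord_smul {v : ℕ} (s : ℝ) (X : V v) : lastCoord (s • X) = s * lastCoord X := by
  unfold lastCoord
  split_ifs <;> simp

theorem norm_pr_le {v : ℕ} (j : Fin (v / 2)) (X : V v) : ‖pr j X‖ ≤ ‖X‖ := by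
  refine le_of_sq_le_sq ?_ (norm_nonneg _)
  rw [EuclideanSpace.real_norm_sq_eq, EuclideanSpace.real_norm_sq_eq]
  refine Finset.sum_le_sum fun i _ => ?_
  simp only [pr]
  split_ifs
  · exact le_rfl
  · rw [zero_pow two_ne_zero]; positivity

theorem pr_smul {v : ℕ} (j : Fin (v / 2)) (s : ℝ) (X : V v) : pr j (s • X) = s • pr j X := by
  ext i
  simp [pr]

theorem abs_coord_le_norm_pr {v : ℕ} (j : Fin (v / 2)) (X : V v) :
    |X ⟨2 * j, by omega⟩| ≤ ‖pr j X‖ := by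
  have h := PiLp.norm_apply_le (pr j X) ⟨2 * j, by omega⟩
  rw [Real.norm_eq_abs] at h
  simpa [pr] using h

/-- A crude count over all `z` entries; it only serves to control the central frequency by `σ²`. -/
theorem norm_ofSkew_D2_le {v : ℕ} {Λ : Fin (v / 2) → ℝ} {M : ℝ} (hΛ : ∀ j, 0 < Λ j)
    (hM : ∀ j, Λ j ≤ M) (hM0 : 0 ≤ M) : ‖(ofSkew (D2 Λ) : Z v)‖ ≤ (zdim v + 1) * M := by
  refine le_of_sq_le_sq ?_ (by positivity)
  rw [EuclideanSpace.real_norm_sq_eq]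
  have h : ∀ p : {p : Fin v × Fin v // p.1 < p.2}, (ofSkew (D2 Λ) : Z v) p ^ 2 ≤ M ^ 2 := by
    intro p
    simp only [ofSkew, D2, Matrix.of_apply]
    split_ifs with h1 h2
    · exact pow_le_pow_left₀ (hΛ _).le (hM _) 2
    · rw [neg_sq]; exact pow_le_pow_left₀ (hΛ _).le (hM _) 2
    · rw [zero_pow two_ne_zero]; positivity
  refine (Finset.sum_le_sum fun p _ => h p).trans ?_
  have hc : (Fintype.card {p : Fin v × Fin v // p.1 < p.2} : ℝ) = zdim v := by
    have := finrank_Z v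
    rw [finrank_euclideanSpace] at this
    exact_mod_cast this
  rw [Finset.sum_const, nsmul_eq_mul, Finset.card_univ, hc, mul_pow]
  have hz : (0 : ℝ) ≤ zdim v := Nat.cast_nonneg _
  gcongr
  nlinarith

/-- Every factor has modulus at most 1, so deviations from 1 add up. The linear exponential
contributes `σ s`; the central and Laguerre factors are `O((σ s)²)`, hence `O(σ s)` when `σ s ≤ 1`.
-/
theorem norm_thetaSlice_sub_one_le {v : ℕ} {r : ℝ} {Λ : Fin (v / 2) → ℝ} {l : Fin (v / 2) → ℕ}
    {κ σ s : ℝ} (hΛ : ∀ j, 0 < Λ j) (hr : |r| ≤ σ) (hσ : ∀ j, Λ j * (2 * l j + 1) ≤ σ ^ 2)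
    (hκ : |κ| ≤ (zdim v + 1) * σ ^ 2) (hs : 0 < s) (hσs : σ * s ≤ 1) {w : V v × ℝ}
    (hw : w ∈ gaugeBall (V v)) :
    ‖thetaSlice r Λ l κ (s • w.1, s ^ 2 * w.2) - 1‖ ≤ (zdim v + v + 2) * (σ * s) := by
  have hσ0 : 0 ≤ σ := (abs_nonneg r).trans hr
  obtain ⟨hw1, hw2⟩ := norm_lt_one_of_mem_gaugeBall hw
  have hσs0 : 0 ≤ σ * s := by positivity
  have hσs2 : (σ * s) ^ 2 ≤ σ * s := by nlinarith
  have h1 : ‖Complex.exp (Complex.I * ((r * lastCoord (s • w.1) : ℝ) : ℂ)) - 1‖ ≤ σ * s := by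
    refine Real.norm_exp_I_mul_ofReal_sub_one_le.trans ?_
    rw [lastCoord_smul, Real.norm_eq_abs, abs_mul, abs_mul, abs_of_pos hs]
    calc |r| * (s * |lastCoord w.1|) ≤ σ * (s * 1) := by
          gcongr
          exact (abs_lastCoord_le _).trans hw1.le
      _ = σ * s := by ring
  have h2 : ‖Complex.exp (Complex.I * ((κ * (s ^ 2 * w.2) : ℝ) : ℂ)) - 1‖ ≤
      (zdim v + 1) * (σ * s) := by
    refine Real.norm_exp_I_mul_ofReal_sub_one_le.trans ?_
    rw [Real.norm_eq_abs, abs_mul, abs_mul, abs_of_pos (by positivity : 0 < s ^ 2)]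
    calc |κ| * (s ^ 2 * |w.2|) ≤ (zdim v + 1) * σ ^ 2 * (s ^ 2 * 1) := by gcongr
      _ = (zdim v + 1) * (σ * s) ^ 2 := by ring
      _ ≤ _ := by gcongr
  have hpos : ∀ j, 0 ≤ Λ j / 2 * ‖pr j (s • w.1)‖ ^ 2 := fun j => by
    have := hΛ j
    positivity
  have h3 : ∀ j, ‖((laguerreFun (l j) (Λ j / 2 * ‖pr j (s • w.1)‖ ^ 2) : ℝ) : ℂ) - 1‖ ≤ σ * s := by
    intro j
    have hΛj := hΛ j
    have hlj : (0 : ℝ) ≤ l j := Nat.cast_nonneg _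
    have hq : ‖pr j w.1‖ ^ 2 ≤ 1 :=
      pow_le_one₀ (norm_nonneg _) ((norm_pr_le j w.1).trans hw1.le)
    have e : Λ j / 2 * ‖pr j (s • w.1)‖ ^ 2 = Λ j / 2 * s ^ 2 * ‖pr j w.1‖ ^ 2 := by
      rw [pr_smul, norm_smul, Real.norm_eq_abs, mul_pow, sq_abs]; ring
    have hb : (l j + 1 / 2 : ℝ) * (Λ j / 2 * ‖pr j (s • w.1)‖ ^ 2) ≤ (σ * s) ^ 2 := by
      rw [e]
      calc (l j + 1 / 2 : ℝ) * (Λ j / 2 * s ^ 2 * ‖pr j w.1‖ ^ 2) ≤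
            (l j + 1 / 2 : ℝ) * (Λ j / 2 * s ^ 2 * 1) := by gcongr
        _ = (Λ j * (2 * l j + 1)) * s ^ 2 / 4 := by ring
        _ ≤ σ ^ 2 * s ^ 2 / 4 := by gcongr; exact hσ j
        _ ≤ (σ * s) ^ 2 := by rw [mul_pow]; nlinarith [mul_nonneg (sq_nonneg σ) (sq_nonneg s)]
    have ht : Λ j / 2 * ‖pr j (s • w.1)‖ ^ 2 ≤ 4 * (l j + 1 / 2 : ℝ) := by
      nlinarith [hpos j, mul_nonneg hlj (hpos j)]
    have h4 := abs_laguerreFun_sub_one_le (l j) (hpos j) ht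
    rw [← Complex.ofReal_one, ← Complex.ofReal_sub, Complex.norm_real, Real.norm_eq_abs]
    linarith
  have h4 := norm_prod_sub_one_le Finset.univ
    (f := fun j => ((laguerreFun (l j) (Λ j / 2 * ‖pr j (s • w.1)‖ ^ 2) : ℝ) : ℂ)) fun j => by
      rw [Complex.norm_real]
      exact abs_laguerreFun_le_one _ (hpos j)
  have h5 := h4.trans (Finset.sum_le_sum fun j _ => h3 j)
  rw [Finset.sum_const, nsmul_eq_mul, Finset.card_univ, Fintype.card_fin] at h5
  have hv : ((v / 2 : ℕ) : ℝ) ≤ v := by exact_mod_cast Nat.div_le_self v 2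
  unfold thetaSlice
  have n1 := Complex.norm_exp_I_mul_ofReal (r * lastCoord (s • w.1))
  have n2 := Complex.norm_exp_I_mul_ofReal (κ * (s ^ 2 * w.2))
  have b1 := norm_mul_sub_one_le
    (a := Complex.exp (Complex.I * ((r * lastCoord (s • w.1) : ℝ) : ℂ)) *
      Complex.exp (Complex.I * ((κ * (s ^ 2 * w.2) : ℝ) : ℂ)))
    (b := ∏ j, ((laguerreFun (l j) (Λ j / 2 * ‖pr j (s • w.1)‖ ^ 2) : ℝ) : ℂ))
    (by rw [norm_mul, n1, n2, one_mul])
  have b2 := norm_mul_sub_one_le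
    (a := Complex.exp (Complex.I * ((r * lastCoord (s • w.1) : ℝ) : ℂ)))
    (b := Complex.exp (Complex.I * ((κ * (s ^ 2 * w.2) : ℝ) : ℂ))) n1.le
  have b3 := mul_le_mul_of_nonneg_right hv hσs0
  dsimp only at b1 b2 ⊢
  linarith

theorem measurable_thetaSlice_dil {v : ℕ} (r : ℝ) (Λ : Fin (v / 2) → ℝ) (l : Fin (v / 2) → ℕ)
    (κ s : ℝ) : Measurable fun w : V v × ℝ => thetaSlice r Λ l κ (s • w.1, s ^ 2 * w.2) :=
  ((continuous_thetaSlice r Λ l κ).comp (by fun_prop)).measurable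

/-- Translating the last coordinate by `π / (r s)` multiplies `e^(i r s x_v)` by `e^(iπ) = -1` and
leaves every other factor unchanged. -/
theorem norm_rieszInt_thetaSlice_le {v : ℕ} (hv : Odd v) {r : ℝ} {Λ : Fin (v / 2) → ℝ}
    {l : Fin (v / 2) → ℕ} {κ s p : ℝ} (hΛ : ∀ j, 0 < Λ j) (hr : 0 < r) (hs : 0 < s) (hp : 0 ≤ p) :
    ‖rieszInt (fun w : V v × ℝ => thetaSlice r Λ l κ (s • w.1, s ^ 2 * w.2)) p 1‖ ≤
      2 ^ v * Real.pi / (r * s) := by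
  have hv0 : 0 < v := hv.pos
  rw [mul_div_assoc]
  refine norm_rieszInt_le_of_antiperiodic ⟨v - 1, by omega⟩ (measurable_thetaSlice_dil r Λ l κ s)
    (fun w => norm_thetaSlice_le_one hΛ κ _) hp (by positivity) fun w => ?_
  have h1 : lastCoord (s • (w.1 + EuclideanSpace.single ⟨v - 1, by omega⟩ (Real.pi / (r * s)))) =
      lastCoord (s • w.1) + Real.pi / r := by
    simp only [lastCoord, hv0, dif_pos, PiLp.smul_apply, PiLp.add_apply, smul_eq_mul]
    rw [PiLp.single_apply, if_pos rfl, mul_add]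
    congr 1
    field_simp
  have h2 : ∀ j : Fin (v / 2), pr j (s • (w.1 + EuclideanSpace.single ⟨v - 1, by omega⟩
      (Real.pi / (r * s)))) = pr j (s • w.1) := by
    intro j
    ext i
    simp only [pr]
    split_ifs with hi
    · simp only [PiLp.smul_apply, PiLp.add_apply, smul_eq_mul]
      -- For `v` odd the last index is `2 (v / 2)`, which lies in none of the planes.
      rw [PiLp.single_apply, if_neg, add_zero]
      intro h
      rw [h] at hi
      obtain ⟨k, hk⟩ := hv
      have := j.2
      simp only at hi
      omega
    · rfl
  unfold thetaSlice
  simp only [Prod.fst_add, Prod.snd_add, add_zero, h1, h2]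
  have h3 : Complex.exp (Complex.I * ((r * (lastCoord (s • w.1) + Real.pi / r) : ℝ) : ℂ)) =
      -Complex.exp (Complex.I * ((r * lastCoord (s • w.1) : ℝ) : ℂ)) := by
    rw [mul_add, mul_div_cancel₀ _ hr.ne', Complex.ofReal_add, mul_add, Complex.exp_add,
      mul_comm Complex.I (Real.pi : ℂ), Complex.exp_pi_mul_I, mul_neg_one]
  rw [h3]
  ring

theorem lintegral_sq_thetaSlice_le {v : ℕ} {r : ℝ} {Λ : Fin (v / 2) → ℝ}
    {l : Fin (v / 2) → ℕ} {κ s₀ : ℝ} (hΛ : ∀ j, 0 < Λ j) (hs₀ : 0 < s₀) (j : Fin (v / 2))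
    (hj : 1 ≤ Λ j * (2 * l j + 1) * s₀ ^ 2) :
    ∫⁻ s in Ioi s₀, (∫⁻ w in gaugeBall (V v),
      ‖thetaSlice r Λ l κ (s • w.1, s ^ 2 * w.2)‖ₑ ^ 2) * ENNReal.ofReal s⁻¹ ≤
      ∫⁻ w in gaugeBall (V v),
        ENNReal.ofReal (6 + 2 * |w.1 ⟨2 * j, by omega⟩| ^ (-1 / 2 : ℝ)) := by
  have hΛj := hΛ j
  have hc1 := continuous_pr (v := v) j
  have hc2 := continuous_laguerreFun (l j)
  have hm : Measurable fun x : ℝ × (V v × ℝ) => ENNReal.ofReal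
      (laguerreFun (l j) (Λ j / 2 * (x.1 * ‖pr j x.2.1‖) ^ 2) ^ 2 * x.1⁻¹) := by
    have h1 : Continuous fun x : ℝ × (V v × ℝ) =>
        laguerreFun (l j) (Λ j / 2 * (x.1 * ‖pr j x.2.1‖) ^ 2) ^ 2 :=
      (hc2.comp (by fun_prop)).pow 2
    exact (h1.measurable.mul (by fun_prop)).ennreal_ofReal
  calc _ ≤ ∫⁻ s in Ioi s₀, ∫⁻ w in gaugeBall (V v), ENNReal.ofReal
        (laguerreFun (l j) (Λ j / 2 * (s * ‖pr j w.1‖) ^ 2) ^ 2 * s⁻¹) := by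
        refine setLIntegral_mono' measurableSet_Ioi fun s hs => ?_
        have hs' : 0 < s := hs₀.trans hs
        rw [← lintegral_mul_const' _ _ ENNReal.ofReal_ne_top]
        refine lintegral_mono fun w => ?_
        rw [ENNReal.ofReal_mul (sq_nonneg _)]
        gcongr
        have h := norm_thetaSlice_le (r := r) (l := l) hΛ κ (s • w.1, s ^ 2 * w.2) j
        dsimp only at h
        rw [pr_smul, norm_smul, Real.norm_eq_abs, abs_of_pos hs'] at h
        rw [← ofReal_norm, ← ENNReal.ofReal_pow (norm_nonneg _),
          ← sq_abs (laguerreFun (l j) (Λ j / 2 * (s * ‖pr j w.1‖) ^ 2))]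
        gcongr
    _ = ∫⁻ w in gaugeBall (V v), ∫⁻ s in Ioi s₀, ENNReal.ofReal
        (laguerreFun (l j) (Λ j / 2 * (s * ‖pr j w.1‖) ^ 2) ^ 2 * s⁻¹) :=
        lintegral_lintegral_swap hm.aemeasurable
    _ ≤ _ := by
        -- The one-dimensional bound is applied with `q = ‖pr j X‖`, which must be positive. Its
        -- negative power is then dominated by that of a single coordinate, whose integral over the
        -- ball is finite.
        have hae : ∀ᵐ w : V v × ℝ, w.1 ⟨2 * j, by omega⟩ ≠ 0 := by
          have h1 : ∀ᵐ x : Fin v → ℝ, x ⟨2 * j, by omega⟩ ≠ 0 :=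
            Measure.ae_eval_ne (μ := fun _ : Fin v => (volume : Measure ℝ)) _ _
          have h2 : ∀ᵐ X : V v, X ⟨2 * j, by omega⟩ ≠ 0 :=
            (PiLp.volume_preserving_ofLp (Fin v)).quasiMeasurePreserving.ae h1
          exact Measure.quasiMeasurePreserving_fst.ae h2
        refine lintegral_mono_ae ?_
        filter_upwards [ae_restrict_of_ae hae, ae_restrict_mem measurableSet_gaugeBall] with w hw0 hw
        have hw1 := norm_lt_one_of_mem_gaugeBall hw
        have hq := abs_coord_le_norm_pr j w.1
        have hp := abs_pos.mpr hw0
        have hq0 : 0 < ‖pr j w.1‖ := hp.trans_le hq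
        refine (lintegral_dilated_sq_laguerreFun_le (l j) hΛj hs₀ hj hq0
          ((norm_pr_le j w.1).trans hw1.1.le)).trans (ENNReal.ofReal_le_ofReal ?_)
        have := Real.rpow_le_rpow_of_nonpos hp hq (show (-1 / 2 : ℝ) ≤ 0 by norm_num)
        linarith

/-! ### Integration over small and large scales. -/

theorem setLIntegral_Ioc_le {σ K : ℝ} (hσ : 0 < σ) {f : ℝ → ℂ}
    (hf : ∀ s, 0 < s → σ * s ≤ 1 → ‖f s‖ ≤ K * (σ * s)) :
    ∫⁻ s in Ioc 0 σ⁻¹, ‖f s‖ₑ ^ 2 * ENNReal.ofReal s⁻¹ ≤ ENNReal.ofReal (K ^ 2) := by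
  calc _ ≤ ∫⁻ s in Ioc 0 σ⁻¹, ENNReal.ofReal (K ^ 2 * σ) := by
        refine setLIntegral_mono' measurableSet_Ioc fun s hs => ?_
        have hs0 : 0 < s := hs.1
        have hs1 : σ * s ≤ 1 := by
          have := mul_le_mul_of_nonneg_left hs.2 hσ.le
          rwa [mul_inv_cancel₀ hσ.ne'] at this
        have h := hf s hs0 hs1
        rw [← ofReal_norm, ← ENNReal.ofReal_pow (norm_nonneg _),
          ← ENNReal.ofReal_mul (by positivity)]
        refine ENNReal.ofReal_le_ofReal ?_
        calc ‖f s‖ ^ 2 * s⁻¹ ≤ (K * (σ * s)) ^ 2 * s⁻¹ := by gcongr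
          _ = K ^ 2 * σ * (σ * s) := by field_simp
          _ ≤ K ^ 2 * σ * 1 := by gcongr
          _ = _ := mul_one _
    _ = ENNReal.ofReal (K ^ 2) := by
        rw [lintegral_const, Measure.restrict_apply_univ, Real.volume_Ioc, sub_zero,
          ← ENNReal.ofReal_mul (by positivity), mul_assoc, mul_inv_cancel₀ hσ.ne', mul_one]

theorem setLIntegral_Ioi_le {σ K : ℝ} (hσ : 0 < σ) {f : ℝ → ℂ}
    (hf : ∀ s, 0 < s → ‖f s‖ ≤ K / (σ * s)) :
    ∫⁻ s in Ioi σ⁻¹, ‖f s‖ₑ ^ 2 * ENNReal.ofReal s⁻¹ ≤ ENNReal.ofReal (K ^ 2) := by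
  have hσ' : 0 < σ⁻¹ := inv_pos.mpr hσ
  have hint : IntegrableOn (fun s : ℝ => K ^ 2 / σ ^ 2 * s ^ (-3 : ℝ)) (Ioi σ⁻¹) :=
    (integrableOn_Ioi_rpow_of_lt (by norm_num) hσ').const_mul _
  calc _ ≤ ∫⁻ s in Ioi σ⁻¹, ENNReal.ofReal (K ^ 2 / σ ^ 2 * s ^ (-3 : ℝ)) := by
        refine setLIntegral_mono' measurableSet_Ioi fun s hs => ?_
        have hs0 : 0 < s := hσ'.trans hs
        have h := hf s hs0
        rw [← ofReal_norm, ← ENNReal.ofReal_pow (norm_nonneg _),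
          ← ENNReal.ofReal_mul (by positivity)]
        refine ENNReal.ofReal_le_ofReal ?_
        calc ‖f s‖ ^ 2 * s⁻¹ ≤ (K / (σ * s)) ^ 2 * s⁻¹ := by gcongr
          _ = K ^ 2 / σ ^ 2 * (s ^ 3)⁻¹ := by field_simp
          _ = _ := by rw [Real.rpow_neg hs0.le]; norm_cast
    _ = ENNReal.ofReal (K ^ 2 / 2) := by
        rw [← ofReal_integral_eq_lintegral_ofReal hint
          ((ae_restrict_mem measurableSet_Ioi).mono fun s hs => by
            have : 0 < s := hσ'.trans hs
            positivity), integral_const_mul, integral_Ioi_rpow_of_lt (by norm_num) hσ']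
        congr 1
        rw [show (-3 + 1 : ℝ) = -(2 : ℕ) by norm_num, Real.rpow_neg hσ'.le, Real.rpow_natCast]
        field_simp
        norm_num
    _ ≤ _ := ENNReal.ofReal_le_ofReal (by nlinarith [sq_nonneg K])

/-- The linear combination of Bochner-Riesz integrals giving `s ^ h ∂_s ^ h` of the spherical
mean. -/
def rieszComb {E : Type} [NormedAddCommGroup E] [InnerProductSpace ℝ E] [FiniteDimensional ℝ E]
    [MeasurableSpace E] [BorelSpace E] (a : ℕ → ℝ) (q : ℝ) (h : ℕ) (G : E × ℝ → ℂ) : ℂ :=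
  ∑ i ∈ Finset.range (h + 1), (a i : ℂ) * rieszInt G (q - i) 1

/-! ### Bounds for linear combinations of Bochner-Riesz integrals. -/

section RieszComb

variable {E : Type} [NormedAddCommGroup E] [InnerProductSpace ℝ E] [FiniteDimensional ℝ E]
  [MeasurableSpace E] [BorelSpace E]

theorem norm_rieszComb_le (a : ℕ → ℝ) {q : ℝ} {h : ℕ} (hq : h ≤ q) (G : E × ℝ → ℂ) {B : ℝ}
    (hB : ∀ p, 0 ≤ p → ‖rieszInt G p 1‖ ≤ B) :
    ‖rieszComb a q h G‖ ≤ (∑ i ∈ Finset.range (h + 1), |a i|) * B := by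
  rw [rieszComb, Finset.sum_mul]
  refine norm_sum_le_of_le _ fun i hi => ?_
  have hi' : (i : ℝ) ≤ h := by exact_mod_cast Nat.lt_succ_iff.mp (Finset.mem_range.mp hi)
  rw [norm_mul, Complex.norm_real, Real.norm_eq_abs]
  exact mul_le_mul_of_nonneg_left (hB _ (by linarith)) (abs_nonneg _)

/-- Since the combination annihilates `G'`, only the deviation of `G` from `G'` matters; it is used
with `G' = 1`. -/
theorem norm_rieszComb_le_of_sub (a : ℕ → ℝ) {q : ℝ} {h : ℕ} (hq : h ≤ q) {G G' : E × ℝ → ℂ}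
    {B : ℝ} (hB : ∀ p, 0 ≤ p → ‖rieszInt G p 1 - rieszInt G' p 1‖ ≤ B)
    (hG' : rieszComb a q h G' = 0) :
    ‖rieszComb a q h G‖ ≤ (∑ i ∈ Finset.range (h + 1), |a i|) * B := by
  rw [← sub_zero (rieszComb a q h G), ← hG', rieszComb, rieszComb, ← Finset.sum_sub_distrib,
    Finset.sum_mul]
  refine norm_sum_le_of_le _ fun i hi => ?_
  have hi' : (i : ℝ) ≤ h := by exact_mod_cast Nat.lt_succ_iff.mp (Finset.mem_range.mp hi)
  rw [← mul_sub, norm_mul, Complex.norm_real, Real.norm_eq_abs]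
  exact mul_le_mul_of_nonneg_left (hB _ (by linarith)) (abs_nonneg _)

theorem sq_enorm_rieszComb_le (a : ℕ → ℝ) {q : ℝ} {h : ℕ} (hq : h ≤ q) {G : E × ℝ → ℂ}
    (hG : Measurable G) :
    ‖rieszComb a q h G‖ₑ ^ 2 ≤ (∑ i ∈ Finset.range (h + 1), ‖a i‖ₑ) ^ 2 *
      (volume (gaugeBall E) * ∫⁻ w in gaugeBall E, ‖G w‖ₑ ^ 2) := by
  set Y := volume (gaugeBall E) * ∫⁻ w in gaugeBall E, ‖G w‖ₑ ^ 2 with hY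
  have hroot : ∀ p, 0 ≤ p → ‖rieszInt G p 1‖ₑ ≤ Y ^ (1 / 2 : ℝ) := by
    intro p hp
    have h1 := ENNReal.rpow_le_rpow (sq_enorm_rieszInt_le hG hp) (show (0 : ℝ) ≤ 1 / 2 by norm_num)
    rwa [← ENNReal.rpow_natCast, ← ENNReal.rpow_mul,
      show ((2 : ℕ) : ℝ) * (1 / 2) = 1 by norm_num, ENNReal.rpow_one] at h1
  have h2 : ‖rieszComb a q h G‖ₑ ≤ (∑ i ∈ Finset.range (h + 1), ‖a i‖ₑ) * Y ^ (1 / 2 : ℝ) := by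
    rw [rieszComb, Finset.sum_mul]
    refine (enorm_sum_le _ _).trans (Finset.sum_le_sum fun i hi => ?_)
    have hi' : (i : ℝ) ≤ h := by exact_mod_cast Nat.lt_succ_iff.mp (Finset.mem_range.mp hi)
    rw [enorm_mul]
    have e : ‖(a i : ℂ)‖ₑ = ‖a i‖ₑ := by
      rw [← ofReal_norm, ← ofReal_norm, Complex.norm_real]
    rw [e]
    exact mul_le_mul_right (hroot _ (by linarith)) _
  refine (pow_le_pow_left' h2 2).trans (le_of_eq ?_)
  rw [mul_pow, ← ENNReal.rpow_natCast (Y ^ (1 / 2 : ℝ)), ← ENNReal.rpow_mul]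
  norm_num

end RieszComb

/-- The square function of a linear combination of Bochner-Riesz integrals of `Θ` is bounded
uniformly over the parameters. -/
theorem exists_lintegral_rieszComb_le {v : ℕ} (hv : 4 ≤ v) (a : ℕ → ℝ) {q : ℝ} {h : ℕ}
    (hq : h ≤ q) (ha : rieszComb a q h (fun _ : V v × ℝ => 1) = 0) :
    ∃ T : ℝ≥0∞, T < ⊤ ∧ ∀ (r : ℝ) (Λ : Fin (v / 2) → ℝ) (l : Fin (v / 2) → ℕ), (r, Λ, l) ∈ P v →
      ∫⁻ s in Ioi (0 : ℝ), ‖rieszComb a q h (fun w : V v × ℝ =>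
        thetaSlice r Λ l ‖(ofSkew (D2 Λ) : Z v)‖ (s • w.1, s ^ 2 * w.2))‖ₑ ^ 2 *
        ENNReal.ofReal s⁻¹ ≤ T := by
  set A : ℝ := ∑ i ∈ Finset.range (h + 1), |a i| with hA
  have hA0 : 0 ≤ A := Finset.sum_nonneg fun _ _ => abs_nonneg _
  set U := (volume (gaugeBall (V v))).toReal with hU
  set K₁ : ℝ := A * ((zdim v + v + 2) * U) with hK₁
  set K₂ : ℝ := A * (2 ^ v * Real.pi) with hK₂
  set J : Fin v → ℝ≥0∞ := fun i => ∫⁻ w in gaugeBall (V v),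
    ENNReal.ofReal (6 + 2 * |w.1 i| ^ (-1 / 2 : ℝ)) with hJ
  set K₃ : ℝ≥0∞ := (∑ i ∈ Finset.range (h + 1), ‖a i‖ₑ) ^ 2 * volume (gaugeBall (V v)) *
    ∑ i, J i with hK₃
  refine ⟨ENNReal.ofReal (K₁ ^ 2) + (ENNReal.ofReal (K₂ ^ 2) + K₃), ?_, ?_⟩
  · have hK₃' : K₃ < ⊤ := by
      refine ENNReal.mul_lt_top (ENNReal.mul_lt_top (ENNReal.pow_lt_top ?_)
        volume_gaugeBall_lt_top) ?_
      · exact ENNReal.sum_lt_top.mpr fun i _ => enorm_lt_top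
      · exact ENNReal.sum_lt_top.mpr fun i _ => setLIntegral_gaugeBall_rpow_lt_top i
    exact ENNReal.add_lt_top.mpr ⟨ENNReal.ofReal_lt_top,
      ENNReal.add_lt_top.mpr ⟨ENNReal.ofReal_lt_top, hK₃'⟩⟩
  intro r Λ l hP
  obtain ⟨-, hΛ, hodd, heven⟩ := hP
  simp only at hΛ hodd heven
  set κ := ‖(ofSkew (D2 Λ) : Z v)‖ with hκ
  have hr0 : 0 ≤ r := by
    rcases Nat.even_or_odd v with h | h
    · exact (heven h).ge
    · exact (hodd h).le
  have hG1 : ∀ s (w : V v × ℝ), ‖thetaSlice r Λ l κ (s • w.1, s ^ 2 * w.2)‖ ≤ 1 :=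
    fun s w => norm_thetaSlice_le_one hΛ κ _
  -- The plane of largest frequency; its Laguerre factor is the one kept when the Laguerre part
  -- dominates.
  obtain ⟨j, -, hj⟩ := Finset.exists_max_image (Finset.univ : Finset (Fin (v / 2)))
    (fun j => Λ j * (2 * l j + 1)) ⟨⟨0, by omega⟩, Finset.mem_univ _⟩
  have hmj : 0 < Λ j * (2 * l j + 1) := by have := hΛ j; positivity
  set σ : ℝ := max r (Real.sqrt (Λ j * (2 * l j + 1))) with hσ
  have hσ0 : 0 < σ := (Real.sqrt_pos.mpr hmj).trans_le (le_max_right _ _)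
  have hσj : ∀ i, Λ i * (2 * l i + 1) ≤ σ ^ 2 := fun i => (hj i (Finset.mem_univ i)).trans
    (Real.sqrt_le_left hσ0.le |>.mp (le_max_right _ _))
  have hΛσ : ∀ i, Λ i ≤ σ ^ 2 := fun i => by
    refine le_trans ?_ (hσj i)
    have h1 := hΛ i
    have h2 : (0 : ℝ) ≤ l i := Nat.cast_nonneg _
    nlinarith
  have hκσ : |κ| ≤ (zdim v + 1) * σ ^ 2 := by
    rw [abs_of_nonneg (norm_nonneg _)]
    exact norm_ofSkew_D2_le hΛ hΛσ (by positivity)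
  rw [← Ioc_union_Ioi_eq_Ioi (inv_pos.mpr hσ0).le]
  refine (lintegral_union_le _ _ _).trans (add_le_add ?_ ?_)
  · refine setLIntegral_Ioc_le hσ0 fun s hs hσs => ?_
    have hb := norm_rieszComb_le_of_sub a hq (B := (zdim v + v + 2) * (σ * s) * U)
      (fun p hp => norm_rieszInt_one_sub_le (measurable_thetaSlice_dil r Λ l κ s) (hG1 s) hp
        fun w hw => norm_thetaSlice_sub_one_le hΛ (by
          rw [abs_of_nonneg hr0]; exact le_max_left _ _) hσj hκσ hs hσs hw) ha
    refine hb.trans (le_of_eq ?_)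
    rw [hK₁]; ring
  -- Large scales: either `σ` is the Laguerre frequency of plane `j`, or `σ = r`.
  · rcases le_or_gt r (Real.sqrt (Λ j * (2 * l j + 1))) with hr | hr
    · refine le_trans ?_ le_add_self
      have hσ2 : σ ^ 2 = Λ j * (2 * l j + 1) := by
        rw [hσ, max_eq_right hr, Real.sq_sqrt hmj.le]
      have h1 := lintegral_sq_thetaSlice_le (r := r) (κ := κ) hΛ (inv_pos.mpr hσ0) j
        (by rw [← hσ2, inv_pow, mul_inv_cancel₀ (by positivity)])
      calc _ ≤ ∫⁻ s in Ioi σ⁻¹, (∑ i ∈ Finset.range (h + 1), ‖a i‖ₑ) ^ 2 *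
            volume (gaugeBall (V v)) * ((∫⁻ w in gaugeBall (V v),
            ‖thetaSlice r Λ l κ (s • w.1, s ^ 2 * w.2)‖ₑ ^ 2) * ENNReal.ofReal s⁻¹) := by
            refine lintegral_mono fun s => ?_
            have h2 := sq_enorm_rieszComb_le a hq (measurable_thetaSlice_dil r Λ l κ s)
            refine (mul_le_mul_left h2 _).trans (le_of_eq ?_)
            simp only [mul_assoc]
        _ = (∑ i ∈ Finset.range (h + 1), ‖a i‖ₑ) ^ 2 * volume (gaugeBall (V v)) *
            ∫⁻ s in Ioi σ⁻¹, (∫⁻ w in gaugeBall (V v),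
            ‖thetaSlice r Λ l κ (s • w.1, s ^ 2 * w.2)‖ₑ ^ 2) * ENNReal.ofReal s⁻¹ := by
            refine lintegral_const_mul' _ _ (ENNReal.mul_lt_top (ENNReal.pow_lt_top ?_)
              volume_gaugeBall_lt_top).ne
            exact ENNReal.sum_lt_top.mpr fun i _ => enorm_lt_top
        _ ≤ K₃ := by
            refine mul_le_mul_right (h1.trans ?_) _
            exact Finset.single_le_sum (f := J) (fun _ _ => zero_le) (Finset.mem_univ _)
    · refine le_trans ?_ le_self_add
      have hr0' : 0 < r := (Real.sqrt_nonneg _).trans_lt hr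
      have hvo : Odd v := by
        by_contra hne
        -- The second case forces `r > 0`, which is excluded for even `v`; so the free last
        -- coordinate is available.
        exact hr0'.ne' (heven (Nat.not_odd_iff_even.mp hne))
      have hσr : σ = r := by rw [hσ, max_eq_left hr.le]
      rw [hσr]
      refine setLIntegral_Ioi_le hr0' fun s hs => ?_
      have hb := norm_rieszComb_le a hq _
        fun p hp => norm_rieszInt_thetaSlice_le hvo (l := l) (κ := κ) hΛ hr0' hs hp
      refine hb.trans (le_of_eq ?_)
      rw [hK₂]; ring

/-! ### Assembly of the uniform bound. -/

theorem exists_unit_smul_eq {v : ℕ} (hv : 4 ≤ v) (D : Z v) : ∃ u : Z v, ‖u‖ = 1 ∧ D = ‖D‖ • u := by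
  by_cases hD : D = 0
  · refine ⟨EuclideanSpace.single ⟨(⟨0, by omega⟩, ⟨1, by omega⟩), by simp⟩ 1, ?_, ?_⟩
    · rw [PiLp.norm_single, norm_one]
    · rw [hD, norm_zero, zero_smul]
  · have h : ‖D‖ ≠ 0 := norm_ne_zero_iff.mpr hD
    refine ⟨‖D‖⁻¹ • D, ?_, ?_⟩
    · rw [norm_smul, norm_inv, norm_norm, inv_mul_cancel₀ h]
    · rw [smul_smul, mul_inv_cancel₀ h, one_smul]

/-- The spherical means of the spherical functions in terms of Bochner-Riesz integrals. -/
theorem sphereMean_phi_eq_derivSum {v : ℕ} (hv : 4 ≤ v) {r : ℝ} {Λ : Fin (v / 2) → ℝ}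
    {l : Fin (v / 2) → ℕ} (hΛ : ∀ j, 0 < Λ j) {s : ℝ} (hs : 0 < s) :
    sphereMean (v := v) (phi r Λ l) s =
      ((volume (Metric.ball (0 : EuclideanSpace ℝ (Fin (zdim v - 1))) 1)).toReal *
        (2 * (zdim v - 1)) : ℝ) * derivSum (4 - homDim v) ((zdim v - 3) / 2)
        (fun i s => rieszInt (thetaSlice (v := v) r Λ l ‖(ofSkew (D2 Λ) : Z v)‖)
          ((zdim v - 3) / 2 - i) (s ^ 4)) 0 s := by
  obtain ⟨u, hu, hDu⟩ := exists_unit_smul_eq hv (ofSkew (D2 Λ))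
  rw [sphereMean_phi hΛ hDu, sphereMean_eq_rieszInt hv hu (continuous_thetaSlice _ _ _ _)
    (fun w => norm_thetaSlice_le_one hΛ _ w) hs]
  simp [derivSum, derivCoeff]

/-- The weight `s^(2h-1)` is `(s^h)² s⁻¹`; `h ≥ 1` keeps the natural subtraction honest. -/
theorem lintegral_iteratedDeriv_eq {f : ℝ → ℂ} {D : ℝ → ℂ} {h : ℕ} (h1 : 1 ≤ h)
    (hf : ∀ s, 0 < s → f s * (s ^ h : ℝ) = D s) :
    ∫⁻ s in Ioi (0 : ℝ), ‖f s‖ₑ ^ 2 * ENNReal.ofReal (s ^ (2 * h - 1)) =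
      ∫⁻ s in Ioi (0 : ℝ), ‖D s‖ₑ ^ 2 * ENNReal.ofReal s⁻¹ := by
  refine setLIntegral_congr_fun measurableSet_Ioi fun s hs => ?_
  have hs0 : 0 < s := hs
  rw [← hf s hs0, ← ofReal_norm, ← ofReal_norm, ← ENNReal.ofReal_pow (norm_nonneg _),
    ← ENNReal.ofReal_pow (norm_nonneg _), ← ENNReal.ofReal_mul (by positivity),
    ← ENNReal.ofReal_mul (by positivity), norm_mul, Complex.norm_real, Real.norm_eq_abs,
    abs_of_pos (by positivity : 0 < s ^ h)]
  congr 1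
  obtain ⟨k, rfl⟩ : ∃ k, h = k + 1 := ⟨h - 1, by omega⟩
  rw [show 2 * (k + 1) - 1 = 2 * k + 1 by omega]
  field_simp
  ring

/-- Uniform bound of the square function of the spherical functions. -/
theorem exists_Shat_phi_le {v : ℕ} (hv : 4 ≤ v) {h : ℕ} (h1 : 1 ≤ h)
    (h2 : (h : ℝ) < ((zdim v : ℝ) - 2) / 2) :
    ∃ C : ℝ, 0 < C ∧ ∀ r Λ l, (r, Λ, l) ∈ P v →
      ContDiffOn ℝ h (sphereMean (v := v) (phi r Λ l)) (Ioi 0) ∧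
      Shat (v := v) h (phi r Λ l) ≤ ENNReal.ofReal C := by
  set q : ℝ := ((zdim v : ℝ) - 3) / 2 with hq
  set m : ℤ := 4 - homDim v with hm
  set c : ℝ := (volume (Metric.ball (0 : EuclideanSpace ℝ (Fin (zdim v - 1))) 1)).toReal *
    (2 * (zdim v - 1)) with hc
  -- Integrality gains the missing half: `2h + 2 < z` means `2h + 3 ≤ z`. So all exponents `q - i`
  -- with `i ≤ h` are nonnegative, with 0 allowed.
  have hhq : (h : ℝ) ≤ q := by
    have h3 : ((2 * h + 2 : ℕ) : ℝ) < zdim v := by push_cast; linarith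
    have h4 : 2 * h + 3 ≤ zdim v := by exact_mod_cast h3
    have h5 : ((2 * h + 3 : ℕ) : ℝ) ≤ zdim v := by exact_mod_cast h4
    push_cast at h5
    rw [hq]
    linarith
  -- As `Q = v + 2z`, the prefactor exponent `4 - Q` is exactly the one that cancels the homogeneity
  -- `v + 2 + 4q`.
  have hmq : (m : ℝ) = -(Module.finrank ℝ (V v) + 2 + 4 * q) := by
    rw [hm, hq, finrank_euclideanSpace, Fintype.card_fin, homDim]
    push_cast
    ring
  obtain ⟨T, hT, hbound⟩ := exists_lintegral_rieszComb_le hv (derivCoeff m q h) hhq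
    (sum_derivCoeff_mul_rieszInt_one (E := V v) hmq hhq h1)
  set B : ℝ≥0∞ := (‖c‖ₑ ^ 2 * T) ^ (1 / 2 : ℝ) with hB
  have hBt : B < ⊤ := ENNReal.rpow_lt_top_of_nonneg (by norm_num)
    (ENNReal.mul_lt_top (ENNReal.pow_lt_top enorm_lt_top) hT).ne
  -- Adding 1 only ensures that the constant is strictly positive.
  refine ⟨B.toReal + 1, by positivity, fun r Λ l hP => ?_⟩
  have hΛ : ∀ j, 0 < Λ j := hP.2.1
  set G : V v × ℝ → ℂ := thetaSlice r Λ l ‖(ofSkew (D2 Λ) : Z v)‖ with hG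
  have hGm : Measurable G := (continuous_thetaSlice _ _ _ _).measurable
  have hG1 : ∀ w, ‖G w‖ ≤ 1 := fun w => norm_thetaSlice_le_one hΛ _ w
  set F : ℝ → ℂ := derivSum m q (fun i s => rieszInt G (q - i) (s ^ 4)) 0 with hF
  have hcd : ContDiffOn ℝ h F (Ioi 0) := contDiffOn_rieszInt hGm hG1 m hhq
  have hmean : ∀ s, 0 < s → sphereMean (phi r Λ l) s = (c : ℂ) * F s :=
    fun s hs => sphereMean_phi_eq_derivSum hv hΛ hs
  refine ⟨(contDiffOn_const.mul hcd).congr fun s hs => hmean s hs, ?_⟩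
  have hder : ∀ s, 0 < s → iteratedDeriv h (sphereMean (phi r Λ l)) s * (s ^ h : ℝ) =
      (c : ℂ) * rieszComb (derivCoeff m q h) q h (fun w : V v × ℝ => G (s • w.1, s ^ 2 * w.2)) := by
    intro s hs
    have e1 : sphereMean (phi r Λ l) =ᶠ[nhds s] fun s => (c : ℂ) * F s := by
      filter_upwards [Ioi_mem_nhds hs] with t ht
      exact hmean t ht
    rw [e1.iteratedDeriv_eq, iteratedDeriv_const_mul_field, mul_assoc,
      iteratedDeriv_rieszInt_mul_pow hGm hG1 hmq hhq hs, rieszComb]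
  have hlast : ∫⁻ s in Ioi (0 : ℝ), ‖iteratedDeriv h (sphereMean (phi r Λ l)) s‖ₑ ^ 2 *
      ENNReal.ofReal (s ^ (2 * h - 1)) ≤ ‖c‖ₑ ^ 2 * T := by
    rw [lintegral_iteratedDeriv_eq h1 hder]
    have e : ‖(c : ℂ)‖ₑ = ‖c‖ₑ := by rw [← ofReal_norm, ← ofReal_norm, Complex.norm_real]
    simp only [enorm_mul, mul_pow, e, mul_assoc]
    rw [lintegral_const_mul' _ _ (ENNReal.pow_lt_top enorm_lt_top).ne]
    exact mul_le_mul_right (hbound r Λ l hP) _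
  calc Shat h (phi r Λ l) ≤ B := ENNReal.rpow_le_rpow hlast (by norm_num)
    _ = ENNReal.ofReal B.toReal := (ENNReal.ofReal_toReal hBt.ne).symm
    _ ≤ ENNReal.ofReal (B.toReal + 1) := ENNReal.ofReal_le_ofReal (by linarith)

end FreeTwoStep

end

theorem mainTheorem5 (v : ℕ) (hv : 4 ≤ v) (h : ℕ) (h1 : 1 ≤ h)
    (h2 : (h : ℝ) < ((FreeTwoStep.zdim v : ℝ) - 2) / 2) :
    ∃ C : ℝ, 0 < C ∧ ∀ r Λ l, (r, Λ, l) ∈ FreeTwoStep.P v →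
      ContDiffOn ℝ h (FreeTwoStep.sphereMean (v := v) (FreeTwoStep.phi r Λ l)) (Set.Ioi 0) ∧
      FreeTwoStep.Shat (v := v) h (FreeTwoStep.phi r Λ l) ≤ ENNReal.ofReal C :=
  FreeTwoStep.exists_Shat_phi_le hv h1 h2
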